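/- **Setting.** Let $T\ge 1$, let $\omega$ be a primitive $T$-th root of unity and let $\mathfrak g$ be a finite-dimensional complex Lie algebra with a non-degenerate invariant symmetric bilinear form $\langle\cdot,\cdot\rangle$, a linear automorphism $\sigma$ with $\sigma^T=1$ preserving the form, and an anti-linear involutive automorphism $\tau$ which stabilizes every eigenspace of $\sigma$ and satisfies $\langle\tau x,\tau y\rangle=\overline{\langle x,y\rangle}$. Let $\widetilde{\mathfrak g}=\mathfrak g\otimes\mathbb C[t,t^{-1}]\oplus\mathbb C\mathsf K\oplus\mathbb C\mathsf D$ be the affine algebra, with $[x_m,y_n]=[x,y]_{m+n}+m\,\delta_{m+n,0}\langle x,y\rangle\mathsf K$, $\mathsf K$ central, $[\mathsf D,x_n]=n\,x_n$ (where $x_n=x\otimes t^n$), and invariant form $(x_m|y_n)=\delta_{m+n,0}\langle x,y\rangle$, $(\mathsf K|\mathsf D)=1$, the other pairings being zero. Extend $\sigma$ by $x_n\mapsto(\sigma x)_n$, $\mathsf K\mapsto\mathsf K$, $\mathsf D\mapsto\mathsf D$, and $\tau$ anti-linearly by $x_n\mapsto(\tau x)_{-n}$, $\mathsf K\mapsto-\mathsf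 K$, $\mathsf D\mapsto-\mathsf D$. The dihedral group $\Pi=\langle\mathsf s,\mathsf t\rangle$ of order $2T$ acts on $\mathbb P^1$ by $\mathsf s:z\mapsto\omega z$, $\mathsf t:z\mapsto\bar z$. Let $\mathcal D=\sum_{x\in\boldsymbol z}n_x x$ ($n_x\ge1$) be a divisor supported on a finite set $\boldsymbol z\ni\infty$ of points in distinct $\Pi$-orbits, and write $\Pi\boldsymbol z$ for the union of these orbits. Let $\Pi_x$ be the stabilizer of $x$ and $\Gamma_x$ its subgroup of rotations. Let $\widetilde{\mathfrak g}^{\mathcal D}$ be the real Lie algebra of elements of $\bigoplus_{x\in\boldsymbol z\setminus\{\infty\}}\widetilde{\mathfrak g}\otimes\mathbb C[\varepsilon_x]/(\varepsilon_x^{n_x})\oplus\widetilde{\mathfrak g}\otimes\varepsilon_\infty\mathbb C[\varepsilon_\infty]/(\varepsilon_\infty^{n_\infty})$ whose component at each $x$ is $\Pi_x$-invariant, where $\mathsf s$ acts by $\mathsf X\varepsilon_x^p\mapsto\omega^{-p}\sigma(\mathsf X)\varepsilon_x^p$ (with $\omega^{p}$ in place of $\omega^{-p}$ if $x=\infty$)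 and $\mathsf t$ by $\mathsf X\varepsilon_x^p\mapsto\tau(\mathsf X)\varepsilon_x^p$. Let $\widetilde{\mathfrak g}^{\mathcal D}_{\mathbb C}=\widetilde{\mathfrak g}^{\mathcal D}\otimes_{\mathbb R}\mathbb C$, let $c$ be complex conjugation in its second factor, and let $\phi$ be the $\mathbb C$-linear extension to $\widetilde{\mathfrak g}^{\mathcal D}_{\mathbb C}$ of the inclusion of $\widetilde{\mathfrak g}^{\mathcal D}$ in the sum above. For $x\in\boldsymbol z$, $\mathsf X\in\widetilde{\mathfrak g}$ put $\mathsf X^{(x)}_p=\mathrm{pr}(\mathsf X)\otimes1-\mathrm{pr}(i\mathsf X)\otimes i$ with $\mathrm{pr}(\mathsf X)=\frac1{2|\Gamma_x|}\sum_{\alpha\in\Pi_x}\alpha.(\mathsf X\varepsilon_x^p)$; it is zero if $p\geq n_x$, and if $(x,p)=(\infty,0)$. Let $\mathsf F_n\widetilde{\mathfrak g}=\mathfrak g\otimes t^n\mathbb C[t]$, $\overline{\mathsf F}_n\widetilde{\mathfrak g}=\mathfrak g\otimes t^{-n}\mathbb C[t^{-1}]$, and let $\mathsf F_n=\mathsf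 F_n\widetilde{\mathfrak g}^{\mathcal D}_{\mathbb C}$ be the space of all $v$ such that all components of $\phi(v)$ are in $\mathsf F_n\widetilde{\mathfrak g}$ and all components of $\phi(c(v))$ are in $\overline{\mathsf F}_n\widetilde{\mathfrak g}$. Let $S=S(\widetilde{\mathfrak g}^{\mathcal D}_{\mathbb C})$ with its Lie-Poisson bracket. The algebra $\hat S$ of formal observables is the completion of $S$ along $\mathsf F_nS\cap c(\mathsf F_n)S$; the space $\mathfrak F$ of formal fields is the completion of $\widetilde{\mathfrak g}\otimes\widetilde{\mathfrak g}^{\mathcal D}_{\mathbb C}$ along $\mathsf F_n\widetilde{\mathfrak g}\otimes c(\mathsf F_n)+\overline{\mathsf F}_n\widetilde{\mathfrak g}\otimes\mathsf F_n$; and $\widetilde{\mathfrak g}\,\hat\otimes\,\hat S$ is the completion of $\widetilde{\mathfrak g}\otimes S$ along $\mathsf F_n\widetilde{\mathfrak g}\otimes c(\mathsf F_n)S+\overline{\mathsf F}_n\widetilde{\mathfrak g}\otimes\mathsf F_nS+\widetilde{\mathfrak g}\otimes(\mathsf F_nS\cap c(\mathsf F_n)S)$. The Poisson bracket of $S$ and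 the bilinear maps $(\mathsf X\otimes u|\mathsf Y\otimes v)=(\mathsf X|\mathsf Y)uv$, $[\mathsf X\otimes u,\mathsf Y\otimes v]=[\mathsf X,\mathsf Y]\otimes uv$, $\{f,\mathsf X\otimes u\}=\mathsf X\otimes\{f,u\}$ are continuous and extend to $\{\cdot,\cdot\}:\hat S\times\hat S\to\hat S$, $(\cdot|\cdot):\mathfrak F\times\mathfrak F\to\hat S$, $[\cdot,\cdot]:\mathfrak F\times\mathfrak F\to\widetilde{\mathfrak g}\,\hat\otimes\,\hat S$ and $\{\cdot,\cdot\}:\hat S\times\mathfrak F\to\widetilde{\mathfrak g}\,\hat\otimes\,\hat S$; $\sigma$ acts on $\mathfrak F$ through the factor $\widetilde{\mathfrak g}$. Let $\mathcal Z$ be the union of $\boldsymbol z$ and of the complex conjugates of the points of $\boldsymbol z$ with trivial stabilizer, and $\mathcal Z'=\mathcal Z\setminus\{0,\infty\}$. With $(I_{\tilde a})$ the basis of $\widetilde{\mathfrak g}$ formed of $(I_a)_{-n}$ ($I_a$ running over a basis of $\mathfrak g$, $n\in\mathbb Z$), $\mathsf K$, $\mathsf D$, and $(I^{\tilde a})$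 the dual basis, define formal fields in $\mathfrak F$ by $\mathcal A^x_p=\sum_{\tilde a}I_{\tilde a}\otimes(I^{\tilde a})^{(x)}_p$ for $x\in\boldsymbol z$ and $\mathcal A^{\bar x}_p=\sum_{\tilde a}\tau I_{\tilde a}\otimes c\big((I^{\tilde a})^{(x)}_p\big)$ for $x\in\boldsymbol z$ with trivial stabilizer; put $\mathcal A^0_p=0$ if $0\notin\boldsymbol z$. They vanish for large $p$. For $z\in\mathbb C\setminus\Pi\boldsymbol z$ the formal Lax matrix is $$\mathcal L(z)=\frac1T\sum_{k=0}^{T-1}\sum_{x\in\mathcal Z'}\sum_{p\ge0}\frac{\omega^{-k}\sigma^k\mathcal A^x_p}{(\omega^{-k}z-x)^{p+1}}+\sum_{p\ge0}\mathcal A^0_pz^{-p-1}-\sum_{q\ge0}\mathcal A^\infty_{q+1}z^q .$$ The formal quadratic Gaudin Hamiltonians are the elements of $\hat S$ $$\mathcal H^x_p=\sum_{\substack{0\le\ell<T,\ y\in\mathcal Z'\cup\{0\}\\(\ell,y)\ne(0,x)}}\ \sum_{q,s\ge0}(-1)^s\binom{q+s}{s}\frac{\omega^{\ell q}(\mathcal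 A^x_{p+s}|\sigma^\ell\mathcal A^y_q)}{(x-\omega^\ell y)^{q+s+1}}-T\sum_{q,s\ge0}\binom qs x^{q-s}(\mathcal A^x_{p+s}|\mathcal A^\infty_{q+1})+\frac12\sum_{q=0}^{p-1}(\mathcal A^x_q|\mathcal A^x_{p-q-1})$$ for $x\in\mathcal Z'$ and $p\ge0$, $$\mathcal H^0_p=\sum_{x\in\mathcal Z'}\sum_{q,s\ge0}(-1)^{q+1}\binom{q+s}{s}\frac{(\mathcal A^0_{p+s}|\mathcal A^x_q)}{x^{q+s+1}}-\sum_{q\ge0}(\mathcal A^0_{p+q}|\mathcal A^\infty_{q+1})+\frac12\sum_{q=0}^{p-1}(\mathcal A^0_{p-q-1}|\mathcal A^0_q)$$ for $p\ge0$ with $p\equiv1\bmod T$, and $$\mathcal H^\infty_q=-\sum_{x\in\mathcal Z'}\sum_{p,s\ge0}\binom sp x^{s-p}(\mathcal A^x_p|\mathcal A^\infty_{q+s+2})-\sum_{p\ge0}(\mathcal A^0_p|\mathcal A^\infty_{q+p+2})+\frac12\sum_{p=0}^q(\mathcal A^\infty_{p+1}|\mathcal A^\infty_{q-p+1})$$ for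 $q\ge0$ with $q+2\equiv0\bmod T$. **Statement.** 1. The Hamiltonians are the coefficients of $\frac12(\mathcal L(z)|\mathcal L(z))$: for all $z\in\mathbb C\setminus\Pi\boldsymbol z$, $$\tfrac12(\mathcal L(z)|\mathcal L(z))=\frac1{T^2}\sum_{k=0}^{T-1}\sum_{x\in\mathcal Z'}\sum_{p\ge0}\frac{\omega^{k(p-1)}\mathcal H^x_p}{(z-\omega^kx)^{p+1}}+\sum_{\substack{p\ge0\\p\equiv1\bmod T}}\mathcal H^0_pz^{-p-1}+\sum_{\substack{q\ge0\\q+2\equiv0\bmod T}}\mathcal H^\infty_qz^q .$$ 2. They Poisson commute: $\{\mathcal H^x_p,\mathcal H^y_q\}=0$ for all $x,y\in\mathcal Z$ and all $p,q\ge0$ (with the above congruences on the index when the point is $0$ or $\infty$). 3. Each of them generates a Lax equation: $\{\mathcal H^x_p,\mathcal L(z)\}=[\mathcal M^x_p(z),\mathcal L(z)]$ for all $z\in\mathbb C\setminus\Pi\boldsymbol z$, all $x\in\mathcal Z$ and all $p\geq0$ (with the same congruences), where $$\mathcal M^x_p(z)=\sum_{\ell=0}^{T-1}\sum_{s\ge0}\frac{\sigma^\ell\mathcal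 A^x_{p+s}}{(\omega^{-\ell}z-x)^{s+1}}\ (x\in\mathcal Z'),\qquad \mathcal M^0_q(z)=\sum_{s\ge0}\mathcal A^0_{q+s}z^{-s-1},\qquad \mathcal M^\infty_r(z)=\sum_{s\ge0}\mathcal A^\infty_{r+s+2}z^s .$$ -/

import Mathlib

open scoped TensorProduct ComplexConjugate

set_option linter.unusedSectionVars false

noncomputable section

namespace Gaudin

section Setup

/-- The action of the dihedral group on the Riemann sphere: the rotation `s = r 1` acts by
`z ↦ ω z`, the reflection `t = sr 0` by `z ↦ conj z`, and `sr i = t s ^ i`. -/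
def mobius {T : ℕ} (ω : ℂ) : DihedralGroup T → OnePoint ℂ → OnePoint ℂ
  | .r i => OnePoint.map fun z => ω ^ i.val * z
  | .sr i => OnePoint.map fun z => conj (ω ^ i.val * z)

/-- The data defining a dihedral affine Gaudin model attached to a complex Lie algebra `𝔤`:
a dihedral group of automorphisms, an invariant bilinear form and a divisor on the Riemann sphere.
That the form is real on the real form of `𝔤` defined by `τ` is expressed as
`form (τ x) (τ y) = conj (form x y)`. -/
structure DihedralGaudin (T : ℕ) (𝔤 : Type*) [LieRing 𝔤] [LieAlgebra ℂ 𝔤] where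
  /-- a primitive `T`-th root of unity -/
  ω : ℂ
  ω_prim : IsPrimitiveRoot ω T
  /-- a linear automorphism of order dividing `T` -/
  σ : 𝔤 →ₗ[ℂ] 𝔤
  σ_lie : ∀ x y, σ ⁅x, y⁆ = ⁅σ x, σ y⁆
  σ_pow : σ ^ T = 1
  /-- an anti-linear involutive automorphism -/
  τ : 𝔤 →ₛₗ[starRingEnd ℂ] 𝔤
  τ_lie : ∀ x y, τ ⁅x, y⁆ = ⁅τ x, τ y⁆
  τ_τ : ∀ x, τ (τ x) = x
  /-- each eigenspace of `σ` is stable under `τ` -/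
  τ_eigen : ∀ (j : ℕ) (x : 𝔤), σ x = ω ^ j • x → σ (τ x) = ω ^ j • τ x
  /-- an invariant symmetric non-degenerate form, real on the real form defined by `τ` -/
  form : LinearMap.BilinForm ℂ 𝔤
  form_symm : ∀ x y, form x y = form y x
  form_nondegenerate : form.Nondegenerate
  form_lie : ∀ x y z, form ⁅x, y⁆ z = form x ⁅y, z⁆
  form_σ : ∀ x y, form (σ x) (σ y) = form x y
  form_τ : ∀ x y, form (τ x) (τ y) = conj (form x y)
  /-- the divisor: `level x` is the multiplicity of `x`, and the marked points
  are those in its support -/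
  level : OnePoint ℂ →₀ ℕ
  level_infty : level OnePoint.infty ≠ 0
  level_disjoint : ∀ x ∈ level.support, ∀ y ∈ level.support, ∀ α : DihedralGroup T,
    mobius ω α x = y → x = y

end Setup

variable {T : ℕ} {𝔤 : Type*} [LieRing 𝔤] [LieAlgebra ℂ 𝔤]

section Loop

/-- the Lie bracket of the loop algebra, `[x_m, y_n] = [x, y]_{m + n}` -/
def loop : (ℤ →₀ 𝔤) →ₗ[ℂ] (ℤ →₀ 𝔤) →ₗ[ℂ] (ℤ →₀ 𝔤) :=
  Finsupp.lsum ℂ fun m => LinearMap.flip (Finsupp.lsum ℂ fun n => LinearMap.flip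
    ((LieModule.toEnd ℂ 𝔤 𝔤 : 𝔤 →ₗ[ℂ] 𝔤 →ₗ[ℂ] 𝔤).compr₂ (Finsupp.lsingle (m + n))))

/-- the derivation `x_m ↦ m x_m` -/
def deg : (ℤ →₀ 𝔤) →ₗ[ℂ] (ℤ →₀ 𝔤) :=
  Finsupp.lsum ℂ fun m => (m : ℂ) • Finsupp.lsingle m

/-- the form `(x_m, y_n) ↦ δ_{m + n, 0} ⟨x, y⟩` -/
def loopForm (B : LinearMap.BilinForm ℂ 𝔤) : (ℤ →₀ 𝔤) →ₗ[ℂ] (ℤ →₀ 𝔤) →ₗ[ℂ] ℂ :=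
  Finsupp.lsum ℂ fun m => LinearMap.flip (Finsupp.lsum ℂ fun n => LinearMap.flip
    (if m + n = 0 then B else 0))

@[simp] theorem loop_single (m n : ℤ) (x y : 𝔤) :
    loop (Finsupp.single m x) (Finsupp.single n y) = Finsupp.single (m + n) ⁅x, y⁆ := by
  simp [loop]

@[simp] theorem deg_single (m : ℤ) (x : 𝔤) :
    deg (Finsupp.single m x) = Finsupp.single m ((m : ℂ) • x) := by
  simp [deg]

@[simp] theorem loopForm_single (B : LinearMap.BilinForm ℂ 𝔤) (m n : ℤ) (x y : 𝔤) :
    loopForm B (Finsupp.single m x) (Finsupp.single n y) = if m + n = 0 then B x y else 0 := by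
  simp only [loopForm, Finsupp.lsum_apply, Finsupp.sum_single_index, map_zero,
    LinearMap.flip_apply]
  split_ifs <;> rfl

/-- the cocycle `(x_m, y_n) ↦ m δ_{m + n, 0} ⟨x, y⟩` -/
abbrev coc (B : LinearMap.BilinForm ℂ 𝔤) (f g : ℤ →₀ 𝔤) : ℂ := loopForm B (deg f) g

theorem eq_zero_of_self_neg {M : Type*} [AddCommGroup M] [Module ℂ M] {x : M} (h : x = -x) :
    x = 0 := by
  have h2 : (2 : ℂ) • x = 0 := by rw [two_smul]; nth_rewrite 2 [h]; exact add_neg_cancel x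
  exact (smul_eq_zero.mp h2).resolve_left two_ne_zero

theorem loop_skew (f g : ℤ →₀ 𝔤) : loop f g = - loop g f := by
  induction f using Finsupp.induction_linear with
  | zero => simp
  | add f f' h h' => simp only [map_add, LinearMap.add_apply, h, h', neg_add]
  | single m x =>
    induction g using Finsupp.induction_linear with
    | zero => simp
    | add f f' h h' => simp only [map_add, LinearMap.add_apply, h, h', neg_add]
    | single n y => rw [loop_single, loop_single, add_comm, ← lie_skew, Finsupp.single_neg]

theorem loop_jacobi (f g h : ℤ →₀ 𝔤) :
    loop f (loop g h) = loop (loop f g) h + loop g (loop f h) := by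
  induction f using Finsupp.induction_linear with
  | zero => simp
  | add f f' h h' => simp only [map_add, LinearMap.add_apply, h, h']; abel
  | single m x =>
    induction g using Finsupp.induction_linear with
    | zero => simp
    | add f f' h h' => simp only [map_add, LinearMap.add_apply, h, h']; abel
    | single n y =>
      induction h using Finsupp.induction_linear with
      | zero => simp
      | add f f' h h' => simp only [map_add, h, h']; abel
      | single k z =>
        simp only [loop_single]
        rw [add_left_comm n m k, ← add_assoc, leibniz_lie, Finsupp.single_add]

theorem deg_loop (f g : ℤ →₀ 𝔤) : deg (loop f g) = loop (deg f) g + loop f (deg g) := by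
  induction f using Finsupp.induction_linear with
  | zero => simp
  | add f f' h h' => simp only [map_add, LinearMap.add_apply, h, h']; abel
  | single m x =>
    induction g using Finsupp.induction_linear with
    | zero => simp
    | add f f' h h' => simp only [map_add, h, h']; abel
    | single n y =>
      simp only [loop_single, deg_single]
      rw [← Finsupp.single_add, smul_lie, lie_smul, ← add_smul, Int.cast_add]

theorem loopForm_symm {B : LinearMap.BilinForm ℂ 𝔤} (hB : ∀ x y, B x y = B y x)
    (f g : ℤ →₀ 𝔤) : loopForm B f g = loopForm B g f := by
  induction f using Finsupp.induction_linear with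
  | zero => simp
  | add f f' h h' => simp only [map_add, LinearMap.add_apply, h, h']
  | single m x =>
    induction g using Finsupp.induction_linear with
    | zero => simp
    | add f f' h h' => simp only [map_add, LinearMap.add_apply, h, h']
    | single n y => simp only [loopForm_single, add_comm n m, hB x y]

theorem loopForm_deg (B : LinearMap.BilinForm ℂ 𝔤) (f g : ℤ →₀ 𝔤) :
    loopForm B (deg f) g = - loopForm B f (deg g) := by
  induction f using Finsupp.induction_linear with
  | zero => simp
  | add f f' h h' => simp only [map_add, LinearMap.add_apply, h, h']; ring
  | single m x =>
    induction g using Finsupp.induction_linear with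
    | zero => simp
    | add f f' h h' => simp only [map_add, h, h']; ring
    | single n y =>
      simp only [deg_single, loopForm_single]
      split_ifs with h
      · have : (m : ℂ) = - n := by
          rw [eq_neg_iff_add_eq_zero]; exact_mod_cast h
        simp [this]
      · simp

theorem loopForm_loop {B : LinearMap.BilinForm ℂ 𝔤} (hB : ∀ x y z, B ⁅x, y⁆ z = B x ⁅y, z⁆)
    (f g h : ℤ →₀ 𝔤) : loopForm B (loop f g) h = loopForm B f (loop g h) := by
  induction f using Finsupp.induction_linear with
  | zero => simp
  | add f f' h h' => simp only [map_add, LinearMap.add_apply, h, h']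
  | single m x =>
    induction g using Finsupp.induction_linear with
    | zero => simp
    | add f f' h h' => simp only [map_add, LinearMap.add_apply, h, h']
    | single n y =>
      induction h using Finsupp.induction_linear with
      | zero => simp
      | add f f' h h' => simp only [map_add, h, h']
      | single k z => simp only [loop_single, loopForm_single, add_assoc, hB]

theorem coc_skew {B : LinearMap.BilinForm ℂ 𝔤} (hB : ∀ x y, B x y = B y x)
    (f g : ℤ →₀ 𝔤) : coc B f g = - coc B g f := by
  rw [coc, coc, loopForm_deg, loopForm_symm hB]

theorem coc_loop {B : LinearMap.BilinForm ℂ 𝔤} (hB' : ∀ x y z, B ⁅x, y⁆ z = B x ⁅y, z⁆) (f g h : ℤ →₀ 𝔤) :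
    coc B f (loop g h) = coc B (loop f g) h + coc B g (loop f h) := by
  simp only [coc]
  rw [← loopForm_loop hB', deg_loop, map_add, LinearMap.add_apply, add_assoc, left_eq_add,
    ← loopForm_loop hB', loop_skew (deg g) f, map_neg, LinearMap.neg_apply, add_neg_cancel]

end Loop

/-- The affine algebra `𝔤 ⊗ ℂ[t, t⁻¹] ⊕ ℂ K ⊕ ℂ D`; the three components
are the loop part and the coefficients of `K` and `D`. -/
def Aff (_P : DihedralGaudin T 𝔤) : Type _ := (ℤ →₀ 𝔤) × ℂ × ℂ

namespace Aff

variable (P : DihedralGaudin T 𝔤)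

instance : AddCommGroup (Aff P) := inferInstanceAs (AddCommGroup ((ℤ →₀ 𝔤) × ℂ × ℂ))

instance : Module ℂ (Aff P) := inferInstanceAs (Module ℂ ((ℤ →₀ 𝔤) × ℂ × ℂ))

variable {P}

/-- build an element `f + a K + b D` -/
def mk (f : ℤ →₀ 𝔤) (a b : ℂ) : Aff P := (f, a, b)

/-- the loop part -/
def lp (X : Aff P) : ℤ →₀ 𝔤 := X.1

/-- the coefficient of `K` -/
def cK (X : Aff P) : ℂ := X.2.1

/-- the coefficient of `D` -/
def cD (X : Aff P) : ℂ := X.2.2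

@[ext] theorem ext {X Y : Aff P} (h : X.lp = Y.lp) (h' : X.cK = Y.cK) (h'' : X.cD = Y.cD) :
    X = Y := Prod.ext h (Prod.ext h' h'')

@[simp] theorem lp_mk (f : ℤ →₀ 𝔤) (a b : ℂ) : (mk f a b : Aff P).lp = f := rfl
@[simp] theorem cK_mk (f : ℤ →₀ 𝔤) (a b : ℂ) : (mk f a b : Aff P).cK = a := rfl
@[simp] theorem cD_mk (f : ℤ →₀ 𝔤) (a b : ℂ) : (mk f a b : Aff P).cD = b := rfl
@[simp] theorem lp_add (X Y : Aff P) : (X + Y).lp = X.lp + Y.lp := rfl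
@[simp] theorem cK_add (X Y : Aff P) : (X + Y).cK = X.cK + Y.cK := rfl
@[simp] theorem cD_add (X Y : Aff P) : (X + Y).cD = X.cD + Y.cD := rfl
@[simp] theorem lp_zero : (0 : Aff P).lp = 0 := rfl
@[simp] theorem cK_zero : (0 : Aff P).cK = 0 := rfl
@[simp] theorem cD_zero : (0 : Aff P).cD = 0 := rfl
@[simp] theorem lp_smul (c : ℂ) (X : Aff P) : (c • X).lp = c • X.lp := rfl
@[simp] theorem cK_smul (c : ℂ) (X : Aff P) : (c • X).cK = c * X.cK := rfl
@[simp] theorem cD_smul (c : ℂ) (X : Aff P) : (c • X).cD = c * X.cD := rfl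

instance : Bracket (Aff P) (Aff P) where
  bracket X Y := mk (loop X.lp Y.lp + X.cD • deg Y.lp - Y.cD • deg X.lp)
    (coc P.form X.lp Y.lp) 0

theorem bracket_def (X Y : Aff P) :
    ⁅X, Y⁆ = mk (loop X.lp Y.lp + X.cD • deg Y.lp - Y.cD • deg X.lp)
      (coc P.form X.lp Y.lp) 0 := rfl

@[simp] theorem lp_bracket (X Y : Aff P) :
    ⁅X, Y⁆.lp = loop X.lp Y.lp + X.cD • deg Y.lp - Y.cD • deg X.lp := rfl
@[simp] theorem cK_bracket (X Y : Aff P) : ⁅X, Y⁆.cK = loopForm P.form (deg X.lp) Y.lp := rfl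
@[simp] theorem cD_bracket (X Y : Aff P) : ⁅X, Y⁆.cD = 0 := rfl

instance : LieRing (Aff P) where
  add_lie X Y Z := by
    ext1 <;> simp only [lp_bracket, cK_bracket, cD_bracket, lp_add, cK_add, cD_add, map_add,
      LinearMap.add_apply, add_smul, smul_add, add_zero]
    abel
  lie_add X Y Z := by
    ext1 <;> simp only [lp_bracket, cK_bracket, cD_bracket, lp_add, cK_add, cD_add, map_add,
      add_smul, smul_add, add_zero]
    abel
  lie_self X := by
    ext1
    · simp only [lp_bracket, add_sub_cancel_right, lp_zero]
      exact eq_zero_of_self_neg (loop_skew X.lp X.lp)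
    · exact self_eq_neg.mp (coc_skew P.form_symm X.lp X.lp)
    · rfl
  leibniz_lie X Y Z := by
    ext1
    · simp only [lp_bracket, lp_add, cD_bracket, map_add, map_sub, map_smul, LinearMap.add_apply,
        LinearMap.sub_apply, LinearMap.smul_apply, zero_smul, sub_zero, smul_add,
        smul_sub, deg_loop, add_zero]
      rw [loop_jacobi, loop_skew Y.lp (deg X.lp), smul_comm X.cD Y.cD, smul_comm X.cD Z.cD,
        smul_comm Y.cD Z.cD]
      module
    · simp only [lp_bracket, cK_bracket, cK_add, map_add, map_sub, map_smul, LinearMap.add_apply,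
        LinearMap.sub_apply, LinearMap.smul_apply, smul_eq_mul]
      have h := coc_loop P.form_lie X.lp Y.lp Z.lp
      simp only [coc] at h
      rw [h, loopForm_deg _ (deg X.lp) Z.lp, loopForm_deg _ (deg Y.lp) Z.lp, loopForm_symm P.form_symm (deg X.lp) (deg Y.lp)]
      ring
    · simp

instance : LieAlgebra ℂ (Aff P) where
  lie_smul c X Y := by
    ext1
    · simp only [lp_bracket, lp_smul, cD_smul, map_smul, smul_add, smul_sub, smul_smul,
        mul_comm c]
    · simp
    · simp

end Aff

namespace DihedralGaudin

/-- the anti-linear involution as a real linear map -/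
def τR (P : DihedralGaudin T 𝔤) : 𝔤 →ₗ[ℝ] 𝔤 where
  toFun := P.τ
  map_add' := map_add P.τ
  map_smul' c x := by
    rw [← Complex.coe_smul, LinearMap.map_smulₛₗ, Complex.conj_ofReal, RingHom.id_apply,
      Complex.coe_smul]

@[simp] theorem τR_apply (P : DihedralGaudin T 𝔤) (x : 𝔤) : P.τR x = P.τ x := rfl

theorem conj_ω [NeZero T] (P : DihedralGaudin T 𝔤) : conj P.ω = P.ω⁻¹ := by
  rw [Complex.inv_eq_conj]
  exact P.ω_prim.norm'_eq_one (NeZero.ne T)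

theorem ω_ne_zero [NeZero T] (P : DihedralGaudin T 𝔤) : P.ω ≠ 0 := P.ω_prim.ne_zero (NeZero.ne T)

/-- the action of `t` on the loop algebra, `x_n ↦ (τ x)_{-n}` -/
def loopτ (P : DihedralGaudin T 𝔤) : (ℤ →₀ 𝔤) →ₗ[ℝ] (ℤ →₀ 𝔤) :=
  Finsupp.mapRange.linearMap P.τR ∘ₗ (Finsupp.domLCongr (R := ℝ) (Equiv.neg ℤ)).toLinearMap

@[simp] theorem loopτ_single (P : DihedralGaudin T 𝔤) (n : ℤ) (x : 𝔤) :
    P.loopτ (Finsupp.single n x) = Finsupp.single (-n) (P.τ x) := by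
  simp [loopτ]

@[simp] theorem loopτ_apply (P : DihedralGaudin T 𝔤) (f : ℤ →₀ 𝔤) (n : ℤ) :
    P.loopτ f n = P.τ (f (-n)) := by
  simp [loopτ, Finsupp.domLCongr, Finsupp.domCongr]

/-- the action of `s` on the loop algebra, `x_n ↦ (σ x)_n` -/
def loopσ (P : DihedralGaudin T 𝔤) : (ℤ →₀ 𝔤) →ₗ[ℂ] (ℤ →₀ 𝔤) := Finsupp.mapRange.linearMap P.σ

@[simp] theorem loopσ_single (P : DihedralGaudin T 𝔤) (n : ℤ) (x : 𝔤) :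
    P.loopσ (Finsupp.single n x) = Finsupp.single n (P.σ x) := by
  simp [loopσ]

@[simp] theorem loopσ_apply (P : DihedralGaudin T 𝔤) (f : ℤ →₀ 𝔤) (n : ℤ) :
    P.loopσ f n = P.σ (f n) := by
  simp [loopσ]

theorem loopτ_smul (P : DihedralGaudin T 𝔤) (c : ℂ) (f : ℤ →₀ 𝔤) :
    P.loopτ (c • f) = conj c • P.loopτ f := by
  ext n; simp

theorem loop_loopτ (P : DihedralGaudin T 𝔤) (f g : ℤ →₀ 𝔤) :
    P.loopτ (loop f g) = loop (P.loopτ f) (P.loopτ g) := by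
  induction f using Finsupp.induction_linear with
  | zero => simp
  | add f f' h h' => simp only [map_add, LinearMap.add_apply, h, h']
  | single m x =>
    induction g using Finsupp.induction_linear with
    | zero => simp
    | add f f' h h' => simp only [map_add, h, h']
    | single n y => simp only [loop_single, loopτ_single, P.τ_lie]; rw [neg_add]

theorem deg_loopτ (P : DihedralGaudin T 𝔤) (f : ℤ →₀ 𝔤) :
    P.loopτ (deg f) = - deg (P.loopτ f) := by
  induction f using Finsupp.induction_linear with
  | zero => simp
  | add f f' h h' => simp only [map_add, h, h']; abel
  | single m x => simp [← Finsupp.single_neg]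

theorem loopForm_loopτ (P : DihedralGaudin T 𝔤) (f g : ℤ →₀ 𝔤) :
    loopForm P.form (P.loopτ f) (P.loopτ g) = conj (loopForm P.form f g) := by
  induction f using Finsupp.induction_linear with
  | zero => simp
  | add f f' h h' => simp only [map_add, LinearMap.add_apply, h, h']
  | single m x =>
    induction g using Finsupp.induction_linear with
    | zero => simp
    | add f f' h h' => simp only [map_add, h, h']
    | single n y =>
      simp only [loopForm_single, loopτ_single, P.form_τ]
      simp only [← neg_add, neg_eq_zero]; split_ifs <;> simp

theorem loop_loopσ (P : DihedralGaudin T 𝔤) (f g : ℤ →₀ 𝔤) :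
    P.loopσ (loop f g) = loop (P.loopσ f) (P.loopσ g) := by
  induction f using Finsupp.induction_linear with
  | zero => simp
  | add f f' h h' => simp only [map_add, LinearMap.add_apply, h, h']
  | single m x =>
    induction g using Finsupp.induction_linear with
    | zero => simp
    | add f f' h h' => simp only [map_add, h, h']
    | single n y => simp only [loop_single, loopσ_single, P.σ_lie]

theorem deg_loopσ (P : DihedralGaudin T 𝔤) (f : ℤ →₀ 𝔤) :
    P.loopσ (deg f) = deg (P.loopσ f) := by
  induction f using Finsupp.induction_linear with
  | zero => simp
  | add f f' h h' => simp only [map_add, h, h']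
  | single m x => simp

theorem loopForm_loopσ (P : DihedralGaudin T 𝔤) (f g : ℤ →₀ 𝔤) :
    loopForm P.form (P.loopσ f) (P.loopσ g) = loopForm P.form f g := by
  induction f using Finsupp.induction_linear with
  | zero => simp
  | add f f' h h' => simp only [map_add, LinearMap.add_apply, h, h']
  | single m x =>
    induction g using Finsupp.induction_linear with
    | zero => simp
    | add f f' h h' => simp only [map_add, h, h']
    | single n y => simp only [loopForm_single, loopσ_single, P.form_σ]

end DihedralGaudin

namespace Aff

variable {P : DihedralGaudin T 𝔤}

@[simp] theorem lp_smulR (c : ℝ) (X : Aff P) : (c • X).lp = c • X.lp := rfl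
@[simp] theorem cK_smulR (c : ℝ) (X : Aff P) : (c • X).cK = c * X.cK := rfl
@[simp] theorem cD_smulR (c : ℝ) (X : Aff P) : (c • X).cD = c * X.cD := rfl

variable (P) in
/-- the invariant form on the affine algebra -/
def form : LinearMap.BilinForm ℂ (Aff P) :=
  LinearMap.mk₂ ℂ (fun X Y => loopForm P.form X.lp Y.lp + X.cK * Y.cD + X.cD * Y.cK)
    (fun X X' Y => by simp; ring) (fun c X Y => by simp; ring)
    (fun X Y Y' => by simp; ring) (fun c X Y => by simp; ring)

theorem form_apply (X Y : Aff P) :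
    form P X Y = loopForm P.form X.lp Y.lp + X.cK * Y.cD + X.cD * Y.cK := rfl

variable (P) in
/-- the automorphism `σ` of the affine algebra, fixing `K` and `D` -/
def sig : Aff P →ₗ[ℂ] Aff P where
  toFun X := mk (P.loopσ X.lp) X.cK X.cD
  map_add' X Y := by ext1 <;> simp
  map_smul' c X := by ext1 <;> simp

variable (P) in
/-- the anti-linear automorphism `τ` of the affine algebra,
`x_n ↦ (τ x)_{-n}`, `K ↦ -K`, `D ↦ -D` -/
def tau : Aff P →ₗ[ℝ] Aff P where
  toFun X := mk (P.loopτ X.lp) (-conj X.cK) (-conj X.cD)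
  map_add' X Y := by ext1 <;> simp <;> ring
  map_smul' c X := by ext1 <;> simp

@[simp] theorem lp_sig (X : Aff P) : (sig P X).lp = P.loopσ X.lp := rfl
@[simp] theorem cK_sig (X : Aff P) : (sig P X).cK = X.cK := rfl
@[simp] theorem cD_sig (X : Aff P) : (sig P X).cD = X.cD := rfl
@[simp] theorem lp_tau (X : Aff P) : (tau P X).lp = P.loopτ X.lp := rfl
@[simp] theorem cK_tau (X : Aff P) : (tau P X).cK = -conj X.cK := rfl
@[simp] theorem cD_tau (X : Aff P) : (tau P X).cD = -conj X.cD := rfl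

theorem tau_smul (c : ℂ) (X : Aff P) : tau P (c • X) = conj c • tau P X := by
  ext1 <;> simp [P.loopτ_smul]

theorem tau_tau (X : Aff P) : tau P (tau P X) = X := by
  ext1
  · ext n; simp [P.τ_τ]
  · simp
  · simp

theorem sig_lie (X Y : Aff P) : sig P ⁅X, Y⁆ = ⁅sig P X, sig P Y⁆ := by
  ext1
  · simp [P.loop_loopσ, P.deg_loopσ]
  · simp [← P.deg_loopσ, P.loopForm_loopσ]
  · simp

theorem tau_lie (X Y : Aff P) : tau P ⁅X, Y⁆ = ⁅tau P X, tau P Y⁆ := by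
  ext1
  · simp [P.loop_loopτ, P.deg_loopτ, P.loopτ_smul]
  · have h : deg (P.loopτ X.lp) = - P.loopτ (deg X.lp) := by rw [P.deg_loopτ, neg_neg]
    simp [h, P.loopForm_loopτ]
  · simp

end Aff

namespace DihedralGaudin

variable (P : DihedralGaudin T 𝔤)

theorem ω_pow : P.ω ^ T = 1 := P.ω_prim.pow_eq_one

theorem σ_pow_apply (x : 𝔤) : (P.σ ^ T) x = x := by rw [P.σ_pow]; rfl

variable [NeZero T]

/-- a multiple of the projection to an eigenspace of `σ` -/
def eigenProj (j : ℕ) (x : 𝔤) : 𝔤 := ∑ k ∈ Finset.range T, ((P.ω ^ j)⁻¹ ^ k) • (P.σ ^ k) x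

theorem σ_eigenProj (j : ℕ) (x : 𝔤) : P.σ (P.eigenProj j x) = P.ω ^ j • P.eigenProj j x := by
  have hw : P.ω ^ j ≠ 0 := pow_ne_zero _ P.ω_ne_zero
  have h1 : P.σ (P.eigenProj j x) =
      P.ω ^ j • ∑ k ∈ Finset.range T, ((P.ω ^ j)⁻¹ ^ (k + 1)) • (P.σ ^ (k + 1)) x := by
    rw [eigenProj, map_sum, Finset.smul_sum]
    refine Finset.sum_congr rfl fun k _ => ?_
    rw [map_smul, smul_smul, pow_succ' P.σ, pow_succ' (P.ω ^ j)⁻¹, ← mul_assoc,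
      mul_inv_cancel₀ hw, one_mul]
    rfl
  rw [h1, eigenProj]
  congr 1
  have h2 := Finset.sum_range_succ (fun k => ((P.ω ^ j)⁻¹ ^ k) • (P.σ ^ k) x) T
  rw [Finset.sum_range_succ'] at h2
  have h3 : (P.ω ^ j)⁻¹ ^ T = 1 := by rw [inv_pow, ← pow_mul, mul_comm, pow_mul, P.ω_pow]; simp
  rw [h3, P.σ_pow_apply, pow_zero, pow_zero, Module.End.one_apply] at h2
  exact add_right_cancel h2

theorem sum_eigenProj (x : 𝔤) : ∑ j ∈ Finset.range T, P.eigenProj j x = (T : ℂ) • x := by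
  simp only [eigenProj]
  rw [Finset.sum_comm, Finset.sum_eq_single_of_mem 0 (Finset.mem_range.mpr (NeZero.pos T))]
  · simp [Nat.cast_smul_eq_nsmul]
  · intro k hk hk0
    rw [← Finset.sum_smul]
    have h : ∀ j, (P.ω ^ j)⁻¹ ^ k = ((P.ω ^ k)⁻¹) ^ j := fun j => by
      rw [inv_pow, inv_pow, ← pow_mul, ← pow_mul, mul_comm]
    simp only [h]
    have hne : (P.ω ^ k)⁻¹ ≠ 1 := by
      rw [ne_eq, inv_eq_one]
      exact P.ω_prim.pow_ne_one_of_pos_of_lt hk0 (Finset.mem_range.mp hk)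
    have h3 : (P.ω ^ k)⁻¹ ^ T = 1 := by rw [inv_pow, ← pow_mul, mul_comm, pow_mul, P.ω_pow]; simp
    rw [geom_sum_eq hne, h3, sub_self, zero_div, zero_smul]

theorem στ_sq (x : 𝔤) : P.σ (P.τ (P.σ (P.τ x))) = x := by
  have key : ∀ j y, P.σ y = P.ω ^ j • y → P.σ (P.τ (P.σ (P.τ y))) = y := by
    intro j y h
    have hw : P.ω ^ j ≠ 0 := pow_ne_zero _ P.ω_ne_zero
    rw [P.τ_eigen j y h, LinearMap.map_smulₛₗ, P.τ_τ, map_smul, h, map_pow, P.conj_ω, smul_smul,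
      inv_pow, inv_mul_cancel₀ hw, one_smul]
  have hT : (T : ℂ) ≠ 0 := Nat.cast_ne_zero.mpr (NeZero.ne T)
  have h := P.sum_eigenProj x
  have h2 : P.σ (P.τ (P.σ (P.τ ((T : ℂ) • x)))) = (T : ℂ) • x := by
    rw [← h]
    simp only [map_sum]
    exact Finset.sum_congr rfl fun j _ => key j _ (P.σ_eigenProj j x)
  rw [LinearMap.map_smulₛₗ, map_smul, LinearMap.map_smulₛₗ, map_smul, starRingEnd_self_apply] at h2
  exact smul_right_injective 𝔤 hT h2

theorem τσ (x : 𝔤) : P.σ (P.τ (P.σ x)) = P.τ x := by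
  have := P.στ_sq (P.τ x)
  rwa [P.τ_τ] at this

/-- the scalar by which `s` acts on the `p`-th power of the local coordinate at `x` -/
def wt (x : OnePoint ℂ) (p : ℕ) : ℂ :=
  open Classical in if x = OnePoint.infty then P.ω ^ p else (P.ω⁻¹) ^ p

theorem wt_add (x : OnePoint ℂ) (p q : ℕ) : P.wt x (p + q) = P.wt x p * P.wt x q := by
  unfold wt; split_ifs <;> rw [pow_add]

theorem wt_pow (x : OnePoint ℂ) (p : ℕ) : P.wt x p ^ T = 1 := by
  unfold wt; split_ifs
  · rw [← pow_mul, mul_comm, pow_mul, P.ω_pow, one_pow]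
  · rw [← pow_mul, mul_comm, pow_mul, inv_pow, P.ω_pow, inv_one, one_pow]

theorem conj_wt (x : OnePoint ℂ) (p : ℕ) : P.wt x p * conj (P.wt x p) = 1 := by
  have h := P.ω_ne_zero
  unfold wt; split_ifs
  · rw [map_pow, P.conj_ω, ← mul_pow, mul_inv_cancel₀ h, one_pow]
  · rw [map_pow, map_inv₀, P.conj_ω, ← mul_pow, mul_inv_cancel₀ (inv_ne_zero h), one_pow]

end DihedralGaudin

namespace Aff

variable (P : DihedralGaudin T 𝔤)

/-- the action of `s` on `X ε_x ^ p` -/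
def gen (x : OnePoint ℂ) (p : ℕ) : Aff P →ₗ[ℂ] Aff P := P.wt x p • sig P

/-- the action of the dihedral group on `X ε_x ^ p` -/
def hat (x : OnePoint ℂ) (p : ℕ) : DihedralGroup T → Aff P →ₗ[ℝ] Aff P
  | .r i => (gen P x p ^ i.val).restrictScalars ℝ
  | .sr i => tau P ∘ₗ (gen P x p ^ i.val).restrictScalars ℝ

theorem sig_pow_apply (k : ℕ) (X : Aff P) :
    (sig P ^ k) X = mk ((Finsupp.mapRange.linearMap (P.σ ^ k)) X.lp) X.cK X.cD := by
  induction k with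
  | zero =>
    ext1
    · ext n; simp
    · rfl
    · rfl
  | succ k ih =>
    rw [pow_succ', Module.End.mul_apply, ih]
    ext1
    · ext n; simp [pow_succ']
    · rfl
    · rfl

variable [NeZero T]

theorem gen_pow (x : OnePoint ℂ) (p : ℕ) : gen P x p ^ T = 1 := by
  rw [gen, smul_pow, P.wt_pow, one_smul]
  ext1 X
  rw [sig_pow_apply]
  ext1
  · ext n; simp [P.σ_pow]
  · rfl
  · rfl

theorem gen_tau (x : OnePoint ℂ) (p : ℕ) (X : Aff P) :
    gen P x p (tau P (gen P x p X)) = tau P X := by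
  simp only [gen, LinearMap.smul_apply, tau_smul, map_smul, smul_smul]
  rw [mul_comm, P.conj_wt, one_smul]
  ext1
  · ext n; simp [P.τσ]
  · simp
  · simp

theorem gen_pow_tau (x : OnePoint ℂ) (p k : ℕ) (X : Aff P) :
    (gen P x p ^ k) (tau P ((gen P x p ^ k) X)) = tau P X := by
  induction k generalizing X with
  | zero => simp
  | succ k ih =>
    nth_rewrite 1 [pow_succ]
    rw [pow_succ', Module.End.mul_apply, Module.End.mul_apply, gen_tau, ih]

theorem gen_pow_mod (x : OnePoint ℂ) (p k : ℕ) : gen P x p ^ (k % T) = gen P x p ^ k :=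
  (pow_eq_pow_mod k (gen_pow P x p)).symm

theorem gen_pow_sub (x : OnePoint ℂ) (p : ℕ) (i j : ZMod T) :
    gen P x p ^ (j - i).val * gen P x p ^ i.val = gen P x p ^ j.val := by
  rw [← pow_add, ← gen_pow_mod, ← ZMod.val_add, sub_add_cancel]

theorem hat_mul (x : OnePoint ℂ) (p : ℕ) (α β : DihedralGroup T) (X : Aff P) :
    hat P x p (α * β) X = hat P x p α (hat P x p β X) := by
  match α, β with
  | .r i, .r j =>
    rw [DihedralGroup.r_mul_r]
    change (gen P x p ^ (i + j).val) X = (gen P x p ^ i.val) ((gen P x p ^ j.val) X)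
    rw [ZMod.val_add, gen_pow_mod, pow_add]; rfl
  | .r i, .sr j =>
    rw [DihedralGroup.r_mul_sr]
    change tau P ((gen P x p ^ (j - i).val) X) =
      (gen P x p ^ i.val) (tau P ((gen P x p ^ j.val) X))
    rw [← gen_pow_tau P x p i.val, ← Module.End.mul_apply (gen P x p ^ i.val), ← pow_add,
      add_comm, pow_add, gen_pow_sub]
  | .sr i, .r j =>
    rw [DihedralGroup.sr_mul_r]
    change tau P ((gen P x p ^ (i + j).val) X) =
      tau P ((gen P x p ^ i.val) ((gen P x p ^ j.val) X))
    rw [ZMod.val_add, gen_pow_mod, pow_add]; rfl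
  | .sr i, .sr j =>
    rw [DihedralGroup.sr_mul_sr]
    change (gen P x p ^ (j - i).val) X =
      tau P ((gen P x p ^ i.val) (tau P ((gen P x p ^ j.val) X)))
    have h := gen_pow_tau P x p i.val ((gen P x p ^ (j - i).val) X)
    rw [← Module.End.mul_apply (gen P x p ^ i.val) (gen P x p ^ _), ← pow_add, add_comm, pow_add,
      gen_pow_sub] at h
    rw [h, tau_tau]

theorem hat_lie (x : OnePoint ℂ) (p q : ℕ) (α : DihedralGroup T) (X Y : Aff P) :
    hat P x (p + q) α ⁅X, Y⁆ = ⁅hat P x p α X, hat P x q α Y⁆ := by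
  have key : ∀ k : ℕ, (gen P x (p + q) ^ k) ⁅X, Y⁆ = ⁅(gen P x p ^ k) X, (gen P x q ^ k) Y⁆ := by
    intro k
    induction k with
    | zero => simp
    | succ k ih =>
      simp only [pow_succ', Module.End.mul_apply, ih]
      simp only [gen, LinearMap.smul_apply, sig_lie, P.wt_add, smul_lie, lie_smul, smul_smul,
        mul_comm (P.wt x p)]
  match α with
  | .r i => exact key _
  | .sr i =>
    change tau P _ = _
    rw [LinearMap.restrictScalars_apply, key, tau_lie]; rfl

end Aff

theorem mobius_mul [NeZero T] (P : DihedralGaudin T 𝔤) (α β : DihedralGroup T) (x : OnePoint ℂ) :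
    mobius P.ω (α * β) x = mobius P.ω α (mobius P.ω β x) := by
  have hmod : ∀ k : ℕ, P.ω ^ (k % T) = P.ω ^ k := fun k => (pow_eq_pow_mod k P.ω_pow).symm
  have hadd : ∀ i j : ZMod T, P.ω ^ (i + j).val = P.ω ^ i.val * P.ω ^ j.val := fun i j => by
    rw [ZMod.val_add, hmod, pow_add]
  have hsub : ∀ i j : ZMod T, P.ω ^ (j - i).val = P.ω ^ j.val * (P.ω⁻¹) ^ i.val := fun i j => by
    have h := hadd (j - i) i
    rw [sub_add_cancel] at h
    rw [h, mul_assoc, ← mul_pow, mul_inv_cancel₀ P.ω_ne_zero, one_pow, mul_one]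
  induction x using OnePoint.rec with
  | infty => rcases α with i | i <;> rcases β with j | j <;> rfl
  | coe z =>
    match α, β with
    | .r i, .r j =>
      refine congrArg ((↑) : ℂ → OnePoint ℂ) ?_
      change P.ω ^ (i + j).val * z = P.ω ^ i.val * (P.ω ^ j.val * z)
      rw [hadd, mul_assoc]
    | .r i, .sr j =>
      refine congrArg ((↑) : ℂ → OnePoint ℂ) ?_
      change conj (P.ω ^ (j - i).val * z) = P.ω ^ i.val * conj (P.ω ^ j.val * z)
      rw [hsub]
      simp only [map_mul, map_pow, map_inv₀, P.conj_ω, inv_inv]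
      rw [mul_comm (P.ω⁻¹ ^ _), mul_assoc]
    | .sr i, .r j =>
      refine congrArg ((↑) : ℂ → OnePoint ℂ) ?_
      change conj (P.ω ^ (i + j).val * z) = conj (P.ω ^ i.val * (P.ω ^ j.val * z))
      rw [hadd, mul_assoc]
    | .sr i, .sr j =>
      refine congrArg ((↑) : ℂ → OnePoint ℂ) ?_
      change P.ω ^ (j - i).val * z = conj (P.ω ^ i.val * conj (P.ω ^ j.val * z))
      rw [hsub]
      simp only [map_mul, map_pow, P.conj_ω, Complex.conj_conj, map_inv₀, inv_inv]
      ring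

section Takiff

theorem sum_anti_assoc {M : Type*} [AddCommMonoid M] (f : ℕ → ℕ → ℕ → M) (n : ℕ) :
    ∑ x ∈ Finset.HasAntidiagonal.antidiagonal n, ∑ y ∈ Finset.HasAntidiagonal.antidiagonal x.2, f x.1 y.1 y.2 =
      ∑ x ∈ Finset.HasAntidiagonal.antidiagonal n, ∑ y ∈ Finset.HasAntidiagonal.antidiagonal x.1, f y.1 y.2 x.2 := by
  rw [Finset.sum_sigma', Finset.sum_sigma']
  refine Finset.sum_nbij' (fun a => ⟨(a.1.1 + a.2.1, a.2.2), (a.1.1, a.2.1)⟩)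
    (fun a => ⟨(a.2.1, a.2.2 + a.1.2), (a.2.2, a.1.2)⟩) ?_ ?_ ?_ ?_ ?_ <;>
    simp only [Finset.mem_sigma, Finset.HasAntidiagonal.mem_antidiagonal, and_imp]
  · rintro ⟨⟨a, b⟩, ⟨c, d⟩⟩ h1 h2; dsimp only at *; subst h2; subst h1; simp [add_assoc, add_left_comm]
  · rintro ⟨⟨a, b⟩, ⟨c, d⟩⟩ h1 h2; dsimp only at *; subst h2; subst h1; simp [add_assoc, add_left_comm]
  · rintro ⟨⟨a, b⟩, ⟨c, d⟩⟩ h1 h2; simp only at *; simp [h2]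
  · rintro ⟨⟨a, b⟩, ⟨c, d⟩⟩ h1 h2; simp only at *; simp [h2]
  · rintro ⟨⟨a, b⟩, ⟨c, d⟩⟩ h1 h2; trivial

theorem sum_anti_comm {M : Type*} [AddCommMonoid M] (f : ℕ → ℕ → ℕ → M) (n : ℕ) :
    ∑ x ∈ Finset.HasAntidiagonal.antidiagonal n, ∑ y ∈ Finset.HasAntidiagonal.antidiagonal x.2, f x.1 y.1 y.2 =
      ∑ x ∈ Finset.HasAntidiagonal.antidiagonal n, ∑ y ∈ Finset.HasAntidiagonal.antidiagonal x.2, f y.1 x.1 y.2 := by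
  rw [Finset.sum_sigma', Finset.sum_sigma']
  refine Finset.sum_nbij' (fun a => ⟨(a.2.1, a.1.1 + a.2.2), (a.1.1, a.2.2)⟩)
    (fun a => ⟨(a.2.1, a.1.1 + a.2.2), (a.1.1, a.2.2)⟩) ?_ ?_ ?_ ?_ ?_ <;>
    simp only [Finset.mem_sigma, Finset.HasAntidiagonal.mem_antidiagonal, and_imp]
  · rintro ⟨⟨a, b⟩, ⟨c, d⟩⟩ h1 h2; dsimp only at *; subst h2; subst h1; simp [add_assoc, add_left_comm]
  · rintro ⟨⟨a, b⟩, ⟨c, d⟩⟩ h1 h2; dsimp only at *; subst h2; subst h1; simp [add_assoc, add_left_comm]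
  · rintro ⟨⟨a, b⟩, ⟨c, d⟩⟩ h1 h2; simp only at *; simp [h2]
  · rintro ⟨⟨a, b⟩, ⟨c, d⟩⟩ h1 h2; simp only at *; simp [h2]
  · rintro ⟨⟨a, b⟩, ⟨c, d⟩⟩ h1 h2; trivial

variable (P : DihedralGaudin T 𝔤)

/-- `ε_x ^ p` is a basis element of the truncated polynomials at `x`:
`0 ≤ p < n_x` at a finite point, `1 ≤ p < n_∞` at infinity. -/
def valid (x : OnePoint ℂ) (p : ℕ) : Prop := p < P.level x ∧ (x = OnePoint.infty → p ≠ 0)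

/-- the space underlying the direct sum of Takiff algebras -/
def takSub : Submodule ℂ (OnePoint ℂ → ℕ → Aff P) where
  carrier := {X | ∀ x p, ¬ valid P x p → X x p = 0}
  add_mem' hX hY x p h := by simp [hX x p h, hY x p h]
  zero_mem' _ _ _ := rfl
  smul_mem' c X hX x p h := by simp [hX x p h]

/-- The direct sum over the marked points of the Takiff algebras `𝔤̃ ⊗ ℂ[ε_x] / (ε_x ^ n_x)`
(for finite `x`) and `𝔤̃ ⊗ ε ℂ[ε] / (ε ^ n_∞)` (for `x = ∞`). An element is given by its
components `X x p` along `ε_x ^ p`. -/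
def TakD : Type _ := takSub P

namespace TakD

instance : AddCommGroup (TakD P) := inferInstanceAs (AddCommGroup (takSub P))

instance : Module ℂ (TakD P) := inferInstanceAs (Module ℂ (takSub P))

variable {P} in
/-- the component along `ε_x ^ p` -/
def co (X : TakD P) : OnePoint ℂ → ℕ → Aff P := X.1

instance : CoeFun (TakD P) fun _ => OnePoint ℂ → ℕ → Aff P := ⟨co⟩

variable {P}

@[ext] theorem ext {X Y : TakD P} (h : ∀ x p, X x p = Y x p) : X = Y :=
  Subtype.ext (funext fun x => funext fun p => h x p)

@[simp] theorem add_apply (X Y : TakD P) (x : OnePoint ℂ) (p : ℕ) :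
    (X + Y) x p = X x p + Y x p := rfl
@[simp] theorem zero_apply (x : OnePoint ℂ) (p : ℕ) : (0 : TakD P) x p = 0 := rfl
@[simp] theorem neg_apply (X : TakD P) (x : OnePoint ℂ) (p : ℕ) : (-X) x p = - X x p := rfl
@[simp] theorem smul_apply (c : ℂ) (X : TakD P) (x : OnePoint ℂ) (p : ℕ) :
    (c • X) x p = c • X x p := rfl
@[simp] theorem smulR_apply (c : ℝ) (X : TakD P) (x : OnePoint ℂ) (p : ℕ) :
    (c • X) x p = c • X x p := rfl

theorem eq_zero (X : TakD P) {x : OnePoint ℂ} {p : ℕ} (h : ¬ valid P x p) : X x p = 0 :=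
  X.2 x p h

open Classical in
instance : Bracket (TakD P) (TakD P) where
  bracket X Y := ⟨fun x p =>
    if valid P x p then ∑ a ∈ Finset.HasAntidiagonal.antidiagonal p, ⁅X x a.1, Y x a.2⁆ else 0,
    fun _ _ h => if_neg h⟩

open Classical in
theorem bracket_apply (X Y : TakD P) (x : OnePoint ℂ) (p : ℕ) : ⁅X, Y⁆ x p =
    if valid P x p then ∑ a ∈ Finset.HasAntidiagonal.antidiagonal p, ⁅X x a.1, Y x a.2⁆ else 0 := rfl

theorem bracket_apply_of_le (X Y : TakD P) {x : OnePoint ℂ} {p q : ℕ} (h : valid P x q)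
    (hpq : p ≤ q) : ⁅X, Y⁆ x p = ∑ a ∈ Finset.HasAntidiagonal.antidiagonal p, ⁅X x a.1, Y x a.2⁆ := by
  rw [bracket_apply]
  split_ifs with hp
  · rfl
  · have hp0 : x = OnePoint.infty ∧ p = 0 := by
      by_contra hc
      exact hp ⟨hpq.trans_lt h.1, fun hx h0 => hc ⟨hx, h0⟩⟩
    obtain ⟨rfl, rfl⟩ := hp0
    simp [X.eq_zero hp]

instance : LieRing (TakD P) where
  add_lie X Y Z := by
    ext1 x p
    simp only [bracket_apply, add_apply]
    split_ifs
    · simp [Finset.sum_add_distrib]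
    · simp
  lie_add X Y Z := by
    ext1 x p
    simp only [bracket_apply, add_apply]
    split_ifs
    · simp [Finset.sum_add_distrib]
    · simp
  lie_self X := by
    ext1 x p
    rw [bracket_apply, zero_apply]
    split_ifs
    · refine eq_zero_of_self_neg ?_
      rw [← Finset.sum_neg_distrib, ← Finset.Nat.sum_antidiagonal_swap]
      exact Finset.sum_congr rfl fun a _ => (lie_skew _ _).symm
    · rfl
  leibniz_lie X Y Z := by
    ext1 x p
    by_cases hp : valid P x p
    · have e1 : ∀ A B C : TakD P, ⁅A, ⁅B, C⁆⁆ x p = ∑ a ∈ Finset.HasAntidiagonal.antidiagonal p,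
          ∑ b ∈ Finset.HasAntidiagonal.antidiagonal a.2, ⁅A x a.1, ⁅B x b.1, C x b.2⁆⁆ := by
        intro A B C
        rw [bracket_apply_of_le _ _ hp le_rfl]
        refine Finset.sum_congr rfl fun a ha => ?_
        rw [bracket_apply_of_le _ _ hp (Finset.HasAntidiagonal.antidiagonal.snd_le ha), lie_sum]
      have e2 : ⁅⁅X, Y⁆, Z⁆ x p = ∑ a ∈ Finset.HasAntidiagonal.antidiagonal p,
          ∑ b ∈ Finset.HasAntidiagonal.antidiagonal a.1, ⁅⁅X x b.1, Y x b.2⁆, Z x a.2⁆ := by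
        rw [bracket_apply_of_le _ _ hp le_rfl]
        refine Finset.sum_congr rfl fun a ha => ?_
        rw [bracket_apply_of_le _ _ hp (Finset.HasAntidiagonal.antidiagonal.fst_le ha), sum_lie]
      rw [add_apply, e1, e1, e2,
        ← sum_anti_assoc (fun a b c => ⁅⁅X x a, Y x b⁆, Z x c⁆),
        sum_anti_comm (fun a b c => ⁅Y x a, ⁅X x b, Z x c⁆⁆)]
      simp only [← Finset.sum_add_distrib]
      refine Finset.sum_congr rfl fun a _ => Finset.sum_congr rfl fun b _ => leibniz_lie _ _ _
    · simp [bracket_apply, hp]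

instance : LieAlgebra ℂ (TakD P) where
  lie_smul c X Y := by
    ext1 x p
    simp only [bracket_apply, smul_apply]
    split_ifs
    · simp [Finset.smul_sum]
    · simp

instance : LieAlgebra ℝ (TakD P) where
  lie_smul c X Y := by
    rw [← Complex.coe_smul, lie_smul, Complex.coe_smul]

end TakD

/-- The real Lie algebra of elements of the direct sum of Takiff algebras whose component
at each `x` is invariant under the stabilizer of `x` in the dihedral group. -/
def gD [NeZero T] : LieSubalgebra ℝ (TakD P) where
  carrier := {X | ∀ x (α : DihedralGroup T), mobius P.ω α x = x →
    ∀ p, Aff.hat P x p α (X x p) = X x p}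
  add_mem' hX hY x α h p := by simp [hX x α h p, hY x α h p]
  zero_mem' _ _ _ _ := by simp
  smul_mem' c X hX x α h p := by simp [hX x α h p]
  lie_mem' := by
    intro X Y hX hY x α h p
    rw [TakD.bracket_apply]
    split_ifs
    · rw [map_sum]
      refine Finset.sum_congr rfl fun a ha => ?_
      rw [← Finset.HasAntidiagonal.mem_antidiagonal.mp ha, Aff.hat_lie, hX x α h, hY x α h]
    · simp

end Takiff

section Filtration

theorem loop_apply (f g : ℤ →₀ 𝔤) (k : ℤ) : loop f g k = f.sum fun a x => ⁅x, g (k - a)⁆ := by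
  induction f using Finsupp.induction_linear with
  | zero => simp
  | add f f' h h' =>
    rw [Finsupp.sum_add_index' (by simp) (by simp), ← h, ← h']; simp
  | single m x =>
    rw [Finsupp.sum_single_index (by simp)]
    induction g using Finsupp.induction_linear with
    | zero => simp
    | add f f' h h' => simp [h, h']
    | single n y =>
      rw [loop_single, Finsupp.single_apply, Finsupp.single_apply]
      by_cases hk : n = k - m
      · rw [if_pos hk, if_pos (by omega)]
      · rw [if_neg hk, if_neg (by omega), lie_zero]

theorem loopForm_apply (B : LinearMap.BilinForm ℂ 𝔤) (f g : ℤ →₀ 𝔤) :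
    loopForm B f g = f.sum fun a x => B x (g (-a)) := by
  induction f using Finsupp.induction_linear with
  | zero => simp
  | add f f' h h' =>
    rw [Finsupp.sum_add_index' (by simp) (by simp), ← h, ← h']; simp
  | single m x =>
    rw [Finsupp.sum_single_index (by simp)]
    induction g using Finsupp.induction_linear with
    | zero => simp
    | add f f' h h' => simp [h, h']
    | single n y =>
      rw [loopForm_single, Finsupp.single_apply]
      by_cases hk : n = -m
      · rw [if_pos hk, if_pos (by omega)]
      · rw [if_neg hk, if_neg (by omega), map_zero]

theorem deg_apply (f : ℤ →₀ 𝔤) (k : ℤ) : deg f k = (k : ℂ) • f k := by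
  induction f using Finsupp.induction_linear with
  | zero => simp
  | add f f' h h' => simp [h, h']
  | single m x =>
    rw [deg_single, Finsupp.single_apply, Finsupp.single_apply]
    split_ifs with h
    · rw [h]
    · simp

variable (P : DihedralGaudin T 𝔤)

/-- The two conjugate filtrations of the affine algebra: `filt P 1 n = 𝔤 ⊗ t ^ n ℂ[t]` and
`filt P (-1) n = 𝔤 ⊗ t ^ (-n) ℂ[t⁻¹]`. -/
def filt (e : ℤ) (n : ℕ) : Submodule ℂ (Aff P) where
  carrier := {X | X.cK = 0 ∧ X.cD = 0 ∧ ∀ k : ℤ, e * k < n → X.lp k = 0}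
  add_mem' := by
    rintro X Y ⟨h1, h2, h3⟩ ⟨h1', h2', h3'⟩
    exact ⟨by simp [h1, h1'], by simp [h2, h2'], fun k hk => by simp [h3 k hk, h3' k hk]⟩
  zero_mem' := ⟨rfl, rfl, fun _ _ => rfl⟩
  smul_mem' := by
    rintro c X ⟨h1, h2, h3⟩
    exact ⟨by simp [h1], by simp [h2], fun k hk => by simp [h3 k hk]⟩

variable {P}

theorem filt_anti {e : ℤ} {m n : ℕ} (h : m ≤ n) : filt P e n ≤ filt P e m := by
  rintro X ⟨h1, h2, h3⟩
  exact ⟨h1, h2, fun k hk => h3 k (hk.trans_le (by exact_mod_cast h))⟩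

theorem tau_mem_filt {e : ℤ} {n : ℕ} {X : Aff P} (h : X ∈ filt P e n) :
    Aff.tau P X ∈ filt P (-e) n := by
  obtain ⟨h1, h2, h3⟩ := h
  refine ⟨by simp [h1], by simp [h2], fun k hk => ?_⟩
  rw [Aff.lp_tau, P.loopτ_apply, h3 (-k) (by rw [mul_neg, ← neg_mul]; exact hk), map_zero]

theorem gen_pow_mem_filt {e : ℤ} {n : ℕ} {X : Aff P} (h : X ∈ filt P e n) (x : OnePoint ℂ)
    (p k : ℕ) : (Aff.gen P x p ^ k) X ∈ filt P e n := by
  induction k with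
  | zero => simpa using h
  | succ k ih =>
    rw [pow_succ', Module.End.mul_apply]
    refine Submodule.smul_mem _ _ ?_
    obtain ⟨h1, h2, h3⟩ := ih
    exact ⟨h1, h2, fun k hk => by rw [Aff.lp_sig, P.loopσ_apply, h3 k hk, map_zero]⟩

theorem bracket_mem_filt {e : ℤ} {m : ℕ} (hm : 1 ≤ m) {X Y : Aff P} (hX : X ∈ filt P e m)
    (hY : Y ∈ filt P e m) : ⁅X, Y⁆ ∈ filt P e m := by
  obtain ⟨h1, h2, h3⟩ := hX
  obtain ⟨h1', h2', h3'⟩ := hY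
  have hm' : (1 : ℤ) ≤ m := by exact_mod_cast hm
  refine ⟨?_, rfl, fun k hk => ?_⟩
  · rw [Aff.cK_bracket, loopForm_apply]
    refine Finset.sum_eq_zero fun a _ => ?_
    dsimp only
    by_cases ha : e * a < m
    · rw [deg_apply, h3 a ha, smul_zero, map_zero, LinearMap.zero_apply]
    · rw [h3' (-a) (by rw [mul_neg]; linarith), map_zero]
  · rw [Aff.lp_bracket, h2, h2', zero_smul, zero_smul, add_zero, sub_zero, loop_apply]
    refine Finset.sum_eq_zero fun a _ => ?_
    dsimp only
    by_cases ha : e * a < m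
    · rw [h3 a ha, zero_lie]
    · rw [h3' (k - a) (by rw [mul_sub]; linarith), lie_zero]

theorem form_filt {e : ℤ} {m : ℕ} (hm : 1 ≤ m) {X Y : Aff P} (hX : X ∈ filt P e m)
    (hY : Y ∈ filt P e m) : Aff.form P X Y = 0 := by
  obtain ⟨h1, h2, h3⟩ := hX
  obtain ⟨h1', h2', h3'⟩ := hY
  have hm' : (1 : ℤ) ≤ m := by exact_mod_cast hm
  rw [Aff.form_apply, h1, h2, zero_mul, zero_mul, add_zero, add_zero, loopForm_apply]
  refine Finset.sum_eq_zero fun a _ => ?_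
  dsimp only
  by_cases ha : e * a < m
  · rw [h3 a ha, map_zero, LinearMap.zero_apply]
  · rw [h3' (-a) (by rw [mul_neg]; linarith), map_zero]

/-- a bound on the degrees in the loop part of an element -/
def bd (X : Aff P) : ℕ := ∑ a ∈ X.lp.support, a.natAbs

theorem le_bd {X : Aff P} {a : ℤ} (ha : a ∈ X.lp.support) {e : ℤ} (he : e = 1 ∨ e = -1) :
    -(e * a) ≤ bd X := by
  have h : a.natAbs ≤ bd X :=
    Finset.single_le_sum (f := fun a : ℤ => a.natAbs) (fun _ _ => Nat.zero_le _) ha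
  rcases he with rfl | rfl <;> omega

theorem bracket_filt {e : ℤ} (he : e = 1 ∨ e = -1) (X : Aff P) (n m : ℕ) (hm : n + 1 + bd X ≤ m)
    {Y : Aff P} (hY : Y ∈ filt P e m) : ⁅X, Y⁆ ∈ filt P e n := by
  obtain ⟨h1', h2', h3'⟩ := hY
  have hm' : (n : ℤ) + 1 + bd X ≤ m := by exact_mod_cast hm
  refine ⟨?_, rfl, fun k hk => ?_⟩
  · rw [Aff.cK_bracket, loopForm_deg, loopForm_apply, neg_eq_zero]
    refine Finset.sum_eq_zero fun a ha => ?_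
    dsimp only
    have := le_bd ha he
    rw [deg_apply, h3' (-a) (by rw [mul_neg]; linarith), smul_zero, map_zero]
  · rw [Aff.lp_bracket, h2', zero_smul, sub_zero, Finsupp.add_apply, Finsupp.smul_apply, deg_apply,
      h3' k (by linarith), smul_zero, smul_zero, add_zero, loop_apply]
    refine Finset.sum_eq_zero fun a ha => ?_
    dsimp only
    have := le_bd ha he
    rw [h3' (k - a) (by rw [mul_sub]; linarith), lie_zero]

theorem form_filt' {e : ℤ} (he : e = 1 ∨ e = -1) (X : Aff P) (m : ℕ) (hm : 1 + bd X ≤ m)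
    {Y : Aff P} (hY : Y ∈ filt P e m) : Aff.form P X Y = 0 := by
  obtain ⟨h1', h2', h3'⟩ := hY
  have hm' : (1 : ℤ) + bd X ≤ m := by exact_mod_cast hm
  rw [Aff.form_apply, h1', h2', mul_zero, mul_zero, add_zero, add_zero, loopForm_apply]
  refine Finset.sum_eq_zero fun a ha => ?_
  dsimp only
  have := le_bd ha he
  rw [h3' (-a) (by rw [mul_neg]; linarith), map_zero]

theorem TakD.bracket_mem {F : Submodule ℂ (Aff P)} {X Y : TakD P}
    (h : ∀ x p q, ⁅X x p, Y x q⁆ ∈ F) (x : OnePoint ℂ) (p : ℕ) : ⁅X, Y⁆ x p ∈ F := by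
  rw [TakD.bracket_apply]
  split_ifs
  · exact Submodule.sum_mem _ fun a _ => h _ _ _
  · exact Submodule.zero_mem _

theorem TakD.exists_bd (X : TakD P) : ∃ b, ∀ x p, bd (X x p) ≤ b := by
  refine ⟨∑ x ∈ P.level.support, ∑ p ∈ Finset.range (P.level x), bd (X x p), fun x p => ?_⟩
  by_cases h : valid P x p
  · have hx : x ∈ P.level.support := by
      rw [Finsupp.mem_support_iff]; exact fun h0 => by have := h.1; omega
    refine le_trans ?_ (Finset.single_le_sum
      (f := fun x => ∑ p ∈ Finset.range (P.level x), bd (X x p)) (fun _ _ => Nat.zero_le _) hx)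
    exact Finset.single_le_sum (f := fun p => bd (X x p)) (fun _ _ => Nat.zero_le _)
      (Finset.mem_range.mpr h.1)
  · rw [X.eq_zero h]
    simp [bd]

open Classical in
variable (P) in
/-- the element `X ε_x ^ p` (zero if `ε_x ^ p` vanishes) -/
def single (x : OnePoint ℂ) (p : ℕ) (X : Aff P) : TakD P :=
  ⟨fun y q => if y = x ∧ q = p ∧ valid P x p then X else 0, by
    rintro y q h
    refine if_neg ?_
    rintro ⟨rfl, rfl, h'⟩
    exact h h'⟩

open Classical in
theorem single_apply (x y : OnePoint ℂ) (p q : ℕ) (X : Aff P) :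
    single P x p X y q = if y = x ∧ q = p ∧ valid P x p then X else 0 := rfl

theorem hat_mem (x : OnePoint ℂ) (p : ℕ) (α : DihedralGroup T) {e : ℤ} {n : ℕ} {X : Aff P}
    (h : X ∈ filt P e n) :
    Aff.hat P x p α X + Complex.I • Aff.hat P x p α (-(Complex.I • X)) ∈ filt P e n ∧
    Aff.hat P x p α X - Complex.I • Aff.hat P x p α (-(Complex.I • X)) ∈ filt P (-e) n := by
  match α with
  | .r i =>
    have h2 : Aff.hat P x p (.r i) (-(Complex.I • X)) =
        -(Complex.I • Aff.hat P x p (.r i) X) := by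
      simp [Aff.hat]
    rw [h2, smul_neg, smul_smul, Complex.I_mul_I, neg_smul, one_smul, neg_neg, sub_self]
    have h3 := gen_pow_mem_filt h x p i.val
    exact ⟨Submodule.add_mem _ h3 h3, Submodule.zero_mem _⟩
  | .sr i =>
    have h2 : Aff.hat P x p (.sr i) (-(Complex.I • X)) =
        Complex.I • Aff.hat P x p (.sr i) X := by
      simp [Aff.hat, Aff.tau_smul]
    rw [h2, smul_smul, Complex.I_mul_I, neg_smul, one_smul, add_neg_cancel, sub_neg_eq_add]
    have h3 := tau_mem_filt (gen_pow_mem_filt h x p i.val)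
    exact ⟨Submodule.zero_mem _, Submodule.add_mem _ h3 h3⟩

end Filtration

section Complexification

variable [NeZero T] (P : DihedralGaudin T 𝔤)

theorem rTensor_conj_smul {V : Type*} [AddCommGroup V] [Module ℝ V] (c : ℂ) (v : ℂ ⊗[ℝ] V) :
    LinearMap.rTensor V Complex.conjAe.toLinearMap (c • v) =
      conj c • LinearMap.rTensor V Complex.conjAe.toLinearMap v := by
  induction v using TensorProduct.induction_on with
  | zero => simp
  | tmul z X => simp [TensorProduct.smul_tmul']
  | add v w h h' => rw [smul_add, map_add, map_add, h, h', smul_add]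

/-- the complexification of the real Lie algebra `gD P` -/
def gDC : Type _ := ℂ ⊗[ℝ] (gD P)

instance : AddCommGroup (gDC P) := inferInstanceAs (AddCommGroup (ℂ ⊗[ℝ] (gD P)))

instance : Module ℂ (gDC P) := inferInstanceAs (Module ℂ (ℂ ⊗[ℝ] (gD P)))

instance : LieRing (gDC P) := inferInstanceAs (LieRing (ℂ ⊗[ℝ] (gD P)))

instance : LieAlgebra ℂ (gDC P) := inferInstanceAs (LieAlgebra ℂ (ℂ ⊗[ℝ] (gD P)))

variable {P} in
/-- the pure tensor `z ⊗ X` -/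
def tm (z : ℂ) (X : gD P) : gDC P := z ⊗ₜ[ℝ] X

/-- complex conjugation in the scalar factor -/
def conjC : gDC P →ₛₗ[starRingEnd ℂ] gDC P where
  toFun := LinearMap.rTensor (gD P) Complex.conjAe.toLinearMap
  map_add' v w := map_add (LinearMap.rTensor (gD P) Complex.conjAe.toLinearMap) v w
  map_smul' c v := rTensor_conj_smul c v

/-- the complex linear extension of the inclusion of `gD P` in the sum of Takiff algebras -/
def phi : gDC P →ₗ[ℂ] TakD P := LinearMap.liftBaseChange ℂ (gD P).toSubmodule.subtype

variable {P}

@[simp] theorem conjC_tm (z : ℂ) (X : gD P) : conjC P (tm z X) = tm (conj z) X := rfl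

@[simp] theorem phi_tm (z : ℂ) (X : gD P) : phi P (tm z X) = z • (X : TakD P) :=
  LinearMap.liftBaseChange_tmul _ _ _ _

@[simp] theorem tm_lie (z w : ℂ) (X Y : gD P) : ⁅tm z X, tm w Y⁆ = tm (z * w) ⁅X, Y⁆ := rfl

theorem gDC_induction {p : gDC P → Prop} (v : gDC P) (h0 : p 0) (ht : ∀ z X, p (tm z X))
    (ha : ∀ v w, p v → p w → p (v + w)) : p v := TensorProduct.induction_on v h0 ht ha

theorem conjC_conjC (v : gDC P) : conjC P (conjC P v) = v := by
  induction v using gDC_induction with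
  | h0 => simp
  | ht z X => simp
  | ha v w h h' => rw [map_add, map_add, h, h']

theorem conjC_lie (v w : gDC P) : conjC P ⁅v, w⁆ = ⁅conjC P v, conjC P w⁆ := by
  induction v using gDC_induction with
  | h0 => simp
  | ha v v' h h' => rw [add_lie, map_add, map_add, h, h', add_lie]
  | ht z X =>
    induction w using gDC_induction with
    | h0 => simp
    | ha v v' h h' => rw [lie_add, map_add, map_add, h, h', lie_add]
    | ht y Y => simp

theorem phi_lie (v w : gDC P) : phi P ⁅v, w⁆ = ⁅phi P v, phi P w⁆ := by
  induction v using gDC_induction with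
  | h0 => simp
  | ha v v' h h' => rw [add_lie, map_add, map_add, h, h', add_lie]
  | ht z X =>
    induction w using gDC_induction with
    | h0 => simp
    | ha v v' h h' => rw [lie_add, map_add, map_add, h, h', lie_add]
    | ht y Y => simp [smul_smul, mul_comm]

variable (P) in
/-- The filtration of `gDC P` (for `e = 1`) and its image under complex conjugation
(for `e = -1`), in terms of the isomorphism `v ↦ (phi v, phi (conj v))` of the complexification
with its image in the sum of the Takiff algebras and their complex conjugates. -/
def filtDC (e : ℤ) (n : ℕ) : Submodule ℂ (gDC P) where
  carrier := {v | ∀ x p, phi P v x p ∈ filt P e n ∧ phi P (conjC P v) x p ∈ filt P (-e) n}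
  add_mem' hv hw x p := by
    simp only [map_add, TakD.add_apply]
    exact ⟨Submodule.add_mem _ (hv x p).1 (hw x p).1, Submodule.add_mem _ (hv x p).2 (hw x p).2⟩
  zero_mem' x p := by simp
  smul_mem' c v hv x p := by
    simp only [LinearMap.map_smulₛₗ, RingHom.id_apply, TakD.smul_apply]
    exact ⟨Submodule.smul_mem _ _ (hv x p).1, Submodule.smul_mem _ _ (hv x p).2⟩

theorem filtDC_anti {e : ℤ} {m n : ℕ} (h : m ≤ n) : filtDC P e n ≤ filtDC P e m :=
  fun _ hv x p => ⟨filt_anti h (hv x p).1, filt_anti h (hv x p).2⟩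

theorem conjC_mem_filtDC {e : ℤ} {n : ℕ} {v : gDC P} (h : v ∈ filtDC P e n) :
    conjC P v ∈ filtDC P (-e) n :=
  fun x p => ⟨(h x p).2, by rw [conjC_conjC, neg_neg]; exact (h x p).1⟩

theorem bracket_mem_filtDC {e : ℤ} {m : ℕ} (hm : 1 ≤ m) {v w : gDC P} (hv : v ∈ filtDC P e m)
    (hw : w ∈ filtDC P e m) : ⁅v, w⁆ ∈ filtDC P e m := by
  refine fun x p => ⟨?_, ?_⟩
  · rw [phi_lie]
    exact TakD.bracket_mem (fun x p q => bracket_mem_filt hm (hv x p).1 (hw x q).1) x p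
  · rw [conjC_lie, phi_lie]
    exact TakD.bracket_mem (fun x p q => bracket_mem_filt hm (hv x p).2 (hw x q).2) x p

theorem bracket_filtDC {e : ℤ} (he : e = 1 ∨ e = -1) (v : gDC P) (n : ℕ) :
    ∃ m₀, ∀ m, m₀ ≤ m → ∀ w ∈ filtDC P e m, ⁅v, w⁆ ∈ filtDC P e n := by
  obtain ⟨b, hb⟩ := (phi P v).exists_bd
  obtain ⟨b', hb'⟩ := (phi P (conjC P v)).exists_bd
  refine ⟨n + 1 + (b + b'), fun m hm w hw x p => ⟨?_, ?_⟩⟩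
  · rw [phi_lie]
    refine TakD.bracket_mem (fun x p q => bracket_filt he _ _ m ?_ (hw x q).1) x p
    have := hb x p; omega
  · rw [conjC_lie, phi_lie]
    refine TakD.bracket_mem (fun x p q => bracket_filt ?_ _ _ m ?_ (hw x q).2) x p
    · rcases he with rfl | rfl <;> simp
    · have := hb' x p; omega

open Classical in
variable (P) in
/-- the stabilizer of a point in the dihedral group -/
def stab (x : OnePoint ℂ) : Finset (DihedralGroup T) :=
  Finset.univ.filter fun α => mobius P.ω α x = x

open Classical in
variable (P) in
/-- the number of rotations fixing a point -/
def rotCard (x : OnePoint ℂ) : ℕ :=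
  (Finset.univ.filter fun i : ZMod T => mobius P.ω (DihedralGroup.r i) x = x).card

theorem mem_stab {x : OnePoint ℂ} {α : DihedralGroup T} :
    α ∈ stab P x ↔ mobius P.ω α x = x := by
  simp [stab]

theorem hat_sum_stab (x : OnePoint ℂ) (p : ℕ) (X : Aff P) {β : DihedralGroup T}
    (hβ : mobius P.ω β x = x) :
    Aff.hat P x p β (∑ α ∈ stab P x, Aff.hat P x p α X) = ∑ α ∈ stab P x, Aff.hat P x p α X := by
  have hβ' : mobius P.ω β⁻¹ x = x := by
    conv_lhs => rw [← hβ, ← mobius_mul, inv_mul_cancel]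
    have h1 := mobius_mul P β β⁻¹ x
    have h2 : mobius P.ω (1 : DihedralGroup T) x = x := by
      induction x using OnePoint.rec with
      | infty => rfl
      | coe z =>
        refine congrArg ((↑) : ℂ → OnePoint ℂ) ?_
        change P.ω ^ (0 : ZMod T).val * z = z
        simp
    exact h2
  rw [map_sum]
  refine Finset.sum_nbij' (fun α => β * α) (fun α => β⁻¹ * α) ?_ ?_ ?_ ?_ ?_
  · intro α hα
    rw [mem_stab] at hα ⊢
    rw [mobius_mul, hα, hβ]
  · intro α hα
    rw [mem_stab] at hα ⊢
    rw [mobius_mul, hα, hβ']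
  · intro α _; simp
  · intro α _; simp
  · intro α _; rw [Aff.hat_mul]

variable (P) in
/-- The real element `(1 / (2 |Γ_x|)) ∑_{α ∈ Π_x} α (X ε_x ^ p)`, where `Π_x` is the stabilizer of
`x` in the dihedral group and `Γ_x` its subgroup of rotations. -/
def proj (x : OnePoint ℂ) (p : ℕ) (X : Aff P) : gD P :=
  ⟨single P x p ((2 * rotCard P x : ℝ)⁻¹ • ∑ α ∈ stab P x, Aff.hat P x p α X), by
    intro y α hα q
    rw [single_apply]
    split_ifs with h
    · obtain ⟨rfl, rfl, h⟩ := h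
      rw [map_smul, hat_sum_stab _ _ _ hα]
    · rw [map_zero]⟩

variable (P) in
/-- The element of the complexification attached to `X ε_x ^ p`. At a point
with trivial stabilizer it is `(1 ⊗ X ε_x ^ p - i ⊗ (i X) ε_x ^ p) / 2`. In general
`X` is first averaged over the stabilizer. -/
def emb (x : OnePoint ℂ) (p : ℕ) (X : Aff P) : gDC P :=
  tm 1 (proj P x p X) + tm Complex.I (proj P x p (-(Complex.I • X)))

theorem emb_mem (x : OnePoint ℂ) (p : ℕ) {e : ℤ} {n : ℕ} {X : Aff P} (h : X ∈ filt P e n) :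
    emb P x p X ∈ filtDC P e n := by
  intro y q
  have key : ∀ (c : ℂ) (F : Submodule ℂ (Aff P)),
      (∀ α, Aff.hat P x p α X + c • Aff.hat P x p α (-(Complex.I • X)) ∈ F) →
      (proj P x p X : TakD P) y q + c • (proj P x p (-(Complex.I • X)) : TakD P) y q ∈ F := by
    intro c F hF
    simp only [proj, single_apply]
    split_ifs
    · rw [smul_comm c, ← smul_add (2 * (rotCard P x : ℝ))⁻¹, Finset.smul_sum,
        ← Finset.sum_add_distrib, ← Complex.coe_smul]
      exact Submodule.smul_mem _ _ (Submodule.sum_mem _ fun α _ => hF α)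
    · simp
  have h1 := key Complex.I (filt P e n) fun α => (hat_mem x p α h).1
  have h2 := key (-Complex.I) (filt P (-e) n) fun α => by
    rw [neg_smul, ← sub_eq_add_neg]; exact (hat_mem x p α h).2
  simp only [emb, map_add, conjC_tm, phi_tm, map_one, one_smul, TakD.add_apply,
    TakD.smul_apply, Complex.conj_I]
  exact ⟨h1, h2⟩

end Complexification

section SymmetricAlgebra

variable {M : Type*} [AddCommGroup M] [Module ℂ M]

/-- auxiliary: the algebra morphism `s ↦ s + ε D s` for the derivation `D` extending `f` -/
def derHom (f : M →ₗ[ℂ] SymmetricAlgebra ℂ M) :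
    SymmetricAlgebra ℂ M →ₐ[ℂ] TrivSqZeroExt (SymmetricAlgebra ℂ M) (SymmetricAlgebra ℂ M) :=
  SymmetricAlgebra.lift
    ((TrivSqZeroExt.inlAlgHom ℂ (SymmetricAlgebra ℂ M) (SymmetricAlgebra ℂ M)).toLinearMap ∘ₗ
        SymmetricAlgebra.ι ℂ M +
      (TrivSqZeroExt.inrHom (SymmetricAlgebra ℂ M) (SymmetricAlgebra ℂ M)).restrictScalars ℂ ∘ₗ f)

theorem derHom_ι (f : M →ₗ[ℂ] SymmetricAlgebra ℂ M) (a : M) :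
    derHom f (SymmetricAlgebra.ι ℂ M a) =
      TrivSqZeroExt.inl (SymmetricAlgebra.ι ℂ M a) + TrivSqZeroExt.inr (f a) := by
  simp [derHom]

theorem derHom_fst (f : M →ₗ[ℂ] SymmetricAlgebra ℂ M) (s : SymmetricAlgebra ℂ M) :
    (derHom f s).fst = s := by
  have h : (TrivSqZeroExt.fstHom ℂ (SymmetricAlgebra ℂ M) (SymmetricAlgebra ℂ M)).comp (derHom f) =
      AlgHom.id ℂ _ := by
    refine SymmetricAlgebra.algHom_ext ?_
    ext a
    simp [derHom_ι]
  exact DFunLike.congr_fun h s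

/-- the derivation of the symmetric algebra extending a linear map -/
def der (f : M →ₗ[ℂ] SymmetricAlgebra ℂ M) (s : SymmetricAlgebra ℂ M) : SymmetricAlgebra ℂ M :=
  (derHom f s).snd

@[simp] theorem der_ι (f : M →ₗ[ℂ] SymmetricAlgebra ℂ M) (a : M) :
    der f (SymmetricAlgebra.ι ℂ M a) = f a := by simp [der, derHom_ι]

@[simp] theorem der_algebraMap (f : M →ₗ[ℂ] SymmetricAlgebra ℂ M) (r : ℂ) :
    der f (algebraMap ℂ _ r) = 0 := by
  rw [der, AlgHom.commutes]
  rfl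

theorem der_mul (f : M →ₗ[ℂ] SymmetricAlgebra ℂ M) (s t : SymmetricAlgebra ℂ M) :
    der f (s * t) = s * der f t + t * der f s := by
  simp [der, derHom_fst, mul_comm]

theorem der_add (f : M →ₗ[ℂ] SymmetricAlgebra ℂ M) (s t : SymmetricAlgebra ℂ M) :
    der f (s + t) = der f s + der f t := by
  simp [der]

theorem der_smul (f : M →ₗ[ℂ] SymmetricAlgebra ℂ M) (c : ℂ) (s : SymmetricAlgebra ℂ M) :
    der f (c • s) = c • der f s := by
  simp [der]

theorem der_add_left (f g : M →ₗ[ℂ] SymmetricAlgebra ℂ M) (s : SymmetricAlgebra ℂ M) :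
    der (f + g) s = der f s + der g s := by
  induction s using SymmetricAlgebra.induction with
  | algebraMap r => simp
  | ι a => simp
  | mul s t hs ht => simp only [der_mul, hs, ht]; ring
  | add s t hs ht => simp only [der_add, hs, ht]; ring

theorem der_smul_left (c : ℂ) (f : M →ₗ[ℂ] SymmetricAlgebra ℂ M) (s : SymmetricAlgebra ℂ M) :
    der (c • f) s = c • der f s := by
  induction s using SymmetricAlgebra.induction with
  | algebraMap r => simp
  | ι a => simp
  | mul s t hs ht => simp only [der_mul, hs, ht, mul_smul_comm, smul_add]
  | add s t hs ht => simp only [der_add, hs, ht, smul_add]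

variable {L : Type*} [LieRing L] [LieAlgebra ℂ L]

/-- the derivation `{a, ·}` for an element `a` of the Lie algebra -/
def adS (a : L) : SymmetricAlgebra ℂ L → SymmetricAlgebra ℂ L :=
  der (SymmetricAlgebra.ι ℂ L ∘ₗ (LieModule.toEnd ℂ L L a : L →ₗ[ℂ] L))

/-- the map `a ↦ {a, g}` -/
def adSL (g : SymmetricAlgebra ℂ L) : L →ₗ[ℂ] SymmetricAlgebra ℂ L where
  toFun a := adS a g
  map_add' a b := by
    rw [adS, adS, adS, map_add, LinearMap.comp_add, der_add_left]
  map_smul' c a := by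
    rw [adS, adS, map_smul, LinearMap.comp_smul, der_smul_left]; rfl

variable (L) in
/-- The Poisson bracket of the symmetric algebra of a Lie algebra: the biderivation
extending the Lie bracket. -/
def poisson : SymmetricAlgebra ℂ L →ₗ[ℂ] SymmetricAlgebra ℂ L →ₗ[ℂ] SymmetricAlgebra ℂ L :=
  LinearMap.mk₂ ℂ (fun f g => der (adSL g) f) (fun f f' g => der_add _ f f')
    (fun c f g => der_smul _ c f)
    (fun f g g' => by
      rw [← der_add_left]
      congr 1
      ext a
      exact der_add _ g g')
    (fun c f g => by
      rw [← der_smul_left]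
      congr 1
      ext a
      exact der_smul _ c g)

theorem poisson_apply (f g : SymmetricAlgebra ℂ L) : poisson L f g = der (adSL g) f := rfl

theorem poisson_ι_left (a : L) (g : SymmetricAlgebra ℂ L) :
    poisson L (SymmetricAlgebra.ι ℂ L a) g = adS a g := by
  rw [poisson_apply, der_ι]; rfl

theorem poisson_ι_ι (a b : L) :
    poisson L (SymmetricAlgebra.ι ℂ L a) (SymmetricAlgebra.ι ℂ L b) =
      SymmetricAlgebra.ι ℂ L ⁅a, b⁆ := by
  rw [poisson_ι_left, adS, der_ι]; rfl

theorem poisson_mul_left (f f' g : SymmetricAlgebra ℂ L) :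
    poisson L (f * f') g = f * poisson L f' g + f' * poisson L f g := der_mul _ f f'

theorem poisson_algebraMap_left (r : ℂ) (g : SymmetricAlgebra ℂ L) :
    poisson L (algebraMap ℂ _ r) g = 0 := der_algebraMap _ r

theorem poisson_skew (f g : SymmetricAlgebra ℂ L) : poisson L f g = - poisson L g f := by
  have h0 : ∀ (r : ℂ) (f : SymmetricAlgebra ℂ L), poisson L f (algebraMap ℂ _ r) = 0 := by
    intro r f
    rw [poisson_apply]
    have : adSL (L := L) (algebraMap ℂ _ r) = 0 := by
      ext a; exact der_algebraMap _ r
    rw [this]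
    induction f using SymmetricAlgebra.induction with
    | algebraMap r => simp
    | ι a => simp
    | mul s t hs ht => simp only [der_mul, hs, ht]; ring
    | add s t hs ht => simp only [der_add, hs, ht]; ring
  have h1 : ∀ (f g g' : SymmetricAlgebra ℂ L),
      poisson L f (g * g') = g * poisson L f g' + g' * poisson L f g := by
    intro f g g'
    induction f using SymmetricAlgebra.induction with
    | algebraMap r => simp [poisson_algebraMap_left]
    | ι a => simp only [poisson_ι_left]; exact der_mul _ g g'
    | mul s t hs ht => simp only [poisson_mul_left, hs, ht]; ring
    | add s t hs ht => simp only [map_add, LinearMap.add_apply, hs, ht]; ring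
  induction f using SymmetricAlgebra.induction with
  | algebraMap r => rw [poisson_algebraMap_left, h0, neg_zero]
  | mul s t hs ht => rw [poisson_mul_left, h1, hs, ht]; ring
  | add s t hs ht => simp only [map_add, LinearMap.add_apply, hs, ht]; ring
  | ι a =>
    induction g using SymmetricAlgebra.induction with
    | algebraMap r => rw [poisson_algebraMap_left, h0, neg_zero]
    | mul s t hs ht => rw [poisson_mul_left, h1, hs, ht]; ring
    | add s t hs ht => simp only [map_add, LinearMap.add_apply, hs, ht]; ring
    | ι b => rw [poisson_ι_ι, poisson_ι_ι, ← map_neg, lie_skew]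

theorem poisson_mul_right (f g g' : SymmetricAlgebra ℂ L) :
    poisson L f (g * g') = g * poisson L f g' + g' * poisson L f g := by
  rw [poisson_skew, poisson_mul_left, poisson_skew g, poisson_skew g']; ring

end SymmetricAlgebra

section Completion

variable {M N K : Type*} [AddCommGroup M] [Module ℂ M] [AddCommGroup N] [Module ℂ N]
  [AddCommGroup K] [Module ℂ K]

/-- The completion `lim M / F n` of a module with respect to a descending filtration: the
families of classes `f n` in `M / F n` which are compatible, in the sense that for `m ≤ n` the
classes `f m` and `f n` have a common representative. -/
def Compl (F : ℕ → Submodule ℂ M) : Submodule ℂ (∀ n, M ⧸ F n) where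
  carrier := {f | ∀ m n, m ≤ n → ∃ a, (F m).mkQ a = f m ∧ (F n).mkQ a = f n}
  add_mem' := by
    intro f g hf hg m n h
    obtain ⟨a, h1, h2⟩ := hf m n h
    obtain ⟨b, h3, h4⟩ := hg m n h
    exact ⟨a + b, by rw [map_add, h1, h3]; rfl, by rw [map_add, h2, h4]; rfl⟩
  zero_mem' m n _ := ⟨0, map_zero _, map_zero _⟩
  smul_mem' := by
    intro c f hf m n h
    obtain ⟨a, h1, h2⟩ := hf m n h
    exact ⟨c • a, by rw [map_smul, h1]; rfl, by rw [map_smul, h2]; rfl⟩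

variable {F : ℕ → Submodule ℂ M} {G : ℕ → Submodule ℂ N} {H : ℕ → Submodule ℂ K}

/-- the element of the completion defined by a convergent sequence of representatives -/
def Compl.ofSeq (u : ℕ → M) (hu : ∀ m n, m ≤ n → u n - u m ∈ F m) : Compl F :=
  ⟨fun n => (F n).mkQ (u n), fun m n h => ⟨u n, by
    rw [← sub_eq_zero, ← map_sub]
    exact (Submodule.Quotient.mk_eq_zero _).mpr (hu m n h), rfl⟩⟩

/-- the map of completions induced by a filtered linear map -/
def Compl.map (φ : M →ₗ[ℂ] N) (hφ : ∀ n, F n ≤ (G n).comap φ) : Compl F →ₗ[ℂ] Compl G where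
  toFun f := ⟨fun n => (F n).mapQ (G n) φ (hφ n) (f.1 n), by
    intro m n h
    obtain ⟨a, h1, h2⟩ := f.2 m n h
    exact ⟨φ a, by dsimp only; rw [← h1]; rfl, by dsimp only; rw [← h2]; rfl⟩⟩
  map_add' f g := Subtype.ext (funext fun n => map_add _ _ _)
  map_smul' c f := Subtype.ext (funext fun n => map_smul ((F n).mapQ (G n) φ (hφ n)) c (f.1 n))

/-- Continuity of a bilinear map for the topologies defined by filtrations: continuity at the
origin and separate continuity. -/
structure ContBilin (B : M →ₗ[ℂ] N →ₗ[ℂ] K) (F : ℕ → Submodule ℂ M) (G : ℕ → Submodule ℂ N)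
    (H : ℕ → Submodule ℂ K) : Prop where
  antiF : Antitone F
  antiG : Antitone G
  joint : ∀ n, ∃ m, ∀ a ∈ F m, ∀ b ∈ G m, B a b ∈ H n
  left : ∀ a n, ∃ m, ∀ b ∈ G m, B a b ∈ H n
  right : ∀ b n, ∃ m, ∀ a ∈ F m, B a b ∈ H n

theorem Compl.rep (hF : Antitone F) (f : Compl F) {m n : ℕ} (h : m ≤ n) {a : M}
    (ha : (F n).mkQ a = f.1 n) : (F m).mkQ a = f.1 m := by
  obtain ⟨b, h1, h2⟩ := f.2 m n h
  rw [← h1, ← sub_eq_zero, ← map_sub]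
  refine (Submodule.Quotient.mk_eq_zero _).mpr (hF h ?_)
  rw [← h2, ← sub_eq_zero, ← map_sub] at ha
  exact (Submodule.Quotient.mk_eq_zero _).mp ha

theorem ContBilin.eventually {B : M →ₗ[ℂ] N →ₗ[ℂ] K} (hB : ContBilin B F G H) (f : Compl F)
    (g : Compl G) (n : ℕ) : ∃ c, ∃ k, ∀ l, k ≤ l → ∀ a b, (F l).mkQ a = f.1 l →
      (G l).mkQ b = g.1 l → (H n).mkQ (B a b) = c := by
  obtain ⟨m, hm⟩ := hB.joint n
  obtain ⟨a₀, ha₀⟩ := (F m).mkQ_surjective (f.1 m)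
  obtain ⟨b₀, hb₀⟩ := (G m).mkQ_surjective (g.1 m)
  obtain ⟨m₁, hm₁⟩ := hB.left a₀ n
  obtain ⟨m₂, hm₂⟩ := hB.right b₀ n
  set k := max m (max m₁ m₂) with hk
  have key : ∀ l, k ≤ l → ∀ a b a' b', (F k).mkQ a = f.1 k → (G k).mkQ b = g.1 k →
      (F k).mkQ a' = f.1 k → (G k).mkQ b' = g.1 k → B a b - B a' b' ∈ H n := by
    intro l hl a b a' b' ha hb ha' hb'
    have e1 : ∀ {i} {x y : M}, (F i).mkQ x = f.1 i → (F i).mkQ y = f.1 i → x - y ∈ F i := by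
      intro i x y hx hy
      refine (Submodule.Quotient.mk_eq_zero _).mp ?_
      change (F i).mkQ (x - y) = 0
      rw [map_sub, hx, hy, sub_self]
    have e2 : ∀ {i} {x y : N}, (G i).mkQ x = g.1 i → (G i).mkQ y = g.1 i → x - y ∈ G i := by
      intro i x y hx hy
      refine (Submodule.Quotient.mk_eq_zero _).mp ?_
      change (G i).mkQ (x - y) = 0
      rw [map_sub, hx, hy, sub_self]
    have hmk : m ≤ k := le_max_left _ _
    have h1k : m₁ ≤ k := (le_max_left _ _).trans (le_max_right _ _)
    have h2k : m₂ ≤ k := (le_max_right _ _).trans (le_max_right _ _)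
    have ea := e1 ha ha'
    have eb := e2 hb hb'
    have ea' := e1 (Compl.rep hB.antiF f hmk ha') ha₀
    have eb' := e2 (Compl.rep hB.antiG g hmk hb) hb₀
    have t1 := hm _ (hB.antiF hmk ea) _ eb'
    have t2 := hm₂ _ (hB.antiF h2k ea)
    have t3 := hm _ ea' _ (hB.antiG hmk eb)
    have t4 := hm₁ _ (hB.antiG h1k eb)
    have : B a b - B a' b' = B (a - a') (b - b₀) + B (a - a') b₀ + B (a' - a₀) (b - b')
        + B a₀ (b - b') := by
      simp only [map_sub, LinearMap.sub_apply]; abel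
    rw [this]
    exact Submodule.add_mem _ (Submodule.add_mem _ (Submodule.add_mem _ t1 t2) t3) t4
  obtain ⟨a, ha⟩ := (F k).mkQ_surjective (f.1 k)
  obtain ⟨b, hb⟩ := (G k).mkQ_surjective (g.1 k)
  refine ⟨(H n).mkQ (B a b), k, fun l hl a' b' ha' hb' => ?_⟩
  rw [← sub_eq_zero, ← map_sub]
  exact (Submodule.Quotient.mk_eq_zero _).mpr (key l hl _ _ _ _ (Compl.rep hB.antiF f hl ha')
    (Compl.rep hB.antiG g hl hb') ha hb)

/-- The extension of a continuous bilinear map to the completions: its component in `K / H n` is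
the class of `B a b`, for `a` and `b` close enough to the two arguments. -/
def ContBilin.ext {B : M →ₗ[ℂ] N →ₗ[ℂ] K} (hB : ContBilin B F G H) (f : Compl F) (g : Compl G) :
    Compl H :=
  ⟨fun n => (hB.eventually f g n).choose, by
    intro m n _
    obtain ⟨k, hk⟩ := (hB.eventually f g m).choose_spec
    obtain ⟨l, hl⟩ := (hB.eventually f g n).choose_spec
    obtain ⟨a, ha⟩ := (F (max k l)).mkQ_surjective (f.1 (max k l))
    obtain ⟨b, hb⟩ := (G (max k l)).mkQ_surjective (g.1 (max k l))
    exact ⟨B a b, hk _ (le_max_left _ _) a b ha hb, hl _ (le_max_right _ _) a b ha hb⟩⟩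

theorem ContBilin.ext_spec {B : M →ₗ[ℂ] N →ₗ[ℂ] K} (hB : ContBilin B F G H) (f : Compl F)
    (g : Compl G) (n : ℕ) : ∃ k, ∀ l, k ≤ l → ∀ a b, (F l).mkQ a = f.1 l →
      (G l).mkQ b = g.1 l → (H n).mkQ (B a b) = (hB.ext f g).1 n :=
  (hB.eventually f g n).choose_spec

end Completion

section Observables

variable [NeZero T] (P : DihedralGaudin T 𝔤)

/-- the symmetric algebra of `gDC P`, the algebra of formal observables before completion -/
abbrev Sym : Type _ := SymmetricAlgebra ℂ (gDC P)

/-- the ideal of `Sym P` generated by `filtDC P e n` -/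
def idealS (e : ℤ) (n : ℕ) : Ideal (Sym P) :=
  Ideal.span (SymmetricAlgebra.ι ℂ (gDC P) '' (filtDC P e n : Set (gDC P)))

/-- the filtration of `Sym P`: the intersection of the ideals generated by the `n`-th
subspace of the filtration of `gDC P` and by its complex conjugate -/
def FS (n : ℕ) : Submodule ℂ (Sym P) := (idealS P 1 n ⊓ idealS P (-1) n).restrictScalars ℂ

/-- the filtration of `Aff P ⊗ gDC P` -/
def FFld (n : ℕ) : Submodule ℂ (Aff P ⊗[ℂ] gDC P) :=
  Submodule.map₂ (TensorProduct.mk ℂ _ _) (filt P 1 n) (filtDC P (-1) n) ⊔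
  Submodule.map₂ (TensorProduct.mk ℂ _ _) (filt P (-1) n) (filtDC P 1 n)

/-- the filtration of `Aff P ⊗ Sym P` -/
def FAS (n : ℕ) : Submodule ℂ (Aff P ⊗[ℂ] Sym P) :=
  Submodule.map₂ (TensorProduct.mk ℂ _ _) (filt P 1 n) ((idealS P (-1) n).restrictScalars ℂ) ⊔
  Submodule.map₂ (TensorProduct.mk ℂ _ _) (filt P (-1) n) ((idealS P 1 n).restrictScalars ℂ) ⊔
  Submodule.map₂ (TensorProduct.mk ℂ _ _) ⊤ (FS P n)

/-- the completed algebra of formal observables -/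
abbrev SHat : Type _ := Compl (FS P)

/-- the space of formal fields -/
abbrev Fld : Type _ := Compl (FFld P)

/-- the completion of `Aff P ⊗ Sym P` -/
abbrev AuxS : Type _ := Compl (FAS P)

/-- the product in `Sym P` of two elements of `gDC P` -/
def mulG : gDC P →ₗ[ℂ] gDC P →ₗ[ℂ] Sym P :=
  (LinearMap.mul ℂ (Sym P)).compl₁₂ (SymmetricAlgebra.ι ℂ (gDC P)) (SymmetricAlgebra.ι ℂ (gDC P))

/-- `(X ⊗ u | Y ⊗ v) = (X | Y) u v` -/
def pair₀ : Aff P ⊗[ℂ] gDC P →ₗ[ℂ] Aff P ⊗[ℂ] gDC P →ₗ[ℂ] Sym P :=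
  (TensorProduct.map₂ (Aff.form P) (mulG P)).compr₂ (TensorProduct.lid ℂ (Sym P)).toLinearMap

/-- `[X ⊗ u, Y ⊗ v] = [X, Y] ⊗ u v` -/
def aux₀ : Aff P ⊗[ℂ] gDC P →ₗ[ℂ] Aff P ⊗[ℂ] gDC P →ₗ[ℂ] Aff P ⊗[ℂ] Sym P :=
  TensorProduct.map₂ (LieModule.toEnd ℂ (Aff P) (Aff P) : Aff P →ₗ[ℂ] Aff P →ₗ[ℂ] Aff P) (mulG P)

/-- `{f, X ⊗ u} = X ⊗ {f, u}` -/
def act₀ : Sym P →ₗ[ℂ] Aff P ⊗[ℂ] gDC P →ₗ[ℂ] Aff P ⊗[ℂ] Sym P :=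
  LinearMap.lTensorHom (Aff P) ∘ₗ (poisson (gDC P)).compl₂ (SymmetricAlgebra.ι ℂ (gDC P))

variable {P}

theorem mulG_apply (u v : gDC P) :
    mulG P u v = SymmetricAlgebra.ι ℂ (gDC P) u * SymmetricAlgebra.ι ℂ (gDC P) v := rfl

theorem pair₀_tmul (X Y : Aff P) (u v : gDC P) :
    pair₀ P (X ⊗ₜ u) (Y ⊗ₜ v) = Aff.form P X Y • mulG P u v := by
  simp [pair₀]

theorem aux₀_tmul (X Y : Aff P) (u v : gDC P) :
    aux₀ P (X ⊗ₜ u) (Y ⊗ₜ v) = ⁅X, Y⁆ ⊗ₜ mulG P u v := by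
  simp [aux₀]

theorem act₀_tmul (f : Sym P) (Y : Aff P) (v : gDC P) :
    act₀ P f (Y ⊗ₜ v) = Y ⊗ₜ poisson (gDC P) f (SymmetricAlgebra.ι ℂ (gDC P) v) := by
  simp [act₀]

theorem ι_mem_idealS {e : ℤ} {n : ℕ} {v : gDC P} (h : v ∈ filtDC P e n) :
    SymmetricAlgebra.ι ℂ (gDC P) v ∈ idealS P e n := Ideal.subset_span ⟨v, h, rfl⟩

theorem idealS_anti {e : ℤ} {m n : ℕ} (h : m ≤ n) : idealS P e n ≤ idealS P e m :=
  Ideal.span_mono (Set.image_mono (filtDC_anti h))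

theorem FS_anti : Antitone (FS P) := fun _ _ h =>
  inf_le_inf (idealS_anti h) (idealS_anti h)

theorem FFld_anti : Antitone (FFld P) := fun _ _ h =>
  sup_le_sup (Submodule.map₂_le_map₂ (filt_anti h) (filtDC_anti h))
    (Submodule.map₂_le_map₂ (filt_anti h) (filtDC_anti h))

theorem FAS_left {n : ℕ} {X : Aff P} {s : Sym P} (h : X ∈ filt P 1 n) (h' : s ∈ idealS P (-1) n) :
    X ⊗ₜ[ℂ] s ∈ FAS P n :=
  Submodule.mem_sup_left (Submodule.mem_sup_left (Submodule.apply_mem_map₂ _ h h'))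

theorem FAS_right {n : ℕ} {X : Aff P} {s : Sym P} (h : X ∈ filt P (-1) n) (h' : s ∈ idealS P 1 n) :
    X ⊗ₜ[ℂ] s ∈ FAS P n :=
  Submodule.mem_sup_left (Submodule.mem_sup_right (Submodule.apply_mem_map₂ _ h h'))

theorem FAS_top {n : ℕ} {X : Aff P} {s : Sym P} (h : s ∈ FS P n) : X ⊗ₜ[ℂ] s ∈ FAS P n :=
  Submodule.mem_sup_right (Submodule.apply_mem_map₂ _ Submodule.mem_top h)

/-- membership in a subspace can be checked on the generators of the filtration -/
theorem FFld_le {K : Type*} [AddCommGroup K] [Module ℂ K] {B : Aff P ⊗[ℂ] gDC P →ₗ[ℂ] K} {n : ℕ}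
    {H : Submodule ℂ K}
    (h : ∀ e : ℤ, (e = 1 ∨ e = -1) → ∀ X ∈ filt P e n, ∀ u ∈ filtDC P (-e) n, B (X ⊗ₜ u) ∈ H) :
    ∀ b ∈ FFld P n, B b ∈ H := by
  have : FFld P n ≤ H.comap B := by
    refine sup_le (Submodule.map₂_le.mpr fun X hX u hu => h 1 (Or.inl rfl) X hX u hu)
      (Submodule.map₂_le.mpr fun X hX u hu => h (-1) (Or.inr rfl) X hX u ?_)
    rwa [neg_neg]
  exact this

theorem poisson_ideal₁ {e : ℤ} {m : ℕ} (hm : 1 ≤ m) {f : Sym P} (hf : f ∈ idealS P e m)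
    {u : gDC P} (hu : u ∈ filtDC P e m) :
    poisson (gDC P) f (SymmetricAlgebra.ι ℂ (gDC P) u) ∈ idealS P e m := by
  induction hf using Submodule.span_induction with
  | mem x hx =>
    obtain ⟨w, hw, rfl⟩ := hx
    rw [poisson_ι_ι]
    exact ι_mem_idealS (bracket_mem_filtDC hm hw hu)
  | zero => simp
  | add x y _ _ hx hy =>
    rw [map_add, LinearMap.add_apply]
    exact Ideal.add_mem _ hx hy
  | smul s x hx h =>
    rw [smul_eq_mul, poisson_mul_left]
    exact Ideal.add_mem _ (Ideal.mul_mem_left _ _ h) (Ideal.mul_mem_right _ _ hx)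

theorem poisson_ideal {e : ℤ} {m : ℕ} (hm : 1 ≤ m) {f g : Sym P} (hf : f ∈ idealS P e m)
    (hg : g ∈ idealS P e m) : poisson (gDC P) f g ∈ idealS P e m := by
  induction hg using Submodule.span_induction with
  | mem x hx =>
    obtain ⟨w, hw, rfl⟩ := hx
    exact poisson_ideal₁ hm hf hw
  | zero => simp
  | add x y _ _ hx hy =>
    rw [map_add]
    exact Ideal.add_mem _ hx hy
  | smul s x hx h =>
    rw [smul_eq_mul, poisson_mul_right]
    exact Ideal.add_mem _ (Ideal.mul_mem_left _ _ h) (Ideal.mul_mem_right _ _ hx)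

theorem poisson_left_cont {e : ℤ} (he : e = 1 ∨ e = -1) (f : Sym P) (n : ℕ) :
    ∃ m, ∀ g ∈ idealS P e m, poisson (gDC P) f g ∈ idealS P e n := by
  induction f using SymmetricAlgebra.induction with
  | algebraMap r => exact ⟨0, fun g _ => by rw [poisson_algebraMap_left]; exact Ideal.zero_mem _⟩
  | mul f f' h h' =>
    obtain ⟨m, hm⟩ := h
    obtain ⟨m', hm'⟩ := h'
    refine ⟨max m m', fun g hg => ?_⟩
    rw [poisson_mul_left]
    exact Ideal.add_mem _
      (Ideal.mul_mem_left _ _ (hm' g (idealS_anti (le_max_right _ _) hg)))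
      (Ideal.mul_mem_left _ _ (hm g (idealS_anti (le_max_left _ _) hg)))
  | add f f' h h' =>
    obtain ⟨m, hm⟩ := h
    obtain ⟨m', hm'⟩ := h'
    refine ⟨max m m', fun g hg => ?_⟩
    rw [map_add, LinearMap.add_apply]
    exact Ideal.add_mem _ (hm g (idealS_anti (le_max_left _ _) hg))
      (hm' g (idealS_anti (le_max_right _ _) hg))
  | ι v =>
    obtain ⟨m₀, hm₀⟩ := bracket_filtDC he v n
    refine ⟨max n m₀, fun g hg => ?_⟩
    induction hg using Submodule.span_induction with
    | mem x hx =>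
      obtain ⟨w, hw, rfl⟩ := hx
      rw [poisson_ι_ι]
      exact ι_mem_idealS (hm₀ _ (le_max_right _ _) w hw)
    | zero => simp
    | add x y _ _ hx hy =>
      rw [map_add]
      exact Ideal.add_mem _ hx hy
    | smul s x hx h =>
      rw [smul_eq_mul, poisson_mul_right]
      exact Ideal.add_mem _ (Ideal.mul_mem_left _ _ h)
        (Ideal.mul_mem_right _ _ (idealS_anti (le_max_left _ _) hx))

theorem poisson_left_FS (f : Sym P) (n : ℕ) :
    ∃ m, ∀ g ∈ FS P m, poisson (gDC P) f g ∈ FS P n := by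
  obtain ⟨m, hm⟩ := poisson_left_cont (Or.inl rfl) f n
  obtain ⟨m', hm'⟩ := poisson_left_cont (Or.inr rfl) f n
  exact ⟨max m m', fun g hg => ⟨hm g (idealS_anti (le_max_left _ _) hg.1),
    hm' g (idealS_anti (le_max_right _ _) hg.2)⟩⟩

theorem poisson_cont : ContBilin (poisson (gDC P)) (FS P) (FS P) (FS P) where
  antiF := FS_anti
  antiG := FS_anti
  joint n := ⟨max n 1, fun f hf g hg => FS_anti (le_max_left n 1)
    ⟨poisson_ideal (le_max_right _ _) hf.1 hg.1, poisson_ideal (le_max_right _ _) hf.2 hg.2⟩⟩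
  left := poisson_left_FS
  right f n := by
    obtain ⟨m, hm⟩ := poisson_left_FS f n
    refine ⟨m, fun g hg => ?_⟩
    rw [poisson_skew]
    exact Submodule.neg_mem _ (hm g hg)

theorem mulG_left {e : ℤ} {n : ℕ} (u : gDC P) {v : gDC P} (hv : v ∈ filtDC P e n) :
    mulG P u v ∈ idealS P e n := by
  rw [mulG_apply]; exact Ideal.mul_mem_left _ _ (ι_mem_idealS hv)

theorem mulG_right {e : ℤ} {n : ℕ} {u : gDC P} (v : gDC P) (hu : u ∈ filtDC P e n) :
    mulG P u v ∈ idealS P e n := by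
  rw [mulG_apply]; exact Ideal.mul_mem_right _ _ (ι_mem_idealS hu)

theorem mulG_mem {e : ℤ} (he : e = 1 ∨ e = -1) {n : ℕ} {u v : gDC P} (hu : u ∈ filtDC P e n)
    (hv : v ∈ filtDC P (-e) n) : mulG P u v ∈ FS P n := by
  rcases he with rfl | rfl
  · exact ⟨mulG_right _ hu, mulG_left _ hv⟩
  · exact ⟨mulG_left _ (by rwa [neg_neg] at hv), mulG_right _ hu⟩

theorem FAS_mem {e : ℤ} (he : e = 1 ∨ e = -1) {n : ℕ} {X : Aff P} {s : Sym P} (h : X ∈ filt P e n)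
    (h' : s ∈ idealS P (-e) n) : X ⊗ₜ[ℂ] s ∈ FAS P n := by
  rcases he with rfl | rfl
  · exact FAS_left h h'
  · exact FAS_right h (by rwa [neg_neg] at h')

theorem left_of_tmul {K : Type*} [AddCommGroup K] [Module ℂ K]
    {B : Aff P ⊗[ℂ] gDC P →ₗ[ℂ] Aff P ⊗[ℂ] gDC P →ₗ[ℂ] K} {H : Submodule ℂ K}
    (h : ∀ X u, ∃ m, ∀ b ∈ FFld P m, B (X ⊗ₜ u) b ∈ H) (a : Aff P ⊗[ℂ] gDC P) :
    ∃ m, ∀ b ∈ FFld P m, B a b ∈ H := by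
  induction a using TensorProduct.induction_on with
  | zero => exact ⟨0, fun b _ => by simp⟩
  | tmul X u => exact h X u
  | add a a' ha ha' =>
    obtain ⟨m, hm⟩ := ha
    obtain ⟨m', hm'⟩ := ha'
    refine ⟨max m m', fun b hb => ?_⟩
    rw [map_add, LinearMap.add_apply]
    exact Submodule.add_mem _ (hm b (FFld_anti (le_max_left _ _) hb))
      (hm' b (FFld_anti (le_max_right _ _) hb))

theorem pair₀_symm (a b : Aff P ⊗[ℂ] gDC P) : pair₀ P a b = pair₀ P b a := by
  induction a using TensorProduct.induction_on with
  | zero => simp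
  | add a a' h h' => rw [map_add, LinearMap.add_apply, h, h', map_add]
  | tmul X u =>
    induction b using TensorProduct.induction_on with
    | zero => simp
    | add a a' h h' => rw [map_add, h, h', map_add, LinearMap.add_apply]
    | tmul Y v =>
      rw [pair₀_tmul, pair₀_tmul, Aff.form_apply, Aff.form_apply, loopForm_symm P.form_symm,
        mulG_apply, mulG_apply, mul_comm (SymmetricAlgebra.ι ℂ (gDC P) u)]
      congr 1; ring

theorem aux₀_skew (a b : Aff P ⊗[ℂ] gDC P) : aux₀ P a b = - aux₀ P b a := by
  induction a using TensorProduct.induction_on with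
  | zero => simp
  | add a a' h h' => rw [map_add, LinearMap.add_apply, h, h', map_add]; abel
  | tmul X u =>
    induction b using TensorProduct.induction_on with
    | zero => simp
    | add a a' h h' => rw [map_add, h, h', map_add, LinearMap.add_apply]; abel
    | tmul Y v =>
      rw [aux₀_tmul, aux₀_tmul, mulG_apply, mulG_apply,
        mul_comm (SymmetricAlgebra.ι ℂ (gDC P) u), ← lie_skew, TensorProduct.neg_tmul]

theorem neg_pm {e : ℤ} (he : e = 1 ∨ e = -1) : -e = 1 ∨ -e = -1 := by
  rcases he with rfl | rfl <;> simp

theorem pair_left (a : Aff P ⊗[ℂ] gDC P) (n : ℕ) : ∃ m, ∀ b ∈ FFld P m, pair₀ P a b ∈ FS P n := by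
  refine left_of_tmul (fun X u => ⟨1 + bd X, FFld_le fun e he Y hY v _ => ?_⟩) a
  rw [pair₀_tmul, form_filt' he X _ le_rfl hY, zero_smul]
  exact Submodule.zero_mem _

theorem pm_cases {e e' : ℤ} (he : e = 1 ∨ e = -1) (he' : e' = 1 ∨ e' = -1) : e' = e ∨ e' = -e := by
  rcases he with rfl | rfl <;> rcases he' with rfl | rfl <;> simp

theorem pair_cont : ContBilin (pair₀ P) (FFld P) (FFld P) (FS P) where
  antiF := FFld_anti
  antiG := FFld_anti
  joint n := by
    refine ⟨max n 1, fun a ha b hb => ?_⟩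
    refine FFld_le (B := (pair₀ P).flip b) (fun e he X hX u hu => ?_) a ha
    refine FFld_le (B := pair₀ P (X ⊗ₜ u)) (fun e' he' Y hY v hv => ?_) b hb
    rw [pair₀_tmul]
    rcases pm_cases he he' with rfl | rfl
    · rw [form_filt (le_max_right n 1) hX hY, zero_smul]
      exact Submodule.zero_mem _
    · exact Submodule.smul_mem _ _ (FS_anti (le_max_left n 1) (mulG_mem he' hu hv))
  left := pair_left
  right b n := by
    obtain ⟨m, hm⟩ := pair_left b n
    exact ⟨m, fun a ha => by rw [pair₀_symm]; exact hm a ha⟩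

theorem FAS_anti : Antitone (FAS P) := fun _ _ h =>
  sup_le_sup (sup_le_sup (Submodule.map₂_le_map₂ (filt_anti h) (idealS_anti h))
    (Submodule.map₂_le_map₂ (filt_anti h) (idealS_anti h)))
    (Submodule.map₂_le_map₂ le_rfl (FS_anti h))

theorem aux_left (a : Aff P ⊗[ℂ] gDC P) (n : ℕ) : ∃ m, ∀ b ∈ FFld P m, aux₀ P a b ∈ FAS P n := by
  refine left_of_tmul (fun X u => ⟨n + 1 + bd X, FFld_le fun e he Y hY v hv => ?_⟩) a
  rw [aux₀_tmul]
  refine FAS_mem he (bracket_filt he X n _ le_rfl hY)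
    (mulG_left _ (filtDC_anti ?_ hv))
  omega

theorem aux_cont : ContBilin (aux₀ P) (FFld P) (FFld P) (FAS P) where
  antiF := FFld_anti
  antiG := FFld_anti
  joint n := by
    refine ⟨max n 1, fun a ha b hb => FAS_anti (le_max_left n 1) ?_⟩
    refine FFld_le (B := (aux₀ P).flip b) (fun e he X hX u hu => ?_) a ha
    refine FFld_le (B := aux₀ P (X ⊗ₜ u)) (fun e' he' Y hY v hv => ?_) b hb
    rw [aux₀_tmul]
    rcases pm_cases he he' with rfl | rfl
    · exact FAS_mem he (bracket_mem_filt (le_max_right n 1) hX hY)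
        (mulG_left _ hv)
    · exact FAS_top (mulG_mem he' hu hv)
  left := aux_left
  right b n := by
    obtain ⟨m, hm⟩ := aux_left b n
    exact ⟨m, fun a ha => by rw [aux₀_skew]; exact Submodule.neg_mem _ (hm a ha)⟩

theorem act_cont : ContBilin (act₀ P) (FS P) (FFld P) (FAS P) where
  antiF := FS_anti
  antiG := FFld_anti
  joint n := by
    refine ⟨max n 1, fun f hf b hb => FAS_anti (le_max_left n 1) ?_⟩
    refine FFld_le (B := act₀ P f) (fun e he X hX u hu => ?_) b hb
    rw [act₀_tmul]
    refine FAS_mem he hX (poisson_ideal₁ (le_max_right n 1) ?_ hu)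
    rcases he with rfl | rfl
    · exact hf.2
    · rw [neg_neg]; exact hf.1
  left f n := by
    obtain ⟨m, hm⟩ := poisson_left_cont (Or.inl rfl) f n
    obtain ⟨m', hm'⟩ := poisson_left_cont (Or.inr rfl) f n
    refine ⟨max n (max m m'), FFld_le fun e he X hX u hu => ?_⟩
    rw [act₀_tmul]
    refine FAS_mem he (filt_anti (le_max_left _ _) hX) ?_
    rcases he with rfl | rfl
    · exact hm' _ (idealS_anti ((le_max_right _ _).trans (le_max_right _ _)) (ι_mem_idealS hu))
    · rw [neg_neg] at hu ⊢
      exact hm _ (idealS_anti ((le_max_left _ _).trans (le_max_right _ _)) (ι_mem_idealS hu))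
  right b n := by
    induction b using TensorProduct.induction_on with
    | zero => exact ⟨0, fun f _ => by simp⟩
    | tmul X u =>
      obtain ⟨m, hm⟩ := poisson_left_FS (SymmetricAlgebra.ι ℂ (gDC P) u) n
      refine ⟨m, fun f hf => ?_⟩
      rw [act₀_tmul, poisson_skew]
      exact FAS_top (Submodule.neg_mem _ (hm f hf))
    | add a a' ha ha' =>
      obtain ⟨m, hm⟩ := ha
      obtain ⟨m', hm'⟩ := ha'
      refine ⟨max m m', fun b hb => ?_⟩
      rw [map_add]
      exact Submodule.add_mem _ (hm b (FS_anti (le_max_left _ _) hb))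
        (hm' b (FS_anti (le_max_right _ _) hb))

variable (P) in
/-- the Poisson bracket of the completed algebra of formal observables -/
def poissonHat (f g : SHat P) : SHat P := poisson_cont.ext f g

variable (P) in
/-- the bilinear map `(· | ·)` from formal fields to formal observables -/
def pairHat (A B : Fld P) : SHat P := pair_cont.ext A B

variable (P) in
/-- the bracket `[A, B]` of two formal fields, in the auxiliary factor -/
def auxHat (A B : Fld P) : AuxS P := aux_cont.ext A B

variable (P) in
/-- the Poisson bracket `{f, A}` of a formal observable with a formal field -/
def actHat (f : SHat P) (A : Fld P) : AuxS P := act_cont.ext f A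

theorem sig_mem_filt {e : ℤ} {n : ℕ} {X : Aff P} (h : X ∈ filt P e n) : Aff.sig P X ∈ filt P e n := by
  obtain ⟨h1, h2, h3⟩ := h
  exact ⟨h1, h2, fun k hk => by rw [Aff.lp_sig, P.loopσ_apply, h3 k hk, map_zero]⟩

variable (P) in
/-- the automorphism `σ` acting on the auxiliary factor of formal fields -/
def sigHat : Fld P →ₗ[ℂ] Fld P :=
  Compl.map (LinearMap.rTensor (gDC P) (Aff.sig P)) fun n => FFld_le (H := FFld P n) fun e he X hX u hu => by
    rw [LinearMap.rTensor_tmul]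
    rcases he with rfl | rfl
    · exact Submodule.mem_sup_left (Submodule.apply_mem_map₂ _ (sig_mem_filt hX) hu)
    · exact Submodule.mem_sup_right
        (Submodule.apply_mem_map₂ _ (sig_mem_filt hX) (by rwa [neg_neg] at hu))

end Observables

section Fields

variable [NeZero T] {P : DihedralGaudin T 𝔤}

/-- the element `x ⊗ t ^ n` -/
def Aff.ld (n : ℤ) (x : 𝔤) : Aff P := Aff.mk (Finsupp.single n x) 0 0

theorem Aff.ld_mem {e n : ℤ} {m : ℕ} (h : m ≤ e * n) (x : 𝔤) : (Aff.ld n x : Aff P) ∈ filt P e m := by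
  refine ⟨rfl, rfl, fun k hk => ?_⟩
  rw [Aff.ld, Aff.lp_mk, Finsupp.single_apply, if_neg]
  rintro rfl
  exact absurd hk (not_lt.mpr h)

theorem FFld_mem {e : ℤ} (he : e = 1 ∨ e = -1) {n : ℕ} {X : Aff P} {u : gDC P} (hX : X ∈ filt P e n)
    (hu : u ∈ filtDC P (-e) n) : X ⊗ₜ[ℂ] u ∈ FFld P n := by
  rcases he with rfl | rfl
  · exact Submodule.mem_sup_left (Submodule.apply_mem_map₂ _ hX hu)
  · exact Submodule.mem_sup_right (Submodule.apply_mem_map₂ _ hX (by rwa [neg_neg] at hu))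

section Points

variable (P)

open Classical in
/-- the marked points and the complex conjugates of those with trivial stabilizer -/
def pts : Finset (OnePoint ℂ) :=
  P.level.support ∪ (P.level.support.filter fun x => stab P x = {1}).image (OnePoint.map conj)

open Classical in
/-- the points of `pts P` other than the origin and infinity -/
def pts' : Finset ℂ :=
  ((pts P).preimage ((↑) : ℂ → OnePoint ℂ) OnePoint.coe_injective.injOn).erase 0

/-- the degree of the divisor; all formal fields `A^x_p` with `p ≥ deg P` vanish -/
def bound : ℕ := P.level.sum fun _ n => n

/-- the points of the complex plane outside the orbits of the marked points -/
def regular : Set ℂ := {z | ∀ x ∈ P.level.support, ∀ α : DihedralGroup T,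
  mobius P.ω α x ≠ (z : OnePoint ℂ)}

/-- the pairs `(x, p)` labelling the Hamiltonians -/
def index : Set (OnePoint ℂ × ℕ) :=
  {a | a.1 ∈ pts P ∧ (a.1 = ((0 : ℂ) : OnePoint ℂ) → a.2 ≡ 1 [MOD T]) ∧
    (a.1 = OnePoint.infty → T ∣ a.2 + 2)}

end Points

variable [FiniteDimensional ℂ 𝔤]

/-- The partial sum over the degrees `-k < n < k` of `ρ(I_a) ⊗ v(I^a)`, where `I_a` runs over the
basis `x_{-n}`, `K`, `D` of the affine algebra and `I^a` over the dual basis. -/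
def fieldSum (ρ : Aff P → Aff P) (v : Aff P → gDC P) (k : ℕ) : Aff P ⊗[ℂ] gDC P :=
  ρ (Aff.mk 0 1 0) ⊗ₜ v (Aff.mk 0 0 1) + ρ (Aff.mk 0 0 1) ⊗ₜ v (Aff.mk 0 1 0) +
    ∑ n ∈ Finset.Ioo (-k : ℤ) k, ∑ a,
      ρ (Aff.ld (-n) (Module.finBasis ℂ 𝔤 a)) ⊗ₜ
        v (Aff.ld n (LinearMap.BilinForm.dualBasis P.form P.form_nondegenerate
          (Module.finBasis ℂ 𝔤) a))

theorem fieldSum_conv {ρ : Aff P → Aff P} {v : Aff P → gDC P} {s : ℤ} (hs : s = 1 ∨ s = -1)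
    (hρ : ∀ e n X, X ∈ filt P e n → ρ X ∈ filt P (s * e) n)
    (hv : ∀ e n X, X ∈ filt P e n → v X ∈ filtDC P (s * e) n) (m n : ℕ) (h : m ≤ n) :
    fieldSum ρ v n - fieldSum ρ v m ∈ FFld P m := by
  have hsub : Finset.Ioo (-m : ℤ) m ⊆ Finset.Ioo (-n : ℤ) n :=
    Finset.Ioo_subset_Ioo (by omega) (by omega)
  rw [fieldSum, fieldSum, add_sub_add_left_eq_sub, ← Finset.sum_sdiff hsub, add_sub_cancel_right]
  refine Submodule.sum_mem _ fun j hj => Submodule.sum_mem _ fun a _ => ?_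
  have hj' : (m : ℤ) ≤ j ∨ (m : ℤ) ≤ -j := by
    rw [Finset.mem_sdiff, Finset.mem_Ioo, Finset.mem_Ioo] at hj
    omega
  rcases hj' with hj' | hj'
  · refine FFld_mem (neg_pm hs) ?_ ?_
    · have := hρ (-1) m _ (Aff.ld_mem (P := P) (n := -j) (by linarith)
        (Module.finBasis ℂ 𝔤 a))
      rwa [mul_neg, mul_one] at this
    · have := hv 1 m _ (Aff.ld_mem (P := P) (n := j) (by linarith)
        (LinearMap.BilinForm.dualBasis P.form P.form_nondegenerate (Module.finBasis ℂ 𝔤) a))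
      rwa [mul_one, ← neg_neg s] at this
  · refine FFld_mem hs ?_ ?_
    · have := hρ 1 m _ (Aff.ld_mem (P := P) (n := -j) (by linarith)
        (Module.finBasis ℂ 𝔤 a))
      rwa [mul_one] at this
    · have := hv (-1) m _ (Aff.ld_mem (P := P) (n := j) (by linarith)
        (LinearMap.BilinForm.dualBasis P.form P.form_nondegenerate (Module.finBasis ℂ 𝔤) a))
      rwa [mul_neg, mul_one] at this

variable (P)

/-- the formal field `∑_a I_a ⊗ (I^a)^{(x)}_p` at a marked point `x` -/
def field (x : OnePoint ℂ) (p : ℕ) : Fld P :=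
  Compl.ofSeq (fieldSum id (emb P x p)) (fieldSum_conv (s := 1) (Or.inl rfl)
    (fun e n X h => by rwa [one_mul]) (fun e n X h => by rw [one_mul]; exact emb_mem x p h))

/-- the formal field `∑_a τ(I_a) ⊗ conj ((I^a)^{(x)}_p)` at the complex conjugate
of a marked point `x` -/
def fieldConj (x : OnePoint ℂ) (p : ℕ) : Fld P :=
  Compl.ofSeq (fieldSum (Aff.tau P) (fun X => conjC P (emb P x p X)))
    (fieldSum_conv (s := -1) (Or.inr rfl)
      (fun e n X h => by rw [neg_mul, one_mul]; exact tau_mem_filt h)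
      (fun e n X h => by rw [neg_mul, one_mul]; exact conjC_mem_filtDC (emb_mem x p h)))

open Classical in
/-- The formal fields `A^x_p`. They are attached to the marked points and to the complex
conjugates of the marked points with trivial stabilizer. -/
def A (x : OnePoint ℂ) (p : ℕ) : Fld P :=
  if P.level x ≠ 0 then field P x p else fieldConj P (OnePoint.map conj x) p

/-- the formal Lax matrix at a point `z` -/
def Lax (z : ℂ) : Fld P :=
  (1 / T : ℂ) • ∑ k ∈ Finset.range T, ∑ x ∈ pts' P, ∑ p ∈ Finset.range (bound P),
      (P.ω⁻¹ ^ k / (P.ω⁻¹ ^ k * z - x) ^ (p + 1)) • (sigHat P ^ k) (A P x p) +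
    ∑ p ∈ Finset.range (bound P), (1 / z ^ (p + 1)) • A P (0 : ℂ) p -
    ∑ q ∈ Finset.range (bound P), z ^ q • A P OnePoint.infty (q + 1)

open Classical in
/-- the formal quadratic Gaudin Hamiltonians `H^x_p` for `x` different from `0` and `∞` -/
def hamFinite (x : ℂ) (p : ℕ) : SHat P :=
  ∑ l ∈ Finset.range T, ∑ y ∈ insert 0 (pts' P), (if l = 0 ∧ y = x then 0 else
      ∑ q ∈ Finset.range (bound P), ∑ s ∈ Finset.range (bound P),
        ((-1) ^ s * ((q + s).choose s : ℂ) * P.ω ^ (l * q) / (x - P.ω ^ l * y) ^ (q + s + 1)) •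
          pairHat P (A P x (p + s)) ((sigHat P ^ l) (A P y q))) -
    (T : ℂ) • ∑ q ∈ Finset.range (bound P), ∑ s ∈ Finset.range (bound P),
      ((q.choose s : ℂ) * x ^ (q - s)) • pairHat P (A P x (p + s)) (A P OnePoint.infty (q + 1)) +
    (1 / 2 : ℂ) • ∑ q ∈ Finset.range p, pairHat P (A P x q) (A P x (p - q - 1))

/-- the formal quadratic Gaudin Hamiltonians `H^0_p` -/
def hamZero (p : ℕ) : SHat P :=
  ∑ x ∈ pts' P, ∑ q ∈ Finset.range (bound P), ∑ s ∈ Finset.range (bound P),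
      ((-1) ^ (q + 1) * ((q + s).choose s : ℂ) / x ^ (q + s + 1)) •
        pairHat P (A P (0 : ℂ) (p + s)) (A P x q) -
    ∑ q ∈ Finset.range (bound P), pairHat P (A P (0 : ℂ) (p + q)) (A P OnePoint.infty (q + 1)) +
    (1 / 2 : ℂ) • ∑ q ∈ Finset.range p, pairHat P (A P (0 : ℂ) (p - q - 1)) (A P (0 : ℂ) q)

/-- the formal quadratic Gaudin Hamiltonians `H^∞_q` -/
def hamInfty (q : ℕ) : SHat P :=
  -(∑ x ∈ pts' P, ∑ p ∈ Finset.range (bound P), ∑ s ∈ Finset.range (bound P),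
      ((s.choose p : ℂ) * x ^ (s - p)) • pairHat P (A P x p) (A P OnePoint.infty (q + s + 2))) -
    ∑ p ∈ Finset.range (bound P), pairHat P (A P (0 : ℂ) p) (A P OnePoint.infty (q + p + 2)) +
    (1 / 2 : ℂ) • ∑ p ∈ Finset.range (q + 1),
      pairHat P (A P OnePoint.infty (p + 1)) (A P OnePoint.infty (q - p + 1))

open Classical in
/-- the formal quadratic Gaudin Hamiltonians -/
def Ham : OnePoint ℂ → ℕ → SHat P
  | .infty, p => hamInfty P p
  | .some x, p => if x = 0 then hamZero P p else hamFinite P x p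

open Classical in
/-- the second matrices `M^x_p(z)` of the Lax pairs -/
def Mat : OnePoint ℂ → ℕ → ℂ → Fld P
  | .infty, r, z => ∑ s ∈ Finset.range (bound P), z ^ s • A P OnePoint.infty (r + s + 2)
  | .some x, p, z => if x = 0 then
      ∑ s ∈ Finset.range (bound P), (1 / z ^ (s + 1)) • A P (0 : ℂ) (p + s)
    else ∑ l ∈ Finset.range T, ∑ s ∈ Finset.range (bound P),
      (1 / (P.ω⁻¹ ^ l * z - x) ^ (s + 1)) • (sigHat P ^ l) (A P x (p + s))

end Fields

end Gaudin

end

/-!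
The Lax matrix `L(z)` and the quadratic Hamiltonians live in completions, but every identity between
them can be tested on the affine algebra: pairing with an element `Y` sends a formal field to an
honest element `evHat Y A` of the complexified Takiff algebra, and these evaluations separate the
points of the completions (`fld_ext`, `auxS_ext`; the argument is `tensor_separation`). The field
`A^x_p` evaluates to the mode `E^x_p(Y)` (`evHat_A`).

The modes at distinct points commute (`E_lie_of_ne`), and at one point they satisfy Takiff relations
(`E_lie`), averaged over the cyclic group at the two fixed points `0` and `∞` (`E_zero_lie`,
`E_infty_lie`). Summing these relations against powers of `z` and `w` produces difference quotients,
so the bracket of `L(z)` with `L(w)` takes the closed form `evHat_Lax_lie`: it is governed by the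
twisted rational kernel `(1 / T) ∑ m, ω ^ m / (ω ^ m w - z)`. Therefore the flow of
`(L(w) | L(w)) / 2` on `L(z)` is a commutator (`actL_half_square`). Of the two terms of each
difference quotient, the one containing only `L(w)` disappears by invariance of the form, and the
other one, rewritten by the equivariance `Lax_om_mul`, gives the matrix `genMat P w z`.

The rest is partial fraction expansion in `w`. The expansion of `(L(w) | L(w)) / 2` has the
Hamiltonians as its coefficients (`half_square_Lax`): `half_square` expands the square of any vector
valued rational function, and orthogonality of the characters of the cyclic group (`sum_om_zpow`)
produces the congruences at `0` and `∞`. The matrix `genMat P w z` has the same poles in `w` up to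
multiples of `L(z)` (`genMat_eq`), which commute with `L(z)`, and its coefficients are the matrices
`M^x_p(z)`. By uniqueness of partial fractions (`partialFractions_unique`) the Lax equation holds
coefficient by coefficient (`lax_equation`). Finally, a flow of Lax form preserves
`(L(w) | L(w)) / 2`, since `([M, L] | L) = 0`; comparing coefficients once more shows that the
Hamiltonians commute (`poissonL_Ham`).
-/

noncomputable section

namespace Gaudin

/-! ### Convergence in completions -/

section Convergence

variable {M N K : Type*} [AddCommGroup M] [Module ℂ M] [AddCommGroup N] [Module ℂ N]
  [AddCommGroup K] [Module ℂ K]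
variable {F : ℕ → Submodule ℂ M} {G : ℕ → Submodule ℂ N} {H : ℕ → Submodule ℂ K}

/-- The sequence `u` converges to the element `f` of the completion: for every `n`, almost all
`u l` represent the component of `f` in `M / F n`. -/
def Tends (u : ℕ → M) (f : Compl F) : Prop :=
  ∀ n, ∃ k, ∀ l, k ≤ l → (F n).mkQ (u l) = f.1 n

theorem Tends.unique {u : ℕ → M} {f g : Compl F} (hf : Tends u f) (hg : Tends u g) : f = g := by
  refine Subtype.ext (funext fun n => ?_)
  obtain ⟨k, hk⟩ := hf n
  obtain ⟨k', hk'⟩ := hg n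
  rw [← hk _ (le_max_left k k'), hk' _ (le_max_right k k')]

theorem Tends.congr {u v : ℕ → M} {f : Compl F} (hf : Tends u f)
    (h : ∃ k, ∀ l, k ≤ l → u l = v l) : Tends v f := by
  intro n
  obtain ⟨k, hk⟩ := hf n
  obtain ⟨k', hk'⟩ := h
  exact ⟨max k k', fun l hl => by
    rw [← hk' l ((le_max_right _ _).trans hl), hk l ((le_max_left _ _).trans hl)]⟩

theorem Tends.add {u v : ℕ → M} {f g : Compl F} (hf : Tends u f) (hg : Tends v g) :
    Tends (fun l => u l + v l) (f + g) := by
  intro n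
  obtain ⟨k, hk⟩ := hf n
  obtain ⟨k', hk'⟩ := hg n
  refine ⟨max k k', fun l hl => ?_⟩
  rw [map_add, hk l ((le_max_left _ _).trans hl), hk' l ((le_max_right _ _).trans hl)]
  rfl

theorem Tends.smul {u : ℕ → M} {f : Compl F} (c : ℂ) (hf : Tends u f) :
    Tends (fun l => c • u l) (c • f) := by
  intro n
  obtain ⟨k, hk⟩ := hf n
  exact ⟨k, fun l hl => by rw [map_smul, hk l hl]; rfl⟩

theorem Tends.neg {u : ℕ → M} {f : Compl F} (hf : Tends u f) :
    Tends (fun l => - u l) (-f) := by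
  intro n
  obtain ⟨k, hk⟩ := hf n
  exact ⟨k, fun l hl => by rw [map_neg, hk l hl]; rfl⟩

theorem tends_zero : Tends (fun _ => (0 : M)) (0 : Compl F) :=
  fun n => ⟨0, fun l _ => by rw [map_zero]; rfl⟩

theorem exists_tends (hF : Antitone F) (f : Compl F) : ∃ u : ℕ → M, Tends u f := by
  choose u hu using fun n => (F n).mkQ_surjective (f.1 n)
  exact ⟨u, fun n => ⟨n, fun l hl => Compl.rep hF f hl (hu l)⟩⟩

theorem Compl.tends_ofSeq (u : ℕ → M) (hu : ∀ m n, m ≤ n → u n - u m ∈ F m) :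
    Tends u (Compl.ofSeq u hu) := by
  intro n
  refine ⟨n, fun l hl => ?_⟩
  change (F n).mkQ (u l) = (F n).mkQ (u n)
  rw [← sub_eq_zero, ← map_sub]
  exact (Submodule.Quotient.mk_eq_zero _).mpr (hu n l hl)

theorem Tends.map {φ : M →ₗ[ℂ] N} {hφ : ∀ n, F n ≤ (G n).comap φ} {u : ℕ → M} {f : Compl F}
    (h : Tends u f) : Tends (fun l => φ (u l)) (Compl.map φ hφ f) := by
  intro n
  obtain ⟨k, hk⟩ := h n
  refine ⟨k, fun l hl => ?_⟩
  change _ = (F n).mapQ (G n) φ (hφ n) (f.1 n)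
  rw [← hk l hl]
  rfl

/-- The extension of a continuous bilinear map is computed along approximating sequences; this
reduces identities in the completions to identities of tensors. -/
theorem Tends.ext {B : M →ₗ[ℂ] N →ₗ[ℂ] K} (hB : ContBilin B F G H) {u : ℕ → M} {v : ℕ → N}
    {f : Compl F} {g : Compl G} (hf : Tends u f) (hg : Tends v g) :
    Tends (fun l => B (u l) (v l)) (hB.ext f g) := by
  intro n
  obtain ⟨m, hm⟩ := hB.ext_spec f g n
  obtain ⟨k, hk⟩ := hf m
  obtain ⟨k', hk'⟩ := hg m
  exact ⟨max k k', fun l hl => hm m le_rfl _ _ (hk l ((le_max_left _ _).trans hl))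
    (hk' l ((le_max_right _ _).trans hl))⟩

/-- the image of an element of `M` in its completion -/
def Compl.const (F : ℕ → Submodule ℂ M) (a : M) : Compl F :=
  ⟨fun n => (F n).mkQ a, fun _ _ _ => ⟨a, rfl, rfl⟩⟩

theorem Compl.tends_const (a : M) : Tends (fun _ => a) (Compl.const F a) :=
  fun _ => ⟨0, fun _ _ => rfl⟩

/-- the extension of a continuous bilinear map to the completions, as a bilinear map -/
def ContBilin.extL {B : M →ₗ[ℂ] N →ₗ[ℂ] K} (hB : ContBilin B F G H) :
    Compl F →ₗ[ℂ] Compl G →ₗ[ℂ] Compl H :=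
  LinearMap.mk₂ ℂ hB.ext
    (fun f f' g => by
      obtain ⟨u, hu⟩ := exists_tends hB.antiF f
      obtain ⟨u', hu'⟩ := exists_tends hB.antiF f'
      obtain ⟨v, hv⟩ := exists_tends hB.antiG g
      refine ((hu.add hu').ext hB hv).unique (((hu.ext hB hv).add (hu'.ext hB hv)).congr
        ⟨0, fun l _ => by rw [map_add, LinearMap.add_apply]⟩))
    (fun c f g => by
      obtain ⟨u, hu⟩ := exists_tends hB.antiF f
      obtain ⟨v, hv⟩ := exists_tends hB.antiG g
      refine ((hu.smul c).ext hB hv).unique (((hu.ext hB hv).smul c).congr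
        ⟨0, fun l _ => by rw [map_smul, LinearMap.smul_apply]⟩))
    (fun f g g' => by
      obtain ⟨u, hu⟩ := exists_tends hB.antiF f
      obtain ⟨v, hv⟩ := exists_tends hB.antiG g
      obtain ⟨v', hv'⟩ := exists_tends hB.antiG g'
      refine (hu.ext hB (hv.add hv')).unique (((hu.ext hB hv).add (hu.ext hB hv')).congr
        ⟨0, fun l _ => by rw [map_add]⟩))
    (fun c f g => by
      obtain ⟨u, hu⟩ := exists_tends hB.antiF f
      obtain ⟨v, hv⟩ := exists_tends hB.antiG g
      refine (hu.ext hB (hv.smul c)).unique (((hu.ext hB hv).smul c).congr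
        ⟨0, fun l _ => by rw [map_smul]⟩))

theorem Tends.extL {B : M →ₗ[ℂ] N →ₗ[ℂ] K} (hB : ContBilin B F G H) {u : ℕ → M} {v : ℕ → N}
    {f : Compl F} {g : Compl G} (hf : Tends u f) (hg : Tends v g) :
    Tends (fun l => B (u l) (v l)) (hB.extL f g) := hf.ext hB hg

/-- The extension to the completions of a continuous linear map `φ`. The function `m` is a modulus
of continuity: `φ` maps `F (m n)` to `G n`. -/
def Compl.mapC (hF : Antitone F) (φ : M →ₗ[ℂ] N) (m : ℕ → ℕ)
    (hφ : ∀ n, F (m n) ≤ (G n).comap φ) : Compl F →ₗ[ℂ] Compl G where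
  toFun f := ⟨fun n => (F (m n)).mapQ (G n) φ (hφ n) (f.1 (m n)), by
    intro i j h
    obtain ⟨a, ha⟩ := (F (max (m i) (m j))).mkQ_surjective (f.1 (max (m i) (m j)))
    refine ⟨φ a, ?_, ?_⟩ <;> dsimp only
    · rw [← Compl.rep hF f (le_max_left _ _) ha]; rfl
    · rw [← Compl.rep hF f (le_max_right _ _) ha]; rfl⟩
  map_add' f g := Subtype.ext (funext fun n => map_add _ _ _)
  map_smul' c f := Subtype.ext (funext fun n =>
    map_smul ((F (m n)).mapQ (G n) φ (hφ n)) c (f.1 (m n)))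

theorem Tends.mapC {hF : Antitone F} {φ : M →ₗ[ℂ] N} {m : ℕ → ℕ}
    {hφ : ∀ n, F (m n) ≤ (G n).comap φ} {u : ℕ → M} {f : Compl F} (h : Tends u f) :
    Tends (fun l => φ (u l)) (Compl.mapC hF φ m hφ f) := by
  intro n
  obtain ⟨k, hk⟩ := h (m n)
  refine ⟨k, fun l hl => ?_⟩
  change _ = (F (m n)).mapQ (G n) φ (hφ n) (f.1 (m n))
  rw [← hk l hl]
  rfl

end Convergence

variable {T : ℕ} {𝔤 : Type*} [LieRing 𝔤] [LieAlgebra ℂ 𝔤]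

/-! ### Evaluation of tensors and separation -/

section Evaluation

variable {P : DihedralGaudin T 𝔤} {N : Type*} [AddCommGroup N] [Module ℂ N]

theorem Aff.form_symm (X Y : Aff P) : Aff.form P X Y = Aff.form P Y X := by
  rw [Aff.form_apply, Aff.form_apply, loopForm_symm P.form_symm]
  ring

theorem Aff.form_lie (X Y Z : Aff P) : Aff.form P ⁅X, Y⁆ Z = Aff.form P X ⁅Y, Z⁆ := by
  simp only [Aff.form_apply, Aff.lp_bracket, Aff.cK_bracket, Aff.cD_bracket, map_add, map_sub,
    map_smul, LinearMap.add_apply, LinearMap.sub_apply, LinearMap.smul_apply, smul_eq_mul,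
    loopForm_loop P.form_lie]
  rw [loopForm_deg _ X.lp Z.lp, loopForm_symm P.form_symm X.lp (deg Z.lp), loopForm_deg _ X.lp Y.lp,
    loopForm_symm P.form_symm (deg Z.lp) X.lp]
  ring

theorem Aff.form_sig (X Y : Aff P) : Aff.form P (Aff.sig P X) (Aff.sig P Y) = Aff.form P X Y := by
  simp [Aff.form_apply, P.loopForm_loopσ]

theorem Aff.form_tau (X Y : Aff P) :
    Aff.form P (Aff.tau P X) (Aff.tau P Y) = conj (Aff.form P X Y) := by
  simp [Aff.form_apply, P.loopForm_loopτ]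

theorem Aff.form_ld (j : ℤ) (x : 𝔤) (X : Aff P) :
    Aff.form P (Aff.ld j x) X = P.form x (X.lp (-j)) := by
  rw [Aff.form_apply, Aff.ld, Aff.lp_mk, Aff.cK_mk, Aff.cD_mk, loopForm_apply,
    Finsupp.sum_single_index (by simp)]
  simp

theorem form_mk_filt {e : ℤ} {n : ℕ} {X : Aff P} (hX : X ∈ filt P e n) (a b : ℂ) :
    Aff.form P (Aff.mk 0 a b) X = 0 := by
  rw [Aff.form_apply, hX.1, hX.2.1]
  simp

theorem form_ld_filt {e j : ℤ} {n : ℕ} {X : Aff P} (hX : X ∈ filt P e n) (hj : -(e * j) < n)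
    (x : 𝔤) : Aff.form P (Aff.ld j x) X = 0 := by
  rw [Aff.form_ld, hX.2.2 (-j) (by rw [mul_neg]; exact hj), map_zero]

variable (N) in
/-- evaluation of a tensor on an element of the affine algebra: `X ⊗ v ↦ (Y | X) v` -/
def evT (Y : Aff P) : Aff P ⊗[ℂ] N →ₗ[ℂ] N :=
  (TensorProduct.lid ℂ N).toLinearMap ∘ₗ LinearMap.rTensor N (Aff.form P Y)

@[simp] theorem evT_tmul (Y X : Aff P) (v : N) : evT N Y (X ⊗ₜ v) = Aff.form P Y X • v := by
  simp [evT]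

/-- A step of the filtration of the tensor product evaluates into `W` as soon as each of
`filt P 1 n` and `filt P (-1) n` either is orthogonal to `Y` or is paired with a subspace of `W`. -/
theorem evT_mem {G : ℤ → Submodule ℂ N} {G₀ W : Submodule ℂ N} {n : ℕ} {Y : Aff P}
    (h₀ : G₀ ≤ W)
    (h : ∀ e : ℤ, (e = 1 ∨ e = -1) → (∀ X ∈ filt P e n, Aff.form P Y X = 0) ∨ G (-e) ≤ W)
    {t : Aff P ⊗[ℂ] N}
    (ht : t ∈ Submodule.map₂ (TensorProduct.mk ℂ _ _) (filt P 1 n) (G (-1)) ⊔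
      Submodule.map₂ (TensorProduct.mk ℂ _ _) (filt P (-1) n) (G 1) ⊔
      Submodule.map₂ (TensorProduct.mk ℂ _ _) ⊤ G₀) : evT N Y t ∈ W := by
  have key : ∀ e : ℤ, (e = 1 ∨ e = -1) → ∀ X ∈ filt P e n, ∀ v ∈ G (-e), evT N Y (X ⊗ₜ v) ∈ W := by
    intro e he X hX v hv
    rw [evT_tmul]
    rcases h e he with h1 | h1
    · rw [h1 X hX, zero_smul]
      exact W.zero_mem
    · exact W.smul_mem _ (h1 hv)
  have : Submodule.map₂ (TensorProduct.mk ℂ _ _) (filt P 1 n) (G (-1)) ⊔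
      Submodule.map₂ (TensorProduct.mk ℂ _ _) (filt P (-1) n) (G 1) ⊔
      Submodule.map₂ (TensorProduct.mk ℂ _ _) ⊤ G₀ ≤ W.comap (evT N Y) := by
    refine sup_le (sup_le (Submodule.map₂_le.mpr fun X hX v hv => key 1 (Or.inl rfl) X hX v hv)
      (Submodule.map₂_le.mpr fun X hX v hv => key (-1) (Or.inr rfl) X hX v ?_))
      (Submodule.map₂_le.mpr fun X _ v hv => ?_)
    · rwa [neg_neg]
    · rw [TensorProduct.mk_apply, Submodule.mem_comap, evT_tmul]
      exact W.smul_mem _ (h₀ hv)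
  exact this ht

variable [FiniteDimensional ℂ 𝔤]

/-- The expansion of `X` in the basis of the affine algebra by means of the dual basis; it is
finite, as only finitely many modes of `X` are nonzero. -/
theorem Aff.sum_basis (X : Aff P) : ∃ l₀ : ℕ, ∀ l : ℕ, l₀ ≤ l →
    Aff.form P (Aff.mk 0 1 0) X • (Aff.mk 0 0 1 : Aff P) +
      Aff.form P (Aff.mk 0 0 1) X • (Aff.mk 0 1 0 : Aff P) +
      ∑ n ∈ Finset.Ioo (-l : ℤ) l, ∑ a,
        Aff.form P (Aff.ld (-n) (Module.finBasis ℂ 𝔤 a)) X •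
          (Aff.ld n (LinearMap.BilinForm.dualBasis P.form P.form_nondegenerate
            (Module.finBasis ℂ 𝔤) a) : Aff P) = X := by
  have hlp : ∀ {ι : Type} (s : Finset ι) (f : ι → Aff P), (∑ i ∈ s, f i).lp = ∑ i ∈ s, (f i).lp :=
    fun s f => map_sum (⟨⟨Aff.lp, rfl⟩, fun _ _ => rfl⟩ : Aff P →+ (ℤ →₀ 𝔤)) f s
  have hcK : ∀ {ι : Type} (s : Finset ι) (f : ι → Aff P), (∑ i ∈ s, f i).cK = ∑ i ∈ s, (f i).cK :=
    fun s f => map_sum (⟨⟨Aff.cK, rfl⟩, fun _ _ => rfl⟩ : Aff P →+ ℂ) f s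
  have hcD : ∀ {ι : Type} (s : Finset ι) (f : ι → Aff P), (∑ i ∈ s, f i).cD = ∑ i ∈ s, (f i).cD :=
    fun s f => map_sum (⟨⟨Aff.cD, rfl⟩, fun _ _ => rfl⟩ : Aff P →+ ℂ) f s
  refine ⟨1 + bd X, fun l hl => ?_⟩
  ext1
  · simp only [Aff.lp_add, Aff.lp_smul, Aff.lp_mk, smul_zero, zero_add, hlp]
    have h1 : ∀ n : ℤ, ∑ a, Aff.form P (Aff.ld (-n) (Module.finBasis ℂ 𝔤 a)) X •
        (Aff.ld n (LinearMap.BilinForm.dualBasis P.form P.form_nondegenerate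
            (Module.finBasis ℂ 𝔤) a) : Aff P).lp = Finsupp.single n (X.lp n) := by
      intro n
      have h2 := Module.Basis.sum_repr (LinearMap.BilinForm.dualBasis P.form P.form_nondegenerate
            (Module.finBasis ℂ 𝔤)) (X.lp n)
      conv_rhs => rw [← h2]
      rw [Finsupp.single_finsetSum]
      refine Finset.sum_congr rfl fun a _ => ?_
      rw [LinearMap.BilinForm.dualBasis_repr_apply, Aff.form_ld, neg_neg, P.form_symm, Aff.ld,
        Aff.lp_mk, Finsupp.smul_single]
    simp only [h1]
    ext n
    rw [Finsupp.finsetSum_apply]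
    simp only [Finsupp.single_apply, Finset.sum_ite_eq']
    split_ifs with hn
    · rfl
    · by_contra h0
      have h3 : n ∈ X.lp.support := Finsupp.mem_support_iff.mpr fun h => h0 h.symm
      have h4 := le_bd h3 (Or.inl rfl)
      have h5 := le_bd h3 (Or.inr rfl)
      rw [Finset.mem_Ioo] at hn
      omega
  · simp only [Aff.cK_add, Aff.cK_smul, Aff.cK_mk, hcK]
    simp [Aff.ld, Aff.form_apply]
  · simp only [Aff.cD_add, Aff.cD_smul, Aff.cD_mk, hcD]
    simp [Aff.ld, Aff.form_apply]

/-- A tensor is recovered from finitely many of its evaluations. -/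
theorem sum_basis_tensor (t : Aff P ⊗[ℂ] N) : ∃ l₀ : ℕ, ∀ l : ℕ, l₀ ≤ l →
    (Aff.mk 0 0 1 : Aff P) ⊗ₜ[ℂ] evT N (Aff.mk 0 1 0) t +
      (Aff.mk 0 1 0 : Aff P) ⊗ₜ[ℂ] evT N (Aff.mk 0 0 1) t +
      ∑ n ∈ Finset.Ioo (-l : ℤ) l, ∑ a,
          (Aff.ld n (LinearMap.BilinForm.dualBasis P.form P.form_nondegenerate
            (Module.finBasis ℂ 𝔤) a) : Aff P) ⊗ₜ[ℂ]
              evT N (Aff.ld (-n) (Module.finBasis ℂ 𝔤 a)) t = t := by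
  induction t using TensorProduct.induction_on with
  | zero => exact ⟨0, fun l _ => by simp⟩
  | tmul X v =>
    obtain ⟨l₀, h⟩ := Aff.sum_basis X
    refine ⟨l₀, fun l hl => ?_⟩
    conv_rhs => rw [← h l hl]
    simp only [evT_tmul, TensorProduct.add_tmul, TensorProduct.sum_tmul, TensorProduct.smul_tmul]
  | add t t' h h' =>
    obtain ⟨l₀, h⟩ := h
    obtain ⟨l₁, h'⟩ := h'
    refine ⟨max l₀ l₁, fun l hl => ?_⟩
    conv_rhs => rw [← h l ((le_max_left _ _).trans hl), ← h' l ((le_max_right _ _).trans hl)]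
    simp only [map_add, TensorProduct.tmul_add, Finset.sum_add_distrib]
    abel

/-- Elements of the completed tensor products are determined by their evaluations: a Cauchy
sequence of tensors all of whose evaluations converge to zero converges to zero. -/
theorem tensor_separation [NeZero T] {F : ℕ → Submodule ℂ (Aff P ⊗[ℂ] N)}
    {G : ℤ → ℕ → Submodule ℂ N} {G₀ : ℕ → Submodule ℂ N}
    (hG : ∀ e : ℤ, (e = 1 ∨ e = -1) → ∀ n, G₀ n ≤ G e n) (hF : Antitone F)
    (hle : ∀ n, F n ≤ Submodule.map₂ (TensorProduct.mk ℂ _ _) (filt P 1 n) (G (-1) n) ⊔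
      Submodule.map₂ (TensorProduct.mk ℂ _ _) (filt P (-1) n) (G 1 n) ⊔
      Submodule.map₂ (TensorProduct.mk ℂ _ _) ⊤ (G₀ n))
    (h1 : ∀ n (e : ℤ), (e = 1 ∨ e = -1) → ∀ X ∈ filt P e n, ∀ v ∈ G (-e) n, X ⊗ₜ[ℂ] v ∈ F n)
    (h2 : ∀ n (X : Aff P), ∀ v ∈ G₀ n, X ⊗ₜ[ℂ] v ∈ F n)
    {u : ℕ → Aff P ⊗[ℂ] N} {f : Compl F} (hu : Tends u f)
    (h0 : ∀ Y n, ∃ k, ∀ l, k ≤ l → evT N Y (u l) ∈ G₀ n) : f = 0 := by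
  have key : ∀ n, 1 ≤ n → ∃ k, ∀ l, k ≤ l → u l ∈ F n := by
    intro n hn
    obtain ⟨k, hk⟩ := hu n
    refine ⟨k, fun l hl => ?_⟩
    have hdiff : ∀ l', k ≤ l' → u l - u l' ∈ F n := fun l' hl' => by
      refine (Submodule.Quotient.mk_eq_zero _).mp ?_
      change (F n).mkQ (u l - u l') = 0
      rw [map_sub, hk l hl, hk l' hl', sub_self]
    have hW : ∀ (Y : Aff P) (W : Submodule ℂ N), G₀ n ≤ W →
        (∀ e : ℤ, (e = 1 ∨ e = -1) → (∀ X ∈ filt P e n, Aff.form P Y X = 0) ∨ G (-e) n ≤ W) →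
        evT N Y (u l) ∈ W := by
      intro Y W hW h
      obtain ⟨k', hk'⟩ := h0 Y n
      have e1 : evT N Y (u l) = evT N Y (u l - u (max k k')) + evT N Y (u (max k k')) := by
        rw [map_sub, sub_add_cancel]
      rw [e1]
      exact W.add_mem (evT_mem (G := fun e => G e n) hW h (hle n (hdiff _ (le_max_left _ _))))
        (hW (hk' _ (le_max_right _ _)))
    obtain ⟨l₀, hl₀⟩ := sum_basis_tensor (u l)
    rw [← hl₀ l₀ le_rfl]
    refine Submodule.add_mem _ (Submodule.add_mem _ (h2 n _ _ ?_) (h2 n _ _ ?_))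
      (Submodule.sum_mem _ fun j _ => Submodule.sum_mem _ fun a _ => ?_)
    · exact hW _ _ le_rfl fun e _ => Or.inl fun X hX => form_mk_filt hX _ _
    · exact hW _ _ le_rfl fun e _ => Or.inl fun X hX => form_mk_filt hX _ _
    · have aux : ∀ e : ℤ, (e = 1 ∨ e = -1) → (n : ℤ) ≤ e * j →
          Aff.ld j (LinearMap.BilinForm.dualBasis P.form P.form_nondegenerate
            (Module.finBasis ℂ 𝔤) a) ⊗ₜ[ℂ]
              evT N (Aff.ld (-j) (Module.finBasis ℂ 𝔤 a)) (u l) ∈ F n := by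
        intro e he hej
        refine h1 n e he _ (Aff.ld_mem hej _) _ (hW _ _ (hG _ (neg_pm he) _) fun e' he' => ?_)
        rcases pm_cases he he' with rfl | rfl
        · exact Or.inr le_rfl
        · refine Or.inl fun X hX => form_ld_filt hX ?_ _
          rw [neg_mul, mul_neg, neg_neg]
          omega
      by_cases hj : (n : ℤ) ≤ j
      · exact aux 1 (Or.inl rfl) (by omega)
      by_cases hj' : (n : ℤ) ≤ -j
      · exact aux (-1) (Or.inr rfl) (by omega)
      · refine h2 n _ _ (hW _ _ le_rfl fun e he => Or.inl fun X hX => form_ld_filt hX ?_ _)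
        rcases he with rfl | rfl <;> omega
  refine hu.unique fun n => ?_
  obtain ⟨k, hk⟩ := key (n + 1) (by omega)
  exact ⟨k, fun l hl => (Submodule.Quotient.mk_eq_zero _).mpr (hF (Nat.le_succ n) (hk l hl))⟩

end Evaluation

/-! ### Continuous operations on formal fields -/

section Operations

variable [NeZero T] (P : DihedralGaudin T 𝔤)

/-- the pairing of formal fields as a bilinear map -/
def pairL : Fld P →ₗ[ℂ] Fld P →ₗ[ℂ] SHat P := (pair_cont (P := P)).extL

/-- the bracket of formal fields as a bilinear map -/
def auxL : Fld P →ₗ[ℂ] Fld P →ₗ[ℂ] AuxS P := (aux_cont (P := P)).extL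

/-- the action of formal observables on formal fields as a bilinear map -/
def actL : SHat P →ₗ[ℂ] Fld P →ₗ[ℂ] AuxS P := (act_cont (P := P)).extL

/-- the Poisson bracket of formal observables as a bilinear map -/
def poissonL : SHat P →ₗ[ℂ] SHat P →ₗ[ℂ] SHat P := (poisson_cont (P := P)).extL

variable {P}

/-- Evaluation on `Y` is defined on the completion, since it kills a step of the filtration. -/
theorem FFld_le_ker (Y : Aff P) : FFld P (1 + bd Y) ≤ LinearMap.ker (evT (gDC P) Y) := by
  intro b hb
  have h := FFld_le (B := evT (gDC P) Y) (H := ⊥) (n := 1 + bd Y) (fun e he X hX u _ => by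
    rw [evT_tmul, form_filt' he Y _ le_rfl hX, zero_smul]
    exact Submodule.zero_mem _) b hb
  exact h

/-- the evaluation `(Y | A)` of a formal field `A` on an element `Y` of the affine algebra -/
def evHat (Y : Aff P) : Fld P →ₗ[ℂ] gDC P :=
  (FFld P (1 + bd Y)).liftQ (evT (gDC P) Y) (FFld_le_ker Y) ∘ₗ
    LinearMap.proj (1 + bd Y) ∘ₗ (Compl (FFld P)).subtype

theorem Tends.evHat (Y : Aff P) {u : ℕ → Aff P ⊗[ℂ] gDC P} {A : Fld P} (h : Tends u A) :
    ∃ k, ∀ l, k ≤ l → evT (gDC P) Y (u l) = evHat Y A := by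
  obtain ⟨k, hk⟩ := h (1 + bd Y)
  refine ⟨k, fun l hl => ?_⟩
  change _ = (FFld P (1 + bd Y)).liftQ (evT (gDC P) Y) (FFld_le_ker Y) (A.1 (1 + bd Y))
  rw [← hk l hl]
  rfl

theorem FAS_le_comap (Y : Aff P) (n : ℕ) :
    FAS P (max n (1 + bd Y)) ≤ (FS P n).comap (evT (Sym P) Y) := by
  refine sup_le (sup_le (Submodule.map₂_le.mpr fun X hX s _ => ?_)
    (Submodule.map₂_le.mpr fun X hX s _ => ?_)) (Submodule.map₂_le.mpr fun X _ s hs => ?_) <;>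
    rw [TensorProduct.mk_apply, Submodule.mem_comap, evT_tmul]
  · rw [form_filt' (Or.inl rfl) Y _ (le_max_right _ _) hX, zero_smul]
    exact Submodule.zero_mem _
  · rw [form_filt' (Or.inr rfl) Y _ (le_max_right _ _) hX, zero_smul]
    exact Submodule.zero_mem _
  · exact Submodule.smul_mem _ _ (FS_anti (le_max_left _ _) hs)

/-- the evaluation of an element of the completed tensor product of the affine algebra and the
formal observables on an element of the affine algebra -/
def evA (Y : Aff P) : AuxS P →ₗ[ℂ] SHat P :=
  Compl.mapC FAS_anti (evT (Sym P) Y) (fun n => max n (1 + bd Y)) (FAS_le_comap Y)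

/-- the linear map `u ↦ [u, v]` -/
def brR (v : gDC P) : gDC P →ₗ[ℂ] gDC P := -(LieModule.toEnd ℂ (gDC P) (gDC P) v)

theorem brR_apply (v u : gDC P) : brR v u = ⁅u, v⁆ := by
  rw [brR, LinearMap.neg_apply, LieModule.toEnd_apply_apply, lie_skew]

/-- The operator `X ⊗ u ↦ X ⊗ [u, v]` is continuous. The modulus depends on `v`. -/
theorem exists_derHat (v : gDC P) : ∃ m : ℕ → ℕ, ∀ n, FFld P (m n) ≤
    (FFld P n).comap (LinearMap.lTensor (Aff P) (brR v)) := by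
  have : ∀ n, ∃ m, FFld P m ≤ (FFld P n).comap (LinearMap.lTensor (Aff P) (brR v)) := by
    intro n
    obtain ⟨m, hm⟩ := bracket_filtDC (Or.inl rfl) v n
    obtain ⟨m', hm'⟩ := bracket_filtDC (Or.inr rfl) v n
    refine ⟨max n (max m m'), FFld_le (B := LinearMap.lTensor (Aff P) (brR v)) (H := FFld P n)
      fun e he X hX u hu => ?_⟩
    rw [LinearMap.lTensor_tmul, brR_apply]
    refine FFld_mem he (filt_anti (le_max_left _ _) hX) ?_
    rw [← lie_skew]
    refine Submodule.neg_mem _ ?_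
    rcases he with rfl | rfl
    · exact hm' _ ((le_max_right _ _).trans (le_max_right _ _)) u hu
    · rw [neg_neg] at hu ⊢
      exact hm _ ((le_max_left _ _).trans (le_max_right _ _)) u hu
  choose m hm using this
  exact ⟨m, hm⟩

/-- the operator `X ⊗ u ↦ X ⊗ [u, v]` on formal fields -/
def derHat (v : gDC P) : Fld P →ₗ[ℂ] Fld P :=
  Compl.mapC FFld_anti (LinearMap.lTensor (Aff P) (brR v)) (exists_derHat v).choose
    (exists_derHat v).choose_spec

theorem adT_le (Y : Aff P) (n : ℕ) : FFld P (n + 1 + bd Y) ≤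
    (FFld P n).comap (LinearMap.rTensor (gDC P) (LieModule.toEnd ℂ (Aff P) (Aff P) Y)) := by
  refine FFld_le (B := LinearMap.rTensor (gDC P) (LieModule.toEnd ℂ (Aff P) (Aff P) Y))
    (H := FFld P n) fun e he X hX u hu => ?_
  rw [LinearMap.rTensor_tmul, LieModule.toEnd_apply_apply]
  refine FFld_mem he (bracket_filt he Y n _ le_rfl hX) (filtDC_anti ?_ hu)
  omega

/-- the operator `X ⊗ u ↦ [Y, X] ⊗ u` on formal fields -/
def adHat (Y : Aff P) : Fld P →ₗ[ℂ] Fld P :=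
  Compl.mapC FFld_anti (LinearMap.rTensor (gDC P) (LieModule.toEnd ℂ (Aff P) (Aff P) Y))
    (fun n => n + 1 + bd Y) (adT_le Y)

variable (P) in
/-- `(X ⊗ s, Y ⊗ v) ↦ (X | Y) s v` -/
def trip₀ : Aff P ⊗[ℂ] Sym P →ₗ[ℂ] Aff P ⊗[ℂ] gDC P →ₗ[ℂ] Sym P :=
  (TensorProduct.map₂ (Aff.form P)
    ((LinearMap.mul ℂ (Sym P)).compl₂ (SymmetricAlgebra.ι ℂ (gDC P)))).compr₂
      (TensorProduct.lid ℂ (Sym P)).toLinearMap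

theorem trip₀_tmul (X Y : Aff P) (s : Sym P) (v : gDC P) :
    trip₀ P (X ⊗ₜ s) (Y ⊗ₜ v) = Aff.form P X Y • (s * SymmetricAlgebra.ι ℂ (gDC P) v) := by
  simp [trip₀]

theorem trip₀_eq_evT (a : Aff P ⊗[ℂ] Sym P) (Y : Aff P) (v : gDC P) :
    trip₀ P a (Y ⊗ₜ v) = evT (Sym P) Y a * SymmetricAlgebra.ι ℂ (gDC P) v := by
  induction a using TensorProduct.induction_on with
  | zero => simp
  | tmul X s => rw [trip₀_tmul, evT_tmul, smul_mul_assoc, Aff.form_symm]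
  | add a a' h h' => rw [map_add, map_add, LinearMap.add_apply, h, h', add_mul]

theorem trip_cont : ContBilin (trip₀ P) (FAS P) (FFld P) (FS P) where
  antiF := FAS_anti
  antiG := FFld_anti
  joint n := by
    refine ⟨max n 1, fun a ha b hb => ?_⟩
    refine FFld_le (B := trip₀ P a) (fun e he Y hY v hv => ?_) b hb
    have key : ∀ e' : ℤ, (e' = 1 ∨ e' = -1) → ∀ X ∈ filt P e' (max n 1),
        ∀ s ∈ idealS P (-e') (max n 1), trip₀ P (X ⊗ₜ s) (Y ⊗ₜ v) ∈ FS P n := by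
      intro e' he' X hX s hs
      rw [trip₀_tmul]
      rcases pm_cases he he' with rfl | rfl
      · rw [form_filt (le_max_right n 1) hX hY, zero_smul]
        exact Submodule.zero_mem _
      · refine Submodule.smul_mem _ _ (FS_anti (le_max_left n 1) ?_)
        rw [neg_neg] at hs
        have h1 := ι_mem_idealS hv
        rcases he with rfl | rfl
        · exact ⟨Ideal.mul_mem_right _ _ hs, Ideal.mul_mem_left _ _ h1⟩
        · rw [neg_neg] at h1
          exact ⟨Ideal.mul_mem_left _ _ h1, Ideal.mul_mem_right _ _ hs⟩
    have : FAS P (max n 1) ≤ (FS P n).comap ((trip₀ P).flip (Y ⊗ₜ v)) := by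
      refine sup_le (sup_le (Submodule.map₂_le.mpr fun X hX s hs => ?_)
        (Submodule.map₂_le.mpr fun X hX s hs => ?_)) (Submodule.map₂_le.mpr fun X _ s hs => ?_)
      · exact key 1 (Or.inl rfl) X hX s hs
      · exact key (-1) (Or.inr rfl) X hX s (by rw [neg_neg]; exact hs)
      · rw [TensorProduct.mk_apply, Submodule.mem_comap, LinearMap.flip_apply, trip₀_tmul]
        have hs' := FS_anti (le_max_left n 1) hs
        exact Submodule.smul_mem _ _ ⟨Ideal.mul_mem_right _ _ hs'.1, Ideal.mul_mem_right _ _ hs'.2⟩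
    exact this ha
  left a n := by
    induction a using TensorProduct.induction_on with
    | zero => exact ⟨0, fun b _ => by simp⟩
    | tmul X s =>
      refine ⟨1 + bd X, FFld_le fun e he Y hY v _ => ?_⟩
      rw [trip₀_tmul, form_filt' he X _ le_rfl hY, zero_smul]
      exact Submodule.zero_mem _
    | add a a' ha ha' =>
      obtain ⟨m, hm⟩ := ha
      obtain ⟨m', hm'⟩ := ha'
      refine ⟨max m m', fun b hb => ?_⟩
      rw [map_add, LinearMap.add_apply]
      exact Submodule.add_mem _ (hm b (FFld_anti (le_max_left _ _) hb))
        (hm' b (FFld_anti (le_max_right _ _) hb))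
  right b n := by
    induction b using TensorProduct.induction_on with
    | zero => exact ⟨0, fun b _ => by simp⟩
    | tmul Y v =>
      refine ⟨max n (1 + bd Y), fun a ha => ?_⟩
      rw [trip₀_eq_evT]
      have h2 := FAS_le_comap Y n ha
      exact ⟨Ideal.mul_mem_right _ _ h2.1, Ideal.mul_mem_right _ _ h2.2⟩
    | add a a' ha ha' =>
      obtain ⟨m, hm⟩ := ha
      obtain ⟨m', hm'⟩ := ha'
      refine ⟨max m m', fun b hb => ?_⟩
      rw [map_add]
      exact Submodule.add_mem _ (hm b (FAS_anti (le_max_left _ _) hb))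
        (hm' b (FAS_anti (le_max_right _ _) hb))

variable (P) in
/-- the pairing `(X ⊗ s, Y ⊗ v) ↦ (X | Y) s v` on the completions -/
def tripL : AuxS P →ₗ[ℂ] Fld P →ₗ[ℂ] SHat P := (trip_cont (P := P)).extL

end Operations

/-! ### Identities between the operations -/

section Identities

variable [NeZero T] {P : DihedralGaudin T 𝔤}

theorem evHat_eq {Y : Aff P} {u : ℕ → Aff P ⊗[ℂ] gDC P} {A : Fld P} {v : gDC P} (h : Tends u A)
    (h' : ∃ k, ∀ l, k ≤ l → evT (gDC P) Y (u l) = v) : evHat Y A = v := by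
  obtain ⟨k, hk⟩ := h.evHat Y
  obtain ⟨k', hk'⟩ := h'
  rw [← hk _ (le_max_left k k'), hk' _ (le_max_right k k')]

theorem evT_lTensor {N N' : Type*} [AddCommGroup N] [Module ℂ N] [AddCommGroup N'] [Module ℂ N']
    (f : N →ₗ[ℂ] N') (Y : Aff P) (t : Aff P ⊗[ℂ] N) :
    evT N' Y (LinearMap.lTensor (Aff P) f t) = f (evT N Y t) := by
  induction t using TensorProduct.induction_on with
  | zero => simp
  | tmul X s => simp
  | add a a' h h' => simp only [map_add, h, h']

theorem evHat_derHat (Y : Aff P) (v : gDC P) (A : Fld P) :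
    evHat Y (derHat v A) = ⁅evHat Y A, v⁆ := by
  obtain ⟨u, hu⟩ := exists_tends FFld_anti A
  obtain ⟨k, hk⟩ := hu.evHat Y
  exact evHat_eq hu.mapC ⟨k, fun l hl => by rw [evT_lTensor, hk l hl, brR_apply]⟩

theorem evT_ad {N : Type*} [AddCommGroup N] [Module ℂ N] (Y Z : Aff P) (t : Aff P ⊗[ℂ] N) :
    evT N Y (LinearMap.rTensor N (LieModule.toEnd ℂ (Aff P) (Aff P) Z) t) = evT N ⁅Y, Z⁆ t := by
  induction t using TensorProduct.induction_on with
  | zero => simp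
  | tmul X s =>
    rw [LinearMap.rTensor_tmul, LieModule.toEnd_apply_apply, evT_tmul, evT_tmul, Aff.form_lie]
  | add a a' h h' => simp only [map_add, h, h']

theorem evHat_adHat (Y Z : Aff P) (A : Fld P) : evHat Y (adHat Z A) = evHat ⁅Y, Z⁆ A := by
  obtain ⟨u, hu⟩ := exists_tends FFld_anti A
  obtain ⟨k, hk⟩ := hu.evHat ⁅Y, Z⁆
  exact evHat_eq hu.mapC ⟨k, fun l hl => by rw [evT_ad, hk l hl]⟩

theorem evT_sig {N : Type*} [AddCommGroup N] [Module ℂ N] (Y : Aff P) (t : Aff P ⊗[ℂ] N) :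
    evT N (Aff.sig P Y) (LinearMap.rTensor N (Aff.sig P) t) = evT N Y t := by
  induction t using TensorProduct.induction_on with
  | zero => simp
  | tmul X s => rw [LinearMap.rTensor_tmul, evT_tmul, evT_tmul, Aff.form_sig]
  | add a a' h h' => simp only [map_add, h, h']

theorem evHat_sigHat (Y : Aff P) (A : Fld P) :
    evHat (Aff.sig P Y) (sigHat P A) = evHat Y A := by
  obtain ⟨u, hu⟩ := exists_tends FFld_anti A
  obtain ⟨k, hk⟩ := hu.evHat Y
  exact evHat_eq hu.map ⟨k, fun l hl => by rw [evT_sig, hk l hl]⟩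

theorem evHat_sigHat_pow (k : ℕ) (Y : Aff P) (A : Fld P) :
    evHat ((Aff.sig P ^ k) Y) ((sigHat P ^ k) A) = evHat Y A := by
  induction k with
  | zero => simp
  | succ k ih => rw [pow_succ', pow_succ', Module.End.mul_apply, Module.End.mul_apply,
      evHat_sigHat, ih]

theorem evT_act (f : Sym P) (Y : Aff P) (t : Aff P ⊗[ℂ] gDC P) :
    evT (Sym P) Y (act₀ P f t) =
      poisson (gDC P) f (SymmetricAlgebra.ι ℂ (gDC P) (evT (gDC P) Y t)) := by
  induction t using TensorProduct.induction_on with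
  | zero => simp
  | tmul X s => rw [act₀_tmul, evT_tmul, evT_tmul, map_smul, map_smul]
  | add a a' h h' => simp only [map_add, h, h']

/-- a formal observable given by an element of the Lie algebra -/
def obs (v : gDC P) : SHat P := Compl.const (FS P) (SymmetricAlgebra.ι ℂ (gDC P) v)

/-- Evaluation turns the action of an observable on a formal field into a Poisson bracket. -/
theorem evA_actL (f : SHat P) (Y : Aff P) (A : Fld P) :
    evA Y (actL P f A) = poissonL P f (obs (evHat Y A)) := by
  obtain ⟨u, hu⟩ := exists_tends FS_anti f
  obtain ⟨v, hv⟩ := exists_tends FFld_anti A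
  obtain ⟨k, hk⟩ := hv.evHat Y
  refine Tends.unique ((hu.extL act_cont hv).mapC.congr ⟨k, fun l hl => ?_⟩)
    (hu.extL poisson_cont (Compl.tends_const _))
  rw [evT_act, hk l hl]

theorem evT_aux (Y : Aff P) (a b : Aff P ⊗[ℂ] gDC P) :
    evT (Sym P) Y (aux₀ P a b) =
      pair₀ P (LinearMap.rTensor (gDC P) (LieModule.toEnd ℂ (Aff P) (Aff P) Y) a) b := by
  induction a using TensorProduct.induction_on with
  | zero => simp
  | add a a' h h' => simp only [map_add, LinearMap.add_apply, h, h']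
  | tmul X u =>
    induction b using TensorProduct.induction_on with
    | zero => simp
    | add a a' h h' => simp only [map_add, h, h']
    | tmul Z v =>
      rw [aux₀_tmul, evT_tmul, LinearMap.rTensor_tmul, pair₀_tmul, LieModule.toEnd_apply_apply,
        Aff.form_lie]

/-- Evaluation turns the bracket of formal fields into a pairing, by invariance of the form. -/
theorem evA_auxL (Y : Aff P) (A B : Fld P) :
    evA Y (auxL P A B) = pairL P (adHat Y A) B := by
  obtain ⟨u, hu⟩ := exists_tends FFld_anti A
  obtain ⟨v, hv⟩ := exists_tends FFld_anti B
  exact Tends.unique ((hu.extL aux_cont hv).mapC.congr ⟨0, fun l _ => evT_aux _ _ _⟩)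
    (hu.mapC.extL pair_cont hv)

theorem poisson_mulG (u v w : gDC P) :
    poisson (gDC P) (mulG P u v) (SymmetricAlgebra.ι ℂ (gDC P) w) =
      mulG P ⁅u, w⁆ v + mulG P u ⁅v, w⁆ := by
  rw [mulG_apply, poisson_mul_left, poisson_ι_ι, poisson_ι_ι, mulG_apply, mulG_apply]
  ring

theorem poisson_pair (a b : Aff P ⊗[ℂ] gDC P) (w : gDC P) :
    poisson (gDC P) (pair₀ P a b) (SymmetricAlgebra.ι ℂ (gDC P) w) =
      pair₀ P (LinearMap.lTensor (Aff P) (brR w) a) b +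
        pair₀ P a (LinearMap.lTensor (Aff P) (brR w) b) := by
  induction a using TensorProduct.induction_on with
  | zero => simp
  | add a a' h h' => simp only [map_add, LinearMap.add_apply, h, h']; abel
  | tmul X u =>
    induction b using TensorProduct.induction_on with
    | zero => simp
    | add a a' h h' => simp only [map_add, LinearMap.add_apply, h, h']; abel
    | tmul Z v =>
      rw [LinearMap.lTensor_tmul, LinearMap.lTensor_tmul, pair₀_tmul, pair₀_tmul, pair₀_tmul,
        map_smul, LinearMap.smul_apply, poisson_mulG, smul_add, brR_apply, brR_apply]

/-- The Leibniz rule for the pairing of two fields and a linear observable. -/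
theorem poissonL_pairL (A B : Fld P) (w : gDC P) :
    poissonL P (pairL P A B) (obs w) = pairL P (derHat w A) B + pairL P A (derHat w B) := by
  obtain ⟨u, hu⟩ := exists_tends FFld_anti A
  obtain ⟨v, hv⟩ := exists_tends FFld_anti B
  exact Tends.unique (((hu.extL pair_cont hv).extL poisson_cont (Compl.tends_const _)).congr
    ⟨0, fun l _ => poisson_pair _ _ _⟩)
    ((hu.mapC.extL pair_cont hv).add (hu.extL pair_cont hv.mapC))

theorem pairL_symm (A B : Fld P) : pairL P A B = pairL P B A := by
  obtain ⟨u, hu⟩ := exists_tends FFld_anti A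
  obtain ⟨v, hv⟩ := exists_tends FFld_anti B
  exact Tends.unique ((hu.extL pair_cont hv).congr ⟨0, fun l _ => pair₀_symm _ _⟩)
    (hv.extL pair_cont hu)

theorem pair₀_ad (Y : Aff P) (a b : Aff P ⊗[ℂ] gDC P) :
    pair₀ P (LinearMap.rTensor (gDC P) (LieModule.toEnd ℂ (Aff P) (Aff P) Y) a) b =
      - pair₀ P a (LinearMap.rTensor (gDC P) (LieModule.toEnd ℂ (Aff P) (Aff P) Y) b) := by
  induction a using TensorProduct.induction_on with
  | zero => simp
  | add a a' h h' => simp only [map_add, LinearMap.add_apply, h, h']; abel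
  | tmul X u =>
    induction b using TensorProduct.induction_on with
    | zero => simp
    | add a a' h h' => simp only [map_add, h, h']; abel
    | tmul Z v =>
      rw [LinearMap.rTensor_tmul, LinearMap.rTensor_tmul, pair₀_tmul, pair₀_tmul,
        LieModule.toEnd_apply_apply, LieModule.toEnd_apply_apply, ← lie_skew, map_neg,
        LinearMap.neg_apply, Aff.form_lie, neg_smul]

theorem pairL_adHat (Y : Aff P) (A B : Fld P) :
    pairL P (adHat Y A) B = - pairL P A (adHat Y B) := by
  obtain ⟨u, hu⟩ := exists_tends FFld_anti A
  obtain ⟨v, hv⟩ := exists_tends FFld_anti B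
  exact Tends.unique ((hu.mapC.extL pair_cont hv).congr ⟨0, fun l _ => pair₀_ad _ _ _⟩)
    (hu.extL pair_cont hv.mapC).neg

theorem pairL_adHat_self (Y : Aff P) (A : Fld P) : pairL P (adHat Y A) A = 0 := by
  refine eq_zero_of_self_neg (M := SHat P) ?_
  conv_lhs => rw [pairL_adHat, pairL_symm]

theorem pair₀_sig (a b : Aff P ⊗[ℂ] gDC P) :
    pair₀ P (LinearMap.rTensor (gDC P) (Aff.sig P) a) (LinearMap.rTensor (gDC P) (Aff.sig P) b) =
      pair₀ P a b := by
  induction a using TensorProduct.induction_on with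
  | zero => simp
  | add a a' h h' => simp only [map_add, LinearMap.add_apply, h, h']
  | tmul X u =>
    induction b using TensorProduct.induction_on with
    | zero => simp
    | add a a' h h' => simp only [map_add, h, h']
    | tmul Z v =>
      rw [LinearMap.rTensor_tmul, LinearMap.rTensor_tmul, pair₀_tmul, pair₀_tmul, Aff.form_sig]

theorem pairL_sigHat (A B : Fld P) : pairL P (sigHat P A) (sigHat P B) = pairL P A B := by
  obtain ⟨u, hu⟩ := exists_tends FFld_anti A
  obtain ⟨v, hv⟩ := exists_tends FFld_anti B
  exact Tends.unique ((hu.map.extL pair_cont hv.map).congr ⟨0, fun l _ => pair₀_sig _ _⟩)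
    (hu.extL pair_cont hv)

theorem pairL_sigHat_pow (k : ℕ) (A B : Fld P) :
    pairL P ((sigHat P ^ k) A) ((sigHat P ^ k) B) = pairL P A B := by
  induction k with
  | zero => simp
  | succ k ih => rw [pow_succ', Module.End.mul_apply, Module.End.mul_apply, pairL_sigHat, ih]

theorem poisson_pair_right (f : Sym P) (a b : Aff P ⊗[ℂ] gDC P) :
    poisson (gDC P) f (pair₀ P a b) = trip₀ P (act₀ P f a) b + trip₀ P (act₀ P f b) a := by
  induction a using TensorProduct.induction_on with
  | zero => simp
  | add a a' h h' => simp only [map_add, LinearMap.add_apply, h, h']; abel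
  | tmul X u =>
    induction b using TensorProduct.induction_on with
    | zero => simp
    | add a a' h h' => simp only [map_add, LinearMap.add_apply, h, h']; abel
    | tmul Z v =>
      rw [pair₀_tmul, act₀_tmul, act₀_tmul, trip₀_tmul, trip₀_tmul, map_smul, mulG_apply,
        poisson_mul_right, Aff.form_symm Z X, ← smul_add]
      congr 1
      ring

/-- The Leibniz rule for an arbitrary observable and the pairing of two fields. -/
theorem poissonL_pairL_right (f : SHat P) (A B : Fld P) :
    poissonL P f (pairL P A B) = tripL P (actL P f A) B + tripL P (actL P f B) A := by
  obtain ⟨w, hw⟩ := exists_tends FS_anti f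
  obtain ⟨u, hu⟩ := exists_tends FFld_anti A
  obtain ⟨v, hv⟩ := exists_tends FFld_anti B
  exact Tends.unique ((hw.extL poisson_cont (hu.extL pair_cont hv)).congr
    ⟨0, fun l _ => poisson_pair_right _ _ _⟩)
    (((hw.extL act_cont hu).extL trip_cont hv).add ((hw.extL act_cont hv).extL trip_cont hu))

theorem trip₀_aux₀ (a b c : Aff P ⊗[ℂ] gDC P) :
    trip₀ P (aux₀ P a b) c = - trip₀ P (aux₀ P a c) b := by
  induction a using TensorProduct.induction_on with
  | zero => simp
  | add a a' h h' => simp only [map_add, LinearMap.add_apply, h, h']; abel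
  | tmul X u =>
    induction b using TensorProduct.induction_on with
    | zero => simp
    | add a a' h h' => simp only [map_add, LinearMap.add_apply, h, h']; abel
    | tmul Y v =>
      induction c using TensorProduct.induction_on with
      | zero => simp
      | add a a' h h' => simp only [map_add, LinearMap.add_apply, h, h']; abel
      | tmul Z w =>
        rw [aux₀_tmul, aux₀_tmul, trip₀_tmul, trip₀_tmul, mulG_apply, mulG_apply, ← neg_smul]
        congr 1
        · rw [Aff.form_lie, Aff.form_lie, ← map_neg, lie_skew]
        · ring

/-- `([A, B] | B) = 0`: a flow of Lax form preserves the square of the Lax matrix. -/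
theorem tripL_auxL_self (A B : Fld P) : tripL P (auxL P A B) B = 0 := by
  obtain ⟨u, hu⟩ := exists_tends FFld_anti A
  obtain ⟨v, hv⟩ := exists_tends FFld_anti B
  exact Tends.unique ((hu.extL aux_cont hv).extL trip_cont hv) (tends_zero.congr
    ⟨0, fun l _ => (eq_zero_of_self_neg (trip₀_aux₀ _ _ _)).symm⟩)

variable [FiniteDimensional ℂ 𝔤]

theorem fld_separation {A : Fld P} (h : ∀ Y, evHat Y A = 0) : A = 0 := by
  obtain ⟨u, hu⟩ := exists_tends FFld_anti A
  refine tensor_separation (F := FFld P) (G := filtDC P) (G₀ := fun _ => ⊥) (fun _ _ _ => bot_le)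
    FFld_anti (fun n => le_sup_left) (fun n e he X hX v hv => FFld_mem he hX hv) ?_ hu
    fun Y n => ?_
  · rintro n X v hv
    rw [(Submodule.mem_bot ℂ).mp hv, TensorProduct.tmul_zero]
    exact Submodule.zero_mem _
  · obtain ⟨k, hk⟩ := hu.evHat Y
    exact ⟨k, fun l hl => (Submodule.mem_bot ℂ).mpr (by rw [hk l hl, h])⟩

/-- A formal field is determined by its evaluations. -/
theorem fld_ext {A B : Fld P} (h : ∀ Y, evHat Y A = evHat Y B) : A = B :=
  sub_eq_zero.mp (fld_separation fun Y => by rw [map_sub, h, sub_self])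

theorem auxS_separation {A : AuxS P} (h : ∀ Y, evA Y A = 0) : A = 0 := by
  obtain ⟨u, hu⟩ := exists_tends FAS_anti A
  refine tensor_separation (F := FAS P) (G := fun e n => (idealS P e n).restrictScalars ℂ)
    (G₀ := FS P) ?_ FAS_anti (fun n => le_rfl)
    (fun n e he X hX v hv => FAS_mem he hX hv) (fun n X v hv => FAS_top hv) hu fun Y n => ?_
  · rintro e (rfl | rfl) n
    · exact fun s hs => hs.1
    · exact fun s hs => hs.2
  · obtain ⟨k, hk⟩ := hu.mapC (hF := FAS_anti) (hφ := FAS_le_comap Y) n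
    refine ⟨k, fun l hl => (Submodule.Quotient.mk_eq_zero _).mp ?_⟩
    change (FS P n).mkQ _ = 0
    rw [hk l hl]
    change (evA Y A).1 n = 0
    rw [h]
    rfl

/-- An element of the completed tensor product with the formal observables is determined by its
evaluations. -/
theorem auxS_ext {A B : AuxS P} (h : ∀ Y, evA Y A = evA Y B) : A = B :=
  sub_eq_zero.mp (auxS_separation fun Y => by rw [map_sub, h, sub_self])

end Identities

/-! ### Brackets of the modes of a marked point -/

section Modes

variable [NeZero T] (P : DihedralGaudin T 𝔤)

theorem tm_zero {P : DihedralGaudin T 𝔤} (z : ℂ) : tm z (0 : gD P) = 0 :=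
  TensorProduct.tmul_zero _ z

/-- An element of the complexification has a real and an imaginary part. -/
theorem gDC_exists (v : gDC P) : ∃ a b : gD P, v = tm 1 a + tm Complex.I b := by
  induction v using gDC_induction with
  | h0 => exact ⟨0, 0, by rw [tm_zero, tm_zero, add_zero]⟩
  | ha v w h h' =>
    obtain ⟨a, b, rfl⟩ := h
    obtain ⟨a', b', rfl⟩ := h'
    refine ⟨a + a', b + b', ?_⟩
    have h : ∀ (z : ℂ) (x y : gD P), tm z (x + y) = tm z x + tm z y :=
      fun z x y => TensorProduct.tmul_add z x y
    rw [h, h]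
    abel
  | ht z X =>
    refine ⟨z.re • X, z.im • X, ?_⟩
    have h : ∀ (w : ℂ) (r : ℝ), tm w (r • X) = tm ((r : ℂ) * w) X := fun w r => by
      rw [← Complex.real_smul]
      exact (TensorProduct.smul_tmul r w X).symm
    have h' : ∀ (w w' : ℂ), tm (w + w') X = tm w X + tm w' X :=
      fun w w' => TensorProduct.add_tmul w w' X
    rw [h, h, ← h', mul_one, Complex.re_add_im]

variable {P}

/-- The complexification embeds in two copies of the sum of Takiff algebras, by
`v ↦ (phi v, phi (conj v))`. -/
theorem gDC_ext {v w : gDC P} (h : phi P v = phi P w)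
    (h' : phi P (conjC P v) = phi P (conjC P w)) : v = w := by
  have key : ∀ u : gDC P, phi P u = 0 → phi P (conjC P u) = 0 → u = 0 := by
    intro u hu hu'
    obtain ⟨a, b, rfl⟩ := gDC_exists P u
    simp only [map_add, phi_tm, conjC_tm, map_one, one_smul, Complex.conj_I] at hu hu'
    have ha : (2 : ℂ) • (a : TakD P) = 0 := by
      rw [two_smul]
      calc (a : TakD P) + a = (a + Complex.I • b) + (a + (-Complex.I) • b) := by module
        _ = 0 := by rw [hu, hu', add_zero]
    have ha' : (a : TakD P) = 0 := (smul_eq_zero.mp ha).resolve_left two_ne_zero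
    rw [ha', zero_add] at hu
    have hb' : (b : TakD P) = 0 := (smul_eq_zero.mp hu).resolve_left Complex.I_ne_zero
    have ha0 : a = 0 := Subtype.ext ha'
    have hb0 : b = 0 := Subtype.ext hb'
    rw [ha0, hb0, tm_zero, tm_zero, add_zero]
  rw [← sub_eq_zero]
  refine key _ ?_ ?_
  · rw [map_sub, h, sub_self]
  · rw [map_sub, map_sub, h', sub_self]

theorem single_of_not_valid {x : OnePoint ℂ} {p : ℕ} (h : ¬ valid P x p) (X : Aff P) :
    single P x p X = 0 := by
  ext1 y q
  rw [single_apply, if_neg fun h' => h h'.2.2]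
  rfl

theorem single_zero (x : OnePoint ℂ) (p : ℕ) : single P x p 0 = 0 := by
  ext1 y q
  rw [single_apply, ite_self]
  rfl

theorem single_add (x : OnePoint ℂ) (p : ℕ) (X Y : Aff P) :
    single P x p (X + Y) = single P x p X + single P x p Y := by
  ext1 y q
  rw [TakD.add_apply, single_apply, single_apply, single_apply]
  split_ifs <;> simp

theorem single_smul (x : OnePoint ℂ) (p : ℕ) (c : ℂ) (X : Aff P) :
    single P x p (c • X) = c • single P x p X := by
  ext1 y q
  rw [TakD.smul_apply, single_apply, single_apply]
  split_ifs <;> simp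

theorem single_lie_single {x : OnePoint ℂ} {p q : ℕ} (h : x = OnePoint.infty → p ≠ 0 ∧ q ≠ 0)
    (X Y : Aff P) : ⁅single P x p X, single P x q Y⁆ = single P x (p + q) ⁅X, Y⁆ := by
  ext1 y s
  rw [TakD.bracket_apply, single_apply x y (p + q) s]
  by_cases hy : y = x
  · subst hy
    by_cases hs : s = p + q
    · subst hs
      by_cases hv : valid P y (p + q)
      · have hp : valid P y p := ⟨by have := hv.1; omega, fun h' => (h h').1⟩
        have hq : valid P y q := ⟨by have := hv.1; omega, fun h' => (h h').2⟩
        rw [if_pos hv, if_pos ⟨rfl, rfl, hv⟩, Finset.sum_eq_single (p, q)]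
        · rw [single_apply, single_apply, if_pos ⟨rfl, rfl, hp⟩, if_pos ⟨rfl, rfl, hq⟩]
        · rintro ⟨a, b⟩ hab hne
          rw [Finset.HasAntidiagonal.mem_antidiagonal] at hab
          rw [single_apply, if_neg, zero_lie]
          rintro ⟨-, h1, -⟩
          dsimp only at h1 hab
          exact hne (Prod.ext h1 (by dsimp only; omega))
        · intro hn
          exact absurd (Finset.HasAntidiagonal.mem_antidiagonal.mpr (by dsimp only)) hn
      · rw [if_neg hv, if_neg fun h' => hv h'.2.2]
    · rw [if_neg fun h' : y = y ∧ s = p + q ∧ valid P y (p + q) => hs h'.2.1]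
      split_ifs
      · refine Finset.sum_eq_zero fun a ha => ?_
        rw [Finset.HasAntidiagonal.mem_antidiagonal] at ha
        rw [single_apply, single_apply]
        split_ifs with h1 h2 h2
        · exact absurd (by rw [← ha, h1.2.1, h2.2.1]) hs
        all_goals simp
      · rfl
  · rw [if_neg fun h' : y = x ∧ s = p + q ∧ valid P x (p + q) => hy h'.1]
    split_ifs
    · refine Finset.sum_eq_zero fun a ha => ?_
      rw [single_apply, if_neg fun h' => hy h'.1, zero_lie]
    · rfl

theorem single_lie_single_of_ne {x x' : OnePoint ℂ} (h : x ≠ x') (p q : ℕ)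
    (X Y : Aff P) : ⁅single P x p X, single P x' q Y⁆ = 0 := by
  ext1 y s
  rw [TakD.bracket_apply, TakD.zero_apply]
  split_ifs
  · refine Finset.sum_eq_zero fun a ha => ?_
    rw [single_apply, single_apply]
    split_ifs with h1 h2 h2
    · exact absurd (h1.1.symm.trans h2.1) h
    all_goals simp
  · rfl

open Classical in
variable (P) in
/-- the rotations `r i` fixing a point -/
def rots (x : OnePoint ℂ) : Finset (ZMod T) :=
  Finset.univ.filter fun i : ZMod T => mobius P.ω (DihedralGroup.r i) x = x

open Classical in
variable (P) in
/-- the reflections `sr i` fixing a point -/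
def refls (x : OnePoint ℂ) : Finset (ZMod T) :=
  Finset.univ.filter fun i : ZMod T => mobius P.ω (DihedralGroup.sr i) x = x

theorem mem_rots {x : OnePoint ℂ} {i : ZMod T} :
    i ∈ rots P x ↔ mobius P.ω (DihedralGroup.r i) x = x := by
  simp [rots]

theorem mem_refls {x : OnePoint ℂ} {i : ZMod T} :
    i ∈ refls P x ↔ mobius P.ω (DihedralGroup.sr i) x = x := by
  simp [refls]

theorem zero_mem_rots (x : OnePoint ℂ) : 0 ∈ rots P x := by
  rw [mem_rots]
  induction x using OnePoint.rec with
  | infty => rfl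
  | coe z =>
    refine congrArg ((↑) : ℂ → OnePoint ℂ) ?_
    change P.ω ^ (0 : ZMod T).val * z = z
    simp

theorem rotCard_eq (x : OnePoint ℂ) : rotCard P x = (rots P x).card := rfl

theorem sum_stab {M : Type*} [AddCommMonoid M] (x : OnePoint ℂ) (f : DihedralGroup T → M) :
    ∑ α ∈ stab P x, f α = ∑ i ∈ rots P x, f (.r i) + ∑ i ∈ refls P x, f (.sr i) := by
  classical
  have h : stab P x = (rots P x).image DihedralGroup.r ∪ (refls P x).image DihedralGroup.sr := by
    ext α
    rw [mem_stab, Finset.mem_union, Finset.mem_image, Finset.mem_image]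
    rcases α with i | i
    · simp [mem_rots]
    · simp [mem_refls]
  rw [h, Finset.sum_union, Finset.sum_image, Finset.sum_image]
  · rintro i _ j _ hij
    exact DihedralGroup.sr.inj hij
  · rintro i _ j _ hij
    exact DihedralGroup.r.inj hij
  · rw [Finset.disjoint_left]
    intro α h1 h2
    rw [Finset.mem_image] at h1 h2
    obtain ⟨i, -, rfl⟩ := h1
    obtain ⟨j, -, h3⟩ := h2
    cases h3

variable (P) in
/-- the average of `X ε_x ^ p` over the rotations fixing `x` -/
def avgRot (x : OnePoint ℂ) (p : ℕ) (X : Aff P) : Aff P :=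
  (rotCard P x : ℂ)⁻¹ • ∑ i ∈ rots P x, Aff.hat P x p (.r i) X

variable (P) in
/-- the normalized sum of the images of `X ε_x ^ p` under the reflections fixing `x` -/
def avgRefl (x : OnePoint ℂ) (p : ℕ) (X : Aff P) : Aff P :=
  (rotCard P x : ℂ)⁻¹ • ∑ i ∈ refls P x, Aff.hat P x p (.sr i) X

theorem hat_r_smul (x : OnePoint ℂ) (p : ℕ) (i : ZMod T) (c : ℂ) (X : Aff P) :
    Aff.hat P x p (.r i) (c • X) = c • Aff.hat P x p (.r i) X := by
  simp [Aff.hat]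

theorem hat_sr_smul (x : OnePoint ℂ) (p : ℕ) (i : ZMod T) (c : ℂ) (X : Aff P) :
    Aff.hat P x p (.sr i) (c • X) = conj c • Aff.hat P x p (.sr i) X := by
  simp [Aff.hat, Aff.tau_smul]

theorem proj_combination (x : OnePoint ℂ) (p : ℕ) (X : Aff P) (c : ℂ) :
    (proj P x p X : TakD P) + c • (proj P x p (-(Complex.I • X)) : TakD P) =
      single P x p ((2 : ℂ)⁻¹ • ((1 - c * Complex.I) • avgRot P x p X +
        (1 + c * Complex.I) • avgRefl P x p X)) := by
  have h1 : ∀ i, Aff.hat P x p (.r i) (-(Complex.I • X)) =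
      (-Complex.I) • Aff.hat P x p (.r i) X := fun i => by
    rw [← neg_smul, hat_r_smul]
  have h2 : ∀ i, Aff.hat P x p (.sr i) (-(Complex.I • X)) =
      Complex.I • Aff.hat P x p (.sr i) X := fun i => by
    rw [← neg_smul, hat_sr_smul, map_neg, Complex.conj_I, neg_neg]
  simp only [proj]
  rw [← single_smul, ← single_add]
  congr 1
  rw [sum_stab, sum_stab]
  simp only [h1, h2, ← Finset.smul_sum]
  rw [avgRot, avgRefl, ← Complex.coe_smul]
  push_cast
  rw [mul_inv]
  module

/-- The two components of `X^{(x)}_p` under the embedding of `gDC_ext` are averages over the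
rotations and over the reflections in the stabilizer of `x`; this is the first one. -/
theorem phi_emb (x : OnePoint ℂ) (p : ℕ) (X : Aff P) :
    phi P (emb P x p X) = single P x p (avgRot P x p X) := by
  rw [emb, map_add, phi_tm, phi_tm, one_smul, proj_combination, Complex.I_mul_I, sub_neg_eq_add,
    add_neg_cancel, zero_smul, add_zero, smul_smul]
  norm_num

theorem phi_conj_emb (x : OnePoint ℂ) (p : ℕ) (X : Aff P) :
    phi P (conjC P (emb P x p X)) = single P x p (avgRefl P x p X) := by
  rw [emb, map_add, map_add, conjC_tm, conjC_tm, phi_tm, phi_tm, map_one, Complex.conj_I, one_smul,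
    proj_combination, neg_mul, Complex.I_mul_I, neg_neg, sub_self, zero_smul, zero_add, smul_smul]
  norm_num

variable (P) in
/-- the map `X ↦ X^{(x)}_p` at a marked point, as a complex linear map -/
def embL (x : OnePoint ℂ) (p : ℕ) : Aff P →ₗ[ℂ] gDC P where
  toFun := emb P x p
  map_add' X Y := by
    refine gDC_ext ?_ ?_
    · rw [map_add, phi_emb, phi_emb, phi_emb, ← single_add]
      simp [avgRot, Finset.sum_add_distrib]
    · rw [map_add, map_add, phi_conj_emb, phi_conj_emb, phi_conj_emb, ← single_add]
      simp [avgRefl, Finset.sum_add_distrib]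
  map_smul' c X := by
    refine gDC_ext ?_ ?_
    · rw [RingHom.id_apply, map_smul, phi_emb, phi_emb, ← single_smul]
      congr 1
      simp only [avgRot, hat_r_smul, ← Finset.smul_sum]
      exact smul_comm _ _ _
    · rw [RingHom.id_apply, LinearMap.map_smulₛₗ, map_smul, phi_conj_emb, phi_conj_emb,
        ← single_smul]
      congr 1
      simp only [avgRefl, hat_sr_smul, ← Finset.smul_sum]
      exact smul_comm _ _ _

theorem embL_apply (x : OnePoint ℂ) (p : ℕ) (X : Aff P) : embL P x p X = emb P x p X := rfl

theorem r_add (i j : ZMod T) : DihedralGroup.r (i + j) = .r i * .r j := by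
  rw [DihedralGroup.r_mul_r]

theorem sum_rots_shift {M : Type*} [AddCommMonoid M] (x : OnePoint ℂ) {j : ZMod T}
    (hj : j ∈ rots P x) (f : ZMod T → M) :
    ∑ i ∈ rots P x, f i = ∑ k ∈ rots P x, f (j + k) := by
  symm
  rw [mem_rots] at hj
  have hj' : mobius P.ω (.r (-j)) x = x := by
    conv_lhs => rw [← hj]
    rw [← mobius_mul, DihedralGroup.r_mul_r, neg_add_cancel]
    exact mem_rots.mp (zero_mem_rots x)
  refine Finset.sum_nbij' (fun k => j + k) (fun i => -j + i) ?_ ?_ ?_ ?_ ?_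
  · intro k hk
    rw [mem_rots] at hk ⊢
    rw [r_add, mobius_mul, hk, hj]
  · intro k hk
    rw [mem_rots] at hk ⊢
    rw [r_add, mobius_mul, hk, hj']
  all_goals simp

theorem sum_refls_shift {M : Type*} [AddCommMonoid M] (x : OnePoint ℂ) {j : ZMod T}
    (hj : j ∈ refls P x) (f : ZMod T → M) :
    ∑ i ∈ refls P x, f i = ∑ k ∈ rots P x, f (j + k) := by
  symm
  rw [mem_refls] at hj
  refine Finset.sum_nbij' (fun k => j + k) (fun i => -j + i) ?_ ?_ ?_ ?_ ?_
  · intro k hk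
    rw [mem_rots] at hk
    rw [mem_refls, ← DihedralGroup.sr_mul_r, mobius_mul, hk, hj]
  · intro k hk
    rw [mem_refls] at hk
    rw [mem_rots, neg_add_eq_sub, ← DihedralGroup.sr_mul_sr, mobius_mul, hk, hj]
  all_goals simp

theorem hat_sum_lie (x : OnePoint ℂ) (p q : ℕ) (g : ZMod T → DihedralGroup T)
    (S : Finset (ZMod T)) (X Y Z : Aff P)
    (h : ∀ j ∈ S, Aff.hat P x p (g j) Z = ∑ i ∈ S, Aff.hat P x p (g i) X) :
    ⁅∑ i ∈ S, Aff.hat P x p (g i) X, ∑ j ∈ S, Aff.hat P x q (g j) Y⁆ =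
      ∑ j ∈ S, Aff.hat P x (p + q) (g j) ⁅Z, Y⁆ := by
  rw [lie_sum]
  exact Finset.sum_congr rfl fun j hj => by rw [Aff.hat_lie, h j hj]

theorem avgRot_lie (x : OnePoint ℂ) (p q : ℕ) (X Y : Aff P) :
    ⁅avgRot P x p X, avgRot P x q Y⁆ = avgRot P x (p + q) ⁅avgRot P x p X, Y⁆ := by
  have h : ∀ j ∈ rots P x, Aff.hat P x p (.r j) (∑ i ∈ rots P x, Aff.hat P x p (.r i) X) =
      ∑ i ∈ rots P x, Aff.hat P x p (.r i) X := fun j hj => by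
    rw [map_sum]
    refine (Finset.sum_congr rfl fun k _ => ?_).trans
      (sum_rots_shift x hj fun i => Aff.hat P x p (.r i) X).symm
    rw [r_add, Aff.hat_mul]
  rw [avgRot, avgRot, avgRot, smul_lie, lie_smul, hat_sum_lie x p q _ _ X Y _ h, smul_lie]
  simp_rw [hat_r_smul]
  rw [← Finset.smul_sum]

theorem avgRefl_lie (x : OnePoint ℂ) (p q : ℕ) (X Y : Aff P) :
    ⁅avgRefl P x p X, avgRefl P x q Y⁆ = avgRefl P x (p + q) ⁅avgRot P x p X, Y⁆ := by
  have h : ∀ j ∈ refls P x, Aff.hat P x p (.sr j) (∑ i ∈ rots P x, Aff.hat P x p (.r i) X) =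
      ∑ i ∈ refls P x, Aff.hat P x p (.sr i) X := fun j hj => by
    rw [map_sum]
    refine (Finset.sum_congr rfl fun k _ => ?_).trans
      (sum_refls_shift x hj fun i => Aff.hat P x p (.sr i) X).symm
    rw [← DihedralGroup.sr_mul_r, Aff.hat_mul]
  rw [avgRefl, avgRefl, avgRefl, avgRot, smul_lie, lie_smul, hat_sum_lie x p q _ _ X Y _ h,
    smul_lie]
  simp_rw [hat_sr_smul]
  rw [← Finset.smul_sum, map_inv₀, map_natCast]

/-- Brackets of the modes at one point: of the first argument, only its average over the rotations
fixing the point matters. At infinity the zeroth modes vanish and have to be excluded. -/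
theorem emb_lie {x : OnePoint ℂ} {p q : ℕ} (h : x = OnePoint.infty → p ≠ 0 ∧ q ≠ 0)
    (X Y : Aff P) : ⁅emb P x p X, emb P x q Y⁆ = emb P x (p + q) ⁅avgRot P x p X, Y⁆ := by
  refine gDC_ext ?_ ?_
  · rw [phi_lie, phi_emb, phi_emb, phi_emb, single_lie_single h, avgRot_lie]
  · rw [conjC_lie, phi_lie, phi_conj_emb, phi_conj_emb, phi_conj_emb, single_lie_single h,
      avgRefl_lie]

theorem emb_lie_of_ne {x y : OnePoint ℂ} (h : x ≠ y) (p q : ℕ) (X Y : Aff P) :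
    ⁅emb P x p X, emb P y q Y⁆ = 0 := by
  refine gDC_ext ?_ ?_
  · rw [phi_lie, phi_emb, phi_emb, single_lie_single_of_ne h, map_zero]
  · rw [conjC_lie, phi_lie, phi_conj_emb, phi_conj_emb, single_lie_single_of_ne h, map_zero,
      map_zero]

theorem emb_lie_conj_of_ne {x y : OnePoint ℂ} (h : x ≠ y) (p q : ℕ) (X Y : Aff P) :
    ⁅emb P x p X, conjC P (emb P y q Y)⁆ = 0 := by
  refine gDC_ext ?_ ?_
  · rw [phi_lie, phi_emb, phi_conj_emb, single_lie_single_of_ne h, map_zero]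
  · rw [conjC_lie, phi_lie, phi_conj_emb, conjC_conjC, phi_emb, single_lie_single_of_ne h, map_zero,
      map_zero]

theorem avgRefl_of_stab {x : OnePoint ℂ} (h : stab P x = {1}) (p : ℕ) (X : Aff P) :
    avgRefl P x p X = 0 := by
  rw [avgRefl, Finset.sum_eq_zero, smul_zero]
  intro i hi
  rw [mem_refls, ← mem_stab, h, Finset.mem_singleton] at hi
  cases hi

/-- At a point with trivial stabilizer the modes commute with their conjugates, as there is no
reflection to mix the two components. -/
theorem emb_lie_conj {x : OnePoint ℂ} (h : stab P x = {1}) (p q : ℕ) (X Y : Aff P) :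
    ⁅emb P x p X, conjC P (emb P x q Y)⁆ = 0 := by
  refine gDC_ext ?_ ?_
  · rw [phi_lie, phi_conj_emb, avgRefl_of_stab h, single_zero, lie_zero, map_zero]
  · rw [conjC_lie, phi_lie, phi_conj_emb, avgRefl_of_stab h, single_zero, zero_lie, map_zero,
      map_zero]

theorem emb_of_not_valid {x : OnePoint ℂ} {p : ℕ} (h : ¬ valid P x p) (X : Aff P) :
    emb P x p X = 0 := by
  refine gDC_ext ?_ ?_
  · rw [phi_emb, single_of_not_valid h, map_zero]
  · rw [phi_conj_emb, single_of_not_valid h, map_zero, map_zero]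

theorem avgRot_of_rots {x : OnePoint ℂ} (h : rots P x = {0}) (p : ℕ) (X : Aff P) :
    avgRot P x p X = X := by
  rw [avgRot, rotCard_eq, h]
  simp [Aff.hat]

end Modes

/-! ### The action of the cyclic group -/

section Twist

variable [NeZero T] (P : DihedralGaudin T 𝔤)

/-- the character `k ↦ ω ^ k` of the cyclic group -/
def om (k : ZMod T) : ℂ := P.ω ^ k.val

/-- the action `k ↦ σ ^ k` of the cyclic group on the affine algebra -/
def sg (k : ZMod T) : Aff P →ₗ[ℂ] Aff P := Aff.sig P ^ k.val

/-- the action `k ↦ σ ^ k` of the cyclic group on the formal fields -/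
def Sg (k : ZMod T) : Fld P →ₗ[ℂ] Fld P := sigHat P ^ k.val

theorem sum_range_zmod {M : Type*} [AddCommMonoid M] (f : ℕ → M) :
    ∑ k ∈ Finset.range T, f k = ∑ k : ZMod T, f k.val := by
  symm
  refine Finset.sum_bij' (fun k _ => k.val) (fun k _ => (k : ZMod T)) ?_ ?_ ?_ ?_ ?_
  · exact fun k _ => Finset.mem_range.mpr (ZMod.val_lt k)
  · exact fun k _ => Finset.mem_univ _
  · exact fun k _ => ZMod.natCast_zmod_val k
  · exact fun k hk => ZMod.val_cast_of_lt (Finset.mem_range.mp hk)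
  · exact fun k _ => rfl

variable {P}

theorem om_zero : om P 0 = 1 := by simp [om]

theorem om_add (k l : ZMod T) : om P (k + l) = om P k * om P l := by
  rw [om, om, om, ZMod.val_add, ← pow_add]
  exact (pow_eq_pow_mod _ P.ω_pow).symm

theorem om_ne_zero (k : ZMod T) : om P k ≠ 0 := pow_ne_zero _ P.ω_ne_zero

theorem om_neg (k : ZMod T) : om P (-k) = (om P k)⁻¹ := by
  refine eq_inv_of_mul_eq_one_left ?_
  rw [← om_add, neg_add_cancel, om_zero]

theorem om_injective : Function.Injective (om P) := by
  intro k l h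
  exact ZMod.val_injective T (P.ω_prim.pow_inj (ZMod.val_lt k) (ZMod.val_lt l) h)

theorem sig_pow_T : Aff.sig P ^ T = 1 := by
  have h := Aff.gen_pow P OnePoint.infty 0
  simpa [Aff.gen, DihedralGaudin.wt] using h

theorem sg_zero (X : Aff P) : sg P 0 X = X := by simp [sg]

theorem sg_add (k l : ZMod T) (X : Aff P) : sg P (k + l) X = sg P k (sg P l X) := by
  have h : sg P (k + l) = sg P k * sg P l := by
    rw [sg, sg, sg, ZMod.val_add, ← pow_add]
    exact (pow_eq_pow_mod _ sig_pow_T).symm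
  rw [h, Module.End.mul_apply]

theorem sg_lie (k : ZMod T) (X Y : Aff P) : sg P k ⁅X, Y⁆ = ⁅sg P k X, sg P k Y⁆ := by
  have h : ∀ n : ℕ, (Aff.sig P ^ n) ⁅X, Y⁆ = ⁅(Aff.sig P ^ n) X, (Aff.sig P ^ n) Y⁆ := by
    intro n
    induction n with
    | zero => simp
    | succ n ih => simp only [pow_succ', Module.End.mul_apply, ih, Aff.sig_lie]
  exact h _

theorem evHat_Sg (k : ZMod T) (Y : Aff P) (A : Fld P) :
    evHat (sg P k Y) (Sg P k A) = evHat Y A := evHat_sigHat_pow _ _ _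

theorem evHat_Sg' (k : ZMod T) (Y : Aff P) (A : Fld P) :
    evHat Y (Sg P k A) = evHat (sg P (-k) Y) A := by
  rw [← evHat_Sg k (sg P (-k) Y), ← sg_add, add_neg_cancel, sg_zero]

theorem pairL_Sg (k : ZMod T) (A B : Fld P) :
    pairL P (Sg P k A) (Sg P k B) = pairL P A B := pairL_sigHat_pow _ _ _

variable [FiniteDimensional ℂ 𝔤]

theorem Sg_add (k l : ZMod T) (A : Fld P) : Sg P (k + l) A = Sg P k (Sg P l A) := by
  refine fld_ext fun Y => ?_
  rw [evHat_Sg', evHat_Sg', evHat_Sg', ← sg_add, neg_add_rev]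

theorem Sg_zero (A : Fld P) : Sg P 0 A = A := by simp [Sg]

theorem pairL_Sg_right (k : ZMod T) (A B : Fld P) :
    pairL P A (Sg P k B) = pairL P (Sg P (-k) A) B := by
  rw [← pairL_Sg (-k) A, ← Sg_add, neg_add_cancel, Sg_zero]

theorem adHat_Sg (k : ZMod T) (Y : Aff P) (A : Fld P) :
    adHat (sg P k Y) (Sg P k A) = Sg P k (adHat Y A) := by
  refine fld_ext fun X => ?_
  rw [evHat_adHat, evHat_Sg', evHat_Sg', evHat_adHat, sg_lie, ← sg_add, neg_add_cancel, sg_zero]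

end Twist

/-! ### Evaluations of the fields attached to points -/

section Evaluations

variable [NeZero T] (P : DihedralGaudin T 𝔤)

open Classical in
/-- The map `Y ↦ (Y | A^x_p)`, which is `Y ↦ Y^{(x)}_p` at a marked point and
`Y ↦ conj ((τ Y)^{(y)}_p)` at the complex conjugate of a marked point `y`. -/
def E (x : OnePoint ℂ) (p : ℕ) : Aff P →ₗ[ℂ] gDC P :=
  if P.level x ≠ 0 then embL P x p else
    { toFun := fun Y => conjC P (embL P (OnePoint.map conj x) p (Aff.tau P Y))
      map_add' := fun Y Z => by rw [map_add, map_add, map_add]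
      map_smul' := fun c Y => by
        rw [Aff.tau_smul, map_smul, LinearMap.map_smulₛₗ, starRingEnd_self_apply,
          RingHom.id_apply] }

variable {P}

theorem E_marked {x : OnePoint ℂ} (h : P.level x ≠ 0) (p : ℕ) (Y : Aff P) :
    E P x p Y = emb P x p Y := by
  rw [E, if_pos h, embL_apply]

theorem E_conj {x : OnePoint ℂ} (h : P.level x = 0) (p : ℕ) (Y : Aff P) :
    E P x p Y = conjC P (emb P (OnePoint.map conj x) p (Aff.tau P Y)) := by
  rw [E, if_neg (not_not.mpr h)]
  rfl

theorem Aff.form_tau_right (X Y : Aff P) :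
    Aff.form P X (Aff.tau P Y) = conj (Aff.form P (Aff.tau P X) Y) := by
  rw [← Aff.form_tau, Aff.tau_tau]

variable [FiniteDimensional ℂ 𝔤]

/-- evaluation recovers the map by which a formal field is defined -/
theorem evHat_A (x : OnePoint ℂ) (p : ℕ) (Y : Aff P) : evHat Y (A P x p) = E P x p Y := by
  by_cases h : P.level x ≠ 0
  · rw [E_marked h, A, if_pos h, field, ← embL_apply]
    refine evHat_eq (Compl.tends_ofSeq _ _) ?_
    obtain ⟨k, hk⟩ := Aff.sum_basis Y
    refine ⟨k, fun l hl => ?_⟩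
    rw [fieldSum]
    simp only [id_eq, ← embL_apply, map_add, map_sum, evT_tmul]
    conv_rhs => rw [← hk l hl]
    simp only [map_add, map_sum, map_smul, Aff.form_symm Y]
  · rw [A, if_neg h, fieldConj]
    rw [not_not] at h
    rw [E_conj h, ← embL_apply]
    refine evHat_eq (Compl.tends_ofSeq _ _) ?_
    obtain ⟨k, hk⟩ := Aff.sum_basis (Aff.tau P Y)
    refine ⟨k, fun l hl => ?_⟩
    rw [fieldSum]
    simp only [← embL_apply, map_add, map_sum, evT_tmul]
    conv_rhs => rw [← hk l hl]
    simp only [map_add, map_sum, map_smul, Aff.form_tau_right, Aff.form_symm (Aff.tau P Y),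
      LinearMap.map_smulₛₗ]

end Evaluations

/-! ### Brackets of the evaluated fields -/

section Commutators

variable [NeZero T] {P : DihedralGaudin T 𝔤}

theorem conj_conj_map (x : OnePoint ℂ) : OnePoint.map conj (OnePoint.map conj x) = x := by
  induction x using OnePoint.rec with
  | infty => rfl
  | coe z => exact congrArg ((↑) : ℂ → OnePoint ℂ) (Complex.conj_conj z)

theorem mobius_reflection (x : OnePoint ℂ) :
    mobius P.ω (.sr 0 : DihedralGroup T) x = OnePoint.map conj x := by
  induction x using OnePoint.rec with
  | infty => rfl
  | coe z =>
    refine congrArg ((↑) : ℂ → OnePoint ℂ) ?_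
    change conj (P.ω ^ (0 : ZMod T).val * z) = conj z
    simp

theorem level_conj {m : OnePoint ℂ} (hm : P.level m ≠ 0) (h : stab P m = {1}) :
    P.level (OnePoint.map conj m) = 0 := by
  by_contra h'
  have h1 := P.level_disjoint m (Finsupp.mem_support_iff.mpr hm) (OnePoint.map conj m)
    (Finsupp.mem_support_iff.mpr h') (.sr 0) (mobius_reflection m)
  have h2 : (.sr 0 : DihedralGroup T) ∈ stab P m := by
    rw [mem_stab, mobius_reflection, ← h1]
  rw [h, Finset.mem_singleton] at h2
  cases h2

/-- A point of `pts P` is marked, or it is the conjugate of a marked point with trivial stabilizer;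
the two cases exclude each other because marked points lie in distinct orbits. -/
theorem mem_pts_cases {x : OnePoint ℂ} (h : x ∈ pts P) : P.level x ≠ 0 ∨
    (P.level x = 0 ∧ P.level (OnePoint.map conj x) ≠ 0 ∧
      stab P (OnePoint.map conj x) = {1}) := by
  classical
  rw [pts, Finset.mem_union, Finset.mem_image] at h
  rcases h with h | ⟨m, hm, rfl⟩
  · exact Or.inl (Finsupp.mem_support_iff.mp h)
  · rw [Finset.mem_filter, Finsupp.mem_support_iff] at hm
    rw [conj_conj_map]
    exact Or.inr ⟨level_conj hm.1 hm.2, hm.1, hm.2⟩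

theorem rots_of_stab {x : OnePoint ℂ} (h : stab P x = {1}) : rots P x = {0} := by
  ext i
  rw [mem_rots, ← mem_stab, h, Finset.mem_singleton, Finset.mem_singleton, DihedralGroup.one_def]
  exact ⟨fun h => DihedralGroup.r.inj h, fun h => by rw [h]⟩

theorem rots_of_ne_zero {x : ℂ} (hx : x ≠ 0) : rots P x = {0} := by
  ext i
  rw [mem_rots, Finset.mem_singleton]
  constructor
  · intro h
    have h1 : om P i * x = x := OnePoint.coe_injective h
    have h2 : om P i = om P 0 := by
      rw [om_zero]
      exact mul_right_cancel₀ hx (by rw [h1, one_mul])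
    exact om_injective h2
  · rintro rfl
    exact mem_rots.mp (zero_mem_rots _)

/-- the formal fields attached to distinct points Poisson commute -/
theorem E_lie_of_ne {x y : OnePoint ℂ} (hx : x ∈ pts P) (hy : y ∈ pts P) (h : x ≠ y) (p q : ℕ)
    (X Y : Aff P) : ⁅E P x p X, E P y q Y⁆ = 0 := by
  have key : ∀ {x y : OnePoint ℂ}, P.level x ≠ 0 → P.level y = 0 →
      stab P (OnePoint.map conj y) = {1} → ∀ p q X Y, ⁅E P x p X, E P y q Y⁆ = 0 := by
    intro x y hx hy hs p q X Y
    rw [E_marked hx, E_conj hy]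
    by_cases hxy : x = OnePoint.map conj y
    · rw [← hxy] at hs ⊢
      exact emb_lie_conj hs _ _ _ _
    · exact emb_lie_conj_of_ne hxy _ _ _ _
  rcases mem_pts_cases hx with hx | ⟨hx, -, hxs⟩ <;> rcases mem_pts_cases hy with hy | ⟨hy, -, hys⟩
  · rw [E_marked hx, E_marked hy, emb_lie_of_ne h]
  · exact key hx hy hys _ _ _ _
  · rw [← lie_skew, key hy hx hxs, neg_zero]
  · rw [E_conj hx, E_conj hy, ← conjC_lie, emb_lie_of_ne, map_zero]
    intro h'
    exact h (by rw [← conj_conj_map x, h', conj_conj_map])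

theorem emb_lie_of_rots {x : OnePoint ℂ} (h : rots P x = {0}) (h' : x ≠ OnePoint.infty) (p q : ℕ)
    (X Y : Aff P) : ⁅emb P x p X, emb P x q Y⁆ = emb P x (p + q) ⁅X, Y⁆ := by
  rw [emb_lie fun h'' => absurd h'' h', avgRot_of_rots h]

/-- The Takiff relations at a point whose orbit is free under rotations. -/
theorem E_lie {x : ℂ} (hx : (x : OnePoint ℂ) ∈ pts P) (h0 : x ≠ 0) (p q : ℕ) (X Y : Aff P) :
    ⁅E P x p X, E P x q Y⁆ = E P x (p + q) ⁅X, Y⁆ := by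
  rcases mem_pts_cases hx with hx | ⟨hx, -, hxs⟩
  · rw [E_marked hx, E_marked hx, E_marked hx,
      emb_lie_of_rots (rots_of_ne_zero h0) (OnePoint.coe_ne_infty x)]
  · rw [E_conj hx, E_conj hx, E_conj hx, ← conjC_lie, Aff.tau_lie,
      emb_lie_of_rots (rots_of_stab hxs)]
    exact OnePoint.coe_ne_infty (conj x)

theorem level_le_bound (x : OnePoint ℂ) : P.level x ≤ bound P := by
  by_cases h : x ∈ P.level.support
  · exact Finset.single_le_sum (f := P.level) (fun _ _ => Nat.zero_le _) h
  · rw [Finsupp.notMem_support_iff.mp h]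
    exact Nat.zero_le _

theorem E_of_level {x : OnePoint ℂ} {p : ℕ} (h : P.level x ≤ p)
    (h' : P.level (OnePoint.map conj x) ≤ p) (Y : Aff P) : E P x p Y = 0 := by
  by_cases hx : P.level x ≠ 0
  · rw [E_marked hx, emb_of_not_valid fun hv => absurd hv.1 (not_lt.mpr h)]
  · rw [not_not] at hx
    rw [E_conj hx, emb_of_not_valid fun hv => absurd hv.1 (not_lt.mpr h'), map_zero]

theorem E_of_bound_le (x : OnePoint ℂ) {p : ℕ} (h : bound P ≤ p) (Y : Aff P) : E P x p Y = 0 :=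
  E_of_level ((level_le_bound x).trans h) ((level_le_bound _).trans h) Y

/-- the origin is fixed by the whole dihedral group -/
theorem mobius_zero (α : DihedralGroup T) : mobius P.ω α ((0 : ℂ) : OnePoint ℂ) = (0 : ℂ) := by
  rcases α with i | i
  · exact congrArg ((↑) : ℂ → OnePoint ℂ) (mul_zero (P.ω ^ i.val))
  · refine congrArg ((↑) : ℂ → OnePoint ℂ) ?_
    change conj (P.ω ^ i.val * 0) = 0
    rw [mul_zero, map_zero]

theorem mobius_infty (α : DihedralGroup T) : mobius P.ω α OnePoint.infty = OnePoint.infty := by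
  rcases α with i | i <;> rfl

theorem E_zero (p : ℕ) (Y : Aff P) : E P (0 : ℂ) p Y = emb P (0 : ℂ) p Y := by
  by_cases h : P.level ((0 : ℂ) : OnePoint ℂ) ≠ 0
  · rw [E_marked h]
  · rw [not_not] at h
    rw [emb_of_not_valid fun hv => by have := hv.1; omega, E_of_level (by omega)]
    change P.level ((conj (0 : ℂ) : ℂ) : OnePoint ℂ) ≤ p
    rw [map_zero, h]
    exact Nat.zero_le _

theorem E_infty (p : ℕ) (Y : Aff P) : E P OnePoint.infty p Y = emb P OnePoint.infty p Y :=
  E_marked P.level_infty p Y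

theorem avgRot_of_fixed {x : OnePoint ℂ} (h : ∀ α : DihedralGroup T, mobius P.ω α x = x) (p : ℕ)
    (X : Aff P) : avgRot P x p X = (T : ℂ)⁻¹ • ∑ k, Aff.hat P x p (.r k) X := by
  have : rots P x = Finset.univ := by
    ext i
    simp [mem_rots, h]
  rw [avgRot, rotCard_eq, this, Finset.card_univ, ZMod.card]

theorem emb_lie_of_fixed {x : OnePoint ℂ} (h : ∀ α : DihedralGroup T, mobius P.ω α x = x) {p q : ℕ}
    (h' : x = OnePoint.infty → p ≠ 0 ∧ q ≠ 0) (X Y : Aff P) :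
    ⁅emb P x p X, emb P x q Y⁆ =
      (T : ℂ)⁻¹ • ∑ k, emb P x (p + q) ⁅X, Aff.hat P x q (.r k) Y⁆ := by
  rw [← lie_skew, emb_lie fun hx => (h' hx).symm, add_comm, ← embL_apply, ← map_neg, lie_skew,
    avgRot_of_fixed h, lie_smul, lie_sum, map_smul, map_sum]
  rfl

/-- At a fixed point the modes are equivariant under the twisted action of the rotations. -/
theorem emb_hat {x : OnePoint ℂ} (h : ∀ α : DihedralGroup T, mobius P.ω α x = x) (p : ℕ)
    (k : ZMod T) (X : Aff P) : emb P x p (Aff.hat P x p (.r k) X) = emb P x p X := by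
  have h2 : refls P x = Finset.univ := by
    ext i
    simp [mem_refls, h]
  refine gDC_ext ?_ ?_
  · rw [phi_emb, phi_emb, avgRot_of_fixed h, avgRot_of_fixed h]
    congr 2
    simp_rw [← Aff.hat_mul, DihedralGroup.r_mul_r]
    exact Fintype.sum_equiv (Equiv.addRight k) _ _ fun i => rfl
  · rw [phi_conj_emb, phi_conj_emb, avgRefl, avgRefl, h2]
    congr 2
    simp_rw [← Aff.hat_mul, DihedralGroup.sr_mul_r]
    exact Fintype.sum_equiv (Equiv.addRight k) _ _ fun i => rfl

theorem hat_zero (p : ℕ) (k : ZMod T) (X : Aff P) :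
    Aff.hat P (0 : ℂ) p (.r k) X = ((om P k)⁻¹ ^ p) • sg P k X := by
  change (Aff.gen P (0 : ℂ) p ^ k.val) X = _
  rw [Aff.gen, smul_pow, LinearMap.smul_apply, DihedralGaudin.wt,
    if_neg (OnePoint.coe_ne_infty 0), om, sg, ← pow_mul, ← inv_pow, ← pow_mul, mul_comm]

theorem hat_infty (p : ℕ) (k : ZMod T) (X : Aff P) :
    Aff.hat P OnePoint.infty p (.r k) X = (om P k ^ p) • sg P k X := by
  change (Aff.gen P OnePoint.infty p ^ k.val) X = _
  rw [Aff.gen, smul_pow, LinearMap.smul_apply, DihedralGaudin.wt,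
    if_pos rfl, om, sg, ← pow_mul, ← pow_mul, mul_comm]

theorem E_zero_sg (p : ℕ) (k : ZMod T) (X : Aff P) :
    E P (0 : ℂ) p (sg P k X) = om P k ^ p • E P (0 : ℂ) p X := by
  have h := emb_hat (P := P) mobius_zero p k X
  rw [hat_zero, ← E_zero, ← E_zero, map_smul] at h
  rw [← h, smul_smul, ← mul_pow, mul_inv_cancel₀ (om_ne_zero k), one_pow, one_smul]

theorem E_infty_sg (p : ℕ) (k : ZMod T) (X : Aff P) :
    E P OnePoint.infty p (sg P k X) = (om P k)⁻¹ ^ p • E P OnePoint.infty p X := by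
  have h := emb_hat (P := P) mobius_infty p k X
  rw [hat_infty, ← E_infty, ← E_infty, map_smul] at h
  rw [← h, smul_smul, ← mul_pow, inv_mul_cancel₀ (om_ne_zero k), one_pow, one_smul]

/-- At the origin the Takiff relations are averaged over the cyclic group. -/
theorem E_zero_lie (p q : ℕ) (X Y : Aff P) :
    ⁅E P (0 : ℂ) p X, E P (0 : ℂ) q Y⁆ =
      (T : ℂ)⁻¹ • ∑ k, (om P k)⁻¹ ^ q • E P (0 : ℂ) (p + q) ⁅X, sg P k Y⁆ := by
  rw [E_zero, E_zero, emb_lie_of_fixed mobius_zero fun h => absurd h (OnePoint.coe_ne_infty 0)]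
  simp only [← E_zero, hat_zero, lie_smul, map_smul]

/-- At infinity the Takiff relations are averaged over the cyclic group, with the opposite weight.
-/
theorem E_infty_lie (p q : ℕ) (X Y : Aff P) :
    ⁅E P OnePoint.infty (p + 1) X, E P OnePoint.infty (q + 1) Y⁆ =
      (T : ℂ)⁻¹ • ∑ k, om P k ^ (q + 1) • E P OnePoint.infty (p + q + 2) ⁅X, sg P k Y⁆ := by
  rw [E_infty, E_infty, emb_lie_of_fixed mobius_infty fun _ => ⟨by omega, by omega⟩]
  simp only [← E_infty, hat_infty, lie_smul, map_smul]
  rw [show p + 1 + (q + 1) = p + q + 2 by omega]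

end Commutators

/-! ### Partial fractions -/

section PartialFractions

variable {W : Type*} [AddCommGroup W] [Module ℂ W]

/-- summation along the antidiagonals of a double sum which is supported in degrees less than `N` -/
theorem sum_sum_eq_antidiagonal {N M : ℕ} (h : N ≤ M) (f : ℕ → ℕ → ℂ) {e : ℕ → W}
    (he : ∀ n, N ≤ n → e n = 0) :
    ∑ p ∈ Finset.range M, ∑ s ∈ Finset.range N, f p s • e (p + s) =
      ∑ n ∈ Finset.range N, (∑ x ∈ Finset.HasAntidiagonal.antidiagonal n, f x.1 x.2) • e n := by
  simp only [Finset.sum_smul]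
  rw [Finset.sum_sigma', Finset.sum_sigma']
  refine Finset.sum_bij_ne_zero (fun a _ _ => ⟨a.1 + a.2, (a.1, a.2)⟩) ?_ ?_ ?_ ?_
  · rintro ⟨p, s⟩ _ h0
    rw [Finset.mem_sigma, Finset.mem_range, Finset.HasAntidiagonal.mem_antidiagonal]
    refine ⟨?_, rfl⟩
    by_contra hc
    exact h0 (by dsimp only; rw [he _ (not_lt.mp hc), smul_zero])
  · rintro ⟨p, s⟩ _ _ ⟨p', s'⟩ _ _ h1
    simp only [Sigma.mk.injEq, heq_eq_eq, Prod.mk.injEq] at h1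
    rw [h1.2.1, h1.2.2]
  · rintro ⟨n, ⟨p, s⟩⟩ h1 h2
    rw [Finset.mem_sigma, Finset.mem_range, Finset.HasAntidiagonal.mem_antidiagonal] at h1
    obtain ⟨h3, h4⟩ := h1
    dsimp only at h3 h4 h2
    subst h4
    refine ⟨⟨p, s⟩, ?_, h2, rfl⟩
    rw [Finset.mem_sigma, Finset.mem_range, Finset.mem_range]
    exact ⟨by dsimp only; omega, by dsimp only; omega⟩
  · rintro ⟨p, s⟩ _ _
    rfl

theorem antidiagonal_geom (a b : ℂ) (n : ℕ) :
    (a - b) * ∑ x ∈ Finset.HasAntidiagonal.antidiagonal n, a ^ x.1 * b ^ x.2 =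
      a ^ (n + 1) - b ^ (n + 1) := by
  rw [Finset.Nat.sum_antidiagonal_eq_sum_range_succ (fun i j => a ^ i * b ^ j), mul_comm]
  exact geom_sum₂_mul a b (n + 1)

/-- the difference quotient of a polar part -/
theorem polar_difference {N M : ℕ} (h : N ≤ M) {e : ℕ → W} (he : ∀ n, N ≤ n → e n = 0)
    {x z w : ℂ} (hz : z ≠ x) (hw : w ≠ x) (hzw : z ≠ w) :
    ∑ p ∈ Finset.range M, ∑ s ∈ Finset.range N,
      (1 / (z - x) ^ (p + 1) * (1 / (w - x) ^ (s + 1))) • e (p + s) =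
    (1 / (w - z)) • ∑ n ∈ Finset.range N,
      (1 / (z - x) ^ (n + 1) - 1 / (w - x) ^ (n + 1)) • e n := by
  rw [sum_sum_eq_antidiagonal h _ he, Finset.smul_sum]
  refine Finset.sum_congr rfl fun n _ => ?_
  rw [smul_smul]
  congr 1
  have hz' := sub_ne_zero.mpr hz
  have hw' := sub_ne_zero.mpr hw
  have hzw' : w - z ≠ 0 := sub_ne_zero.mpr hzw.symm
  have h1 := antidiagonal_geom (1 / (z - x)) (1 / (w - x)) n
  have h2 : 1 / (z - x) - 1 / (w - x) = (w - z) * (1 / (z - x) * (1 / (w - x))) := by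
    field_simp
    ring
  have h3 : ∑ y ∈ Finset.HasAntidiagonal.antidiagonal n,
      1 / (z - x) ^ (y.1 + 1) * (1 / (w - x) ^ (y.2 + 1)) = 1 / (z - x) * (1 / (w - x)) *
        ∑ y ∈ Finset.HasAntidiagonal.antidiagonal n, (1 / (z - x)) ^ y.1 * (1 / (w - x)) ^ y.2 := by
    rw [Finset.mul_sum]
    refine Finset.sum_congr rfl fun y _ => ?_
    rw [one_div_pow, one_div_pow, pow_succ, pow_succ]
    field_simp
  rw [h2, one_div_pow, one_div_pow] at h1
  rw [h3, ← h1]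
  field_simp

/-- the difference quotient of a polynomial -/
theorem polynomial_difference {N M : ℕ} (h : N ≤ M) {e : ℕ → W} (he : ∀ n, N ≤ n → e n = 0)
    {z w : ℂ} (hzw : z ≠ w) :
    ∑ p ∈ Finset.range M, ∑ s ∈ Finset.range N, (z ^ p * w ^ s) • e (p + s + 1) =
    (1 / (z - w)) • ∑ n ∈ Finset.range N, (z ^ n - w ^ n) • e n := by
  have hzw' : z - w ≠ 0 := sub_ne_zero.mpr hzw
  rw [sum_sum_eq_antidiagonal h (fun p s => z ^ p * w ^ s) (e := fun n => e (n + 1))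
    fun n hn => he _ (by omega)]
  have h1 : ∑ n ∈ Finset.range N, (z ^ n - w ^ n) • e n =
      ∑ n ∈ Finset.range N, (z ^ (n + 1) - w ^ (n + 1)) • e (n + 1) := by
    have h2 := Finset.sum_range_succ (fun n => (z ^ n - w ^ n) • e n) N
    rw [Finset.sum_range_succ', he N le_rfl, smul_zero, add_zero, pow_zero, pow_zero,
      sub_self, zero_smul, add_zero] at h2
    exact h2.symm
  rw [h1, Finset.smul_sum]
  refine Finset.sum_congr rfl fun n _ => ?_
  rw [← antidiagonal_geom, smul_smul, ← mul_assoc, one_div_mul_cancel hzw', one_mul]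

/-- the polar part at the pole of `u` of `u ^ (p + 1) * v ^ (q + 1)`, where `u * v = d * (u - v)`,
as is the case for `u = 1 / (z - x)`, `v = 1 / (z - y)` and `d = 1 / (x - y)` -/
def polar (d u : ℂ) (p q : ℕ) : ℂ :=
  ∑ s ∈ Finset.range (p + 1), (-1) ^ s * ((q + s).choose s : ℂ) * d ^ (q + s + 1) * u ^ (p - s + 1)

theorem polar_succ_succ (d u : ℂ) (p q : ℕ) :
    polar d u (p + 1) (q + 1) = d * (polar d u (p + 1) q - polar d u p (q + 1)) := by
  rw [polar, polar, polar, Finset.sum_range_succ', Finset.sum_range_succ' _ (p + 1)]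
  have h : ∀ s ∈ Finset.range (p + 1),
      (-1 : ℂ) ^ (s + 1) * ((q + 1 + (s + 1)).choose (s + 1) : ℂ) * d ^ (q + 1 + (s + 1) + 1) *
          u ^ (p + 1 - (s + 1) + 1) =
        d * ((-1) ^ (s + 1) * ((q + (s + 1)).choose (s + 1) : ℂ) * d ^ (q + (s + 1) + 1) *
          u ^ (p + 1 - (s + 1) + 1)) -
        d * ((-1) ^ s * ((q + 1 + s).choose s : ℂ) * d ^ (q + 1 + s + 1) * u ^ (p - s + 1)) := by
    intro s _
    have h1 : (q + 1 + (s + 1)).choose (s + 1) =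
        (q + 1 + s).choose s + (q + (s + 1)).choose (s + 1) := by
      rw [show q + 1 + (s + 1) = q + 1 + s + 1 by omega, Nat.choose_succ_succ,
        show q + 1 + s = q + (s + 1) by omega]
    rw [h1, Nat.add_sub_add_right]
    push_cast
    ring
  rw [Finset.sum_congr rfl h, Finset.sum_sub_distrib, ← Finset.mul_sum, ← Finset.mul_sum]
  simp
  ring

theorem polar_succ_zero (d u : ℂ) (p : ℕ) :
    polar d u (p + 1) 0 = d * (u ^ (p + 2) - polar d u p 0) := by
  rw [polar, polar, Finset.sum_range_succ', mul_sub, Finset.mul_sum]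
  have h : ∀ s ∈ Finset.range (p + 1),
      (-1 : ℂ) ^ (s + 1) * ((0 + (s + 1)).choose (s + 1) : ℂ) * d ^ (0 + (s + 1) + 1) *
          u ^ (p + 1 - (s + 1) + 1) =
        -(d * ((-1) ^ s * ((0 + s).choose s : ℂ) * d ^ (0 + s + 1) * u ^ (p - s + 1))) := by
    intro s _
    rw [Nat.add_sub_add_right, zero_add, zero_add, Nat.choose_self, Nat.choose_self]
    ring
  rw [Finset.sum_congr rfl h, Finset.sum_neg_distrib]
  simp
  ring

theorem polar_zero_succ (d u : ℂ) (q : ℕ) : polar d u 0 (q + 1) = d * polar d u 0 q := by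
  simp [polar]
  ring

/-- The partial fraction expansion of `u ^ (p + 1) * v ^ (q + 1)` for `u = 1 / (z - x)` and `v = 1 /
(z - y)`, where `d = 1 / (x - y)`. -/
theorem polar_add_polar {d u v : ℂ} (h : u * v = d * (u - v)) (p q : ℕ) :
    u ^ (p + 1) * v ^ (q + 1) = polar d u p q + polar (-d) v q p := by
  induction p generalizing q with
  | zero =>
    induction q with
    | zero => simp [polar]; linear_combination h
    | succ q ih =>
      rw [polar_zero_succ, polar_succ_zero]
      linear_combination v ^ (q + 1) * h + d * ih
  | succ p ihp =>
    induction q with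
    | zero =>
      rw [polar_zero_succ, polar_succ_zero]
      linear_combination u ^ (p + 1) * h - d * ihp 0
    | succ q ihq =>
      rw [polar_succ_succ, polar_succ_succ]
      linear_combination u ^ (p + 1) * v ^ (q + 1) * h + d * ihq - d * ihp (q + 1)

/-- The partial fraction expansion of `z ^ q * u ^ (p + 1)` for `u = 1 / (z - a)`. -/
theorem polar_polynomial {a u z : ℂ} (h : z * u = 1 + a * u) (p q : ℕ) :
    z ^ q * u ^ (p + 1) =
      ∑ s ∈ Finset.range (p + 1), (q.choose s : ℂ) * a ^ (q - s) * u ^ (p - s + 1) +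
      ∑ s ∈ Finset.range q, (s.choose p : ℂ) * a ^ (s - p) * z ^ (q - 1 - s) := by
  induction q generalizing p with
  | zero =>
    rw [Finset.sum_range_succ', Finset.sum_eq_zero fun s _ => by simp]
    simp
  | succ q ih =>
    have hz : z ^ (q + 1) * u ^ (p + 1) = z ^ q * u ^ p + a * (z ^ q * u ^ (p + 1)) := by
      linear_combination z ^ q * u ^ p * h
    cases p with
    | zero =>
      have h1 : ∀ s ∈ Finset.range q,
          ((s + 1).choose 0 : ℂ) * a ^ (s + 1 - 0) * z ^ (q + 1 - 1 - (s + 1)) =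
          a * ((s.choose 0 : ℂ) * a ^ (s - 0) * z ^ (q - 1 - s)) := by
        intro s _
        rw [show q + 1 - 1 - (s + 1) = q - 1 - s by omega, Nat.choose_zero_right,
          Nat.choose_zero_right, Nat.sub_zero, Nat.sub_zero]
        ring
      rw [hz, ih, Finset.sum_range_succ' _ q, Finset.sum_congr rfl h1, ← Finset.mul_sum]
      simp
      ring
    | succ p =>
      rw [hz, ih p, ih (p + 1), Finset.sum_range_succ' _ q, Finset.sum_range_succ' _ (p + 1),
        Finset.sum_range_succ' _ (p + 1), mul_add, mul_add, Finset.mul_sum, Finset.mul_sum]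
      have h1 : ∀ s ∈ Finset.range (p + 1),
          ((q + 1).choose (s + 1) : ℂ) * a ^ (q + 1 - (s + 1)) * u ^ (p + 1 - (s + 1) + 1) =
          (q.choose s : ℂ) * a ^ (q - s) * u ^ (p - s + 1) +
          a * ((q.choose (s + 1) : ℂ) * a ^ (q - (s + 1)) * u ^ (p + 1 - (s + 1) + 1)) := by
        intro s _
        rw [Nat.choose_succ_succ, Nat.add_sub_add_right, Nat.add_sub_add_right]
        rcases Nat.lt_or_ge s q with hs | hs
        · obtain ⟨r, rfl⟩ := Nat.exists_eq_add_of_lt hs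
          rw [show s + r + 1 - s = r + 1 by omega, show s + r + 1 - (s + 1) = r by omega]
          push_cast
          ring
        · rw [Nat.choose_eq_zero_of_lt (n := q) (k := s + 1) (by omega)]
          push_cast
          ring
      have h2 : ∀ s ∈ Finset.range q,
          ((s + 1).choose (p + 1) : ℂ) * a ^ (s + 1 - (p + 1)) * z ^ (q + 1 - 1 - (s + 1)) =
          (s.choose p : ℂ) * a ^ (s - p) * z ^ (q - 1 - s) +
          a * ((s.choose (p + 1) : ℂ) * a ^ (s - (p + 1)) * z ^ (q - 1 - s)) := by
        intro s _
        rw [Nat.choose_succ_succ, Nat.add_sub_add_right,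
          show q + 1 - 1 - (s + 1) = q - 1 - s by omega]
        rcases Nat.lt_or_ge p s with hs | hs
        · obtain ⟨r, rfl⟩ := Nat.exists_eq_add_of_lt hs
          rw [show p + r + 1 - p = r + 1 by omega, show p + r + 1 - (p + 1) = r by omega]
          push_cast
          ring
        · rw [Nat.choose_eq_zero_of_lt (n := s) (k := p + 1) (by omega)]
          push_cast
          ring
      rw [Finset.sum_congr rfl h1, Finset.sum_congr rfl h2, Finset.sum_add_distrib,
        Finset.sum_add_distrib]
      simp
      ring

/-- the expansion of a product of two polar parts at distinct points -/
theorem polar_mul_polar {N M : ℕ} (hNM : N ≤ M) {g : ℕ → ℕ → W}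
    (hp : ∀ p q, N ≤ p → g p q = 0) (hq : ∀ p q, N ≤ q → g p q = 0) {d u v : ℂ}
    (h : u * v = d * (u - v)) :
    ∑ p ∈ Finset.range N, ∑ q ∈ Finset.range N, (u ^ (p + 1) * v ^ (q + 1)) • g p q =
      ∑ p ∈ Finset.range M, u ^ (p + 1) • ∑ q ∈ Finset.range N, ∑ s ∈ Finset.range N,
        ((-1) ^ s * ((q + s).choose s : ℂ) * d ^ (q + s + 1)) • g (p + s) q +
      ∑ q ∈ Finset.range M, v ^ (q + 1) • ∑ p ∈ Finset.range N, ∑ s ∈ Finset.range N,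
        ((-1) ^ s * ((p + s).choose s : ℂ) * (-d) ^ (p + s + 1)) • g p (q + s) := by
  have key : ∀ (d u : ℂ) (q : ℕ) (e : ℕ → W), (∀ n, N ≤ n → e n = 0) →
      ∑ p ∈ Finset.range N, polar d u p q • e p =
        ∑ p ∈ Finset.range M, u ^ (p + 1) • ∑ s ∈ Finset.range N,
          ((-1) ^ s * ((q + s).choose s : ℂ) * d ^ (q + s + 1)) • e (p + s) := by
    intro d u q e he
    simp only [Finset.smul_sum, smul_smul]
    rw [sum_sum_eq_antidiagonal hNM (fun p s => u ^ (p + 1) *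
      ((-1) ^ s * ((q + s).choose s : ℂ) * d ^ (q + s + 1))) he]
    refine Finset.sum_congr rfl fun p _ => ?_
    rw [← Finset.Nat.sum_antidiagonal_swap, Finset.Nat.sum_antidiagonal_eq_sum_range_succ_mk, polar]
    congr 1
    refine Finset.sum_congr rfl fun s _ => ?_
    simp only [Prod.fst_swap, Prod.snd_swap]
    ring
  simp only [polar_add_polar h, add_smul, Finset.sum_add_distrib]
  congr 1
  · rw [Finset.sum_comm]
    simp only [key d u _ _ fun n hn => hp n _ hn]
    rw [Finset.sum_comm]
    simp only [Finset.smul_sum]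
  · simp only [key (-d) v _ _ fun n hn => hq _ n hn]
    rw [Finset.sum_comm]
    simp only [Finset.smul_sum]

/-- the expansion of a product of a polar part and a polynomial -/
theorem polar_mul_polynomial {N M : ℕ} (hNM : N ≤ M) {g : ℕ → ℕ → W}
    (hp : ∀ p q, N ≤ p → g p q = 0) (hq : ∀ p q, N ≤ q → g p q = 0) {a u z : ℂ}
    (h : z * u = 1 + a * u) :
    ∑ p ∈ Finset.range N, ∑ q ∈ Finset.range N, (u ^ (p + 1) * z ^ q) • g p q =
      ∑ p ∈ Finset.range M, u ^ (p + 1) • ∑ q ∈ Finset.range N, ∑ s ∈ Finset.range N,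
        ((q.choose s : ℂ) * a ^ (q - s)) • g (p + s) q +
      ∑ m ∈ Finset.range M, z ^ m • ∑ p ∈ Finset.range N, ∑ s ∈ Finset.range N,
        ((s.choose p : ℂ) * a ^ (s - p)) • g p (m + s + 1) := by
  simp only [mul_comm (u ^ _), polar_polynomial h, add_smul, Finset.sum_add_distrib]
  congr 1
  · have key : ∀ (q : ℕ) (e : ℕ → W), (∀ n, N ≤ n → e n = 0) →
        ∑ p ∈ Finset.range N, (∑ s ∈ Finset.range (p + 1),
          (q.choose s : ℂ) * a ^ (q - s) * u ^ (p - s + 1)) • e p =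
        ∑ p ∈ Finset.range M, u ^ (p + 1) • ∑ s ∈ Finset.range N,
          ((q.choose s : ℂ) * a ^ (q - s)) • e (p + s) := by
      intro q e he
      simp only [Finset.smul_sum, smul_smul]
      rw [sum_sum_eq_antidiagonal hNM (fun p s => u ^ (p + 1) *
        ((q.choose s : ℂ) * a ^ (q - s))) he]
      refine Finset.sum_congr rfl fun p _ => ?_
      rw [← Finset.Nat.sum_antidiagonal_swap, Finset.Nat.sum_antidiagonal_eq_sum_range_succ_mk]
      congr 1
      refine Finset.sum_congr rfl fun s _ => ?_
      simp only [Prod.fst_swap, Prod.snd_swap]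
      ring
    rw [Finset.sum_comm]
    simp only [key _ _ fun n hn => hp n _ hn]
    rw [Finset.sum_comm]
    simp only [Finset.smul_sum]
  · have key : ∀ (p : ℕ) (e : ℕ → W), (∀ n, N ≤ n → e n = 0) →
        ∑ q ∈ Finset.range N, (∑ s ∈ Finset.range q,
          (s.choose p : ℂ) * a ^ (s - p) * z ^ (q - 1 - s)) • e q =
        ∑ m ∈ Finset.range M, z ^ m • ∑ s ∈ Finset.range N,
          ((s.choose p : ℂ) * a ^ (s - p)) • e (m + s + 1) := by
      intro p e he
      simp only [Finset.smul_sum, smul_smul]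
      rw [sum_sum_eq_antidiagonal hNM (fun m s => z ^ m *
        ((s.choose p : ℂ) * a ^ (s - p))) (e := fun n => e (n + 1)) fun n hn => he _ (by omega)]
      have h1 := Finset.sum_range_succ (fun q => (∑ s ∈ Finset.range q,
          (s.choose p : ℂ) * a ^ (s - p) * z ^ (q - 1 - s)) • e q) N
      rw [he N le_rfl, smul_zero, add_zero, Finset.sum_range_succ', Finset.range_zero,
        Finset.sum_empty, zero_smul, add_zero] at h1
      rw [← h1]
      refine Finset.sum_congr rfl fun q _ => ?_
      rw [← Finset.Nat.sum_antidiagonal_swap, Finset.Nat.sum_antidiagonal_eq_sum_range_succ_mk]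
      congr 1
      refine Finset.sum_congr rfl fun s _ => ?_
      simp only [Prod.fst_swap, Prod.snd_swap, Nat.add_sub_cancel]
      ring
    simp only [key _ _ fun n hn => hq _ n hn]
    rw [Finset.sum_comm]
    simp only [Finset.smul_sum]

open Polynomial in
/-- The scalar case of `partialFractions_unique`: clearing denominators reduces it to the uniqueness
of the expansion of a polynomial in powers of coprime factors. -/
theorem partialFractions_unique_complex {ι : Type*} [DecidableEq ι] {J : Finset ι} {a : ι → ℂ}
    (ha : Set.InjOn a J) {N : ℕ} {c : ι → ℕ → ℂ} {d : ℕ → ℂ} {Z : Set ℂ} (hZ : Z.Finite)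
    (h : ∀ z ∉ Z, (∀ j ∈ J, z ≠ a j) →
      ∑ j ∈ J, ∑ p ∈ Finset.range N, (1 / (z - a j) ^ (p + 1)) * c j p +
        ∑ q ∈ Finset.range N, z ^ q * d q = 0) :
    (∀ j ∈ J, ∀ p < N, c j p = 0) ∧ ∀ q < N, d q = 0 := by
  -- after multiplication by `(X - a i) ^ N` the pole of order `p + 1` has exponent `N - 1 - p`
  set r : (i : ι) → Fin N → ℂ[X] := fun i j => C (c i (N - 1 - j)) with hr
  set Q : ℂ[X] := ∑ q ∈ Finset.range N, C (d q) * X ^ q with hQ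
  have hpoly : Q * (∏ i ∈ J, (X - C (a i)) ^ N) +
      ∑ i ∈ J, ∑ j, r i j * (X - C (a i)) ^ j.1 * ∏ k ∈ J.erase i, (X - C (a k)) ^ N = 0 := by
    refine Polynomial.eq_zero_of_infinite_isRoot _ ?_
    refine Set.Infinite.mono (s := (Z ∪ (J.image a : Set ℂ))ᶜ) ?_
      ((hZ.union (Finset.finite_toSet _)).infinite_compl)
    intro z hz
    rw [Set.mem_compl_iff, Set.mem_union, not_or] at hz
    have hz2 : ∀ j ∈ J, z ≠ a j := fun j hj h' =>
      hz.2 (Finset.mem_coe.mpr (Finset.mem_image.mpr ⟨j, hj, h'.symm⟩))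
    have h1 := h z hz.1 hz2
    have h2 : ∀ i ∈ J, ∑ p ∈ Finset.range N, (1 / (z - a i) ^ (p + 1)) * c i p *
        ∏ k ∈ J, (z - a k) ^ N =
        ∑ j : Fin N, c i (N - 1 - j) * (z - a i) ^ j.1 * ∏ k ∈ J.erase i, (z - a k) ^ N := by
      intro i hi
      rw [← Finset.sum_range_reflect, Finset.sum_range]
      refine Finset.sum_congr rfl fun j _ => ?_
      have h3 : (z - a i) ^ N = (z - a i) ^ (N - 1 - j + 1) * (z - a i) ^ j.1 := by
        rw [← pow_add]
        congr 1
        have := j.2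
        omega
      have h4 : (z - a i) ^ (N - 1 - j + 1) ≠ 0 := pow_ne_zero _ (sub_ne_zero.mpr (hz2 i hi))
      rw [← Finset.mul_prod_erase J _ hi, h3]
      field_simp
    rw [Set.mem_ofPred_eq, Polynomial.IsRoot.def]
    simp only [hQ, hr, eval_add, eval_mul, eval_prod, eval_finsetSum, eval_pow, eval_sub, eval_X,
      eval_C]
    rw [← Finset.sum_congr rfl h2]
    simp only [← Finset.sum_mul]
    rw [← add_mul, add_comm]
    have h5 : (∑ q ∈ Finset.range N, d q * z ^ q) = ∑ q ∈ Finset.range N, z ^ q * d q :=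
      Finset.sum_congr rfl fun q _ => mul_comm _ _
    rw [h5, h1, zero_mul]
  have huniq := Polynomial.quo_mul_prod_pow_add_sum_rem_mul_prod_pow_unique (s := J)
    (g := fun i => X - C (a i)) (n := fun _ => N) (q₁ := Q) (q₂ := 0) (r₁ := r) (r₂ := fun _ _ => 0)
    (fun i _ => monic_X_sub_C _)
    (fun i hi j hj hij => isCoprime_X_sub_C_of_isUnit_sub
      (sub_ne_zero.mpr fun h' => hij (ha hi hj h')).isUnit)
    (fun i _ j => by
      rw [degree_X_sub_C]
      exact lt_of_le_of_lt degree_C_le (by norm_num))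
    (fun i _ j => by
      rw [degree_X_sub_C, degree_zero]
      exact WithBot.bot_lt_coe _)
    (by rw [hpoly]; simp)
  refine ⟨fun j hj p hp => ?_, fun q hq => ?_⟩
  · have h1 := congrFun (huniq.2 j hj) ⟨N - 1 - p, by omega⟩
    simp only [hr] at h1
    rw [show N - 1 - (N - 1 - p) = p by omega] at h1
    exact C_eq_zero.mp h1
  · have h1 := congrArg (fun f => coeff f q) huniq.1
    simp only [hQ, finsetSum_coeff, coeff_C_mul, coeff_X_pow, mul_ite, mul_one, mul_zero,
      Finset.sum_ite_eq, Finset.mem_range, hq, if_true, coeff_zero] at h1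
    exact h1

/-- uniqueness of partial fraction expansions with coefficients in a vector space -/
theorem partialFractions_unique {ι : Type*} [DecidableEq ι] {J : Finset ι} {a : ι → ℂ}
    (ha : Set.InjOn a J) {N : ℕ} {c : ι → ℕ → W} {d : ℕ → W} {Z : Set ℂ} (hZ : Z.Finite)
    (h : ∀ z ∉ Z, (∀ j ∈ J, z ≠ a j) →
      ∑ j ∈ J, ∑ p ∈ Finset.range N, (1 / (z - a j) ^ (p + 1)) • c j p +
        ∑ q ∈ Finset.range N, z ^ q • d q = 0) :
    (∀ j ∈ J, ∀ p < N, c j p = 0) ∧ ∀ q < N, d q = 0 := by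
  have key : ∀ f : Module.Dual ℂ W, (∀ j ∈ J, ∀ p < N, f (c j p) = 0) ∧ ∀ q < N, f (d q) = 0 := by
    intro f
    refine partialFractions_unique_complex ha hZ fun z hz hz' => ?_
    have h1 := congrArg f (h z hz hz')
    simpa only [map_add, map_sum, map_smul, smul_eq_mul, map_zero] using h1
  exact ⟨fun j hj p hp =>
      (Module.forall_dual_apply_eq_zero_iff ℂ _).mp fun f => (key f).1 j hj p hp,
    fun q hq => (Module.forall_dual_apply_eq_zero_iff ℂ _).mp fun f => (key f).2 q hq⟩

end PartialFractions

/-! ### Squares and difference quotients of rational functions -/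

section RationalFunctions

variable {V W : Type*} [AddCommGroup V] [Module ℂ V] [AddCommGroup W] [Module ℂ W]
variable {ι : Type*} [DecidableEq ι]

/-- The vector valued rational function with polar coefficients `B j p` at the points `a j` and
polynomial part `-∑ z ^ q C q`. -/
def ratFun (J : Finset ι) (a : ι → ℂ) (B : ι → ℕ → V) (C : ℕ → V) (N : ℕ) (z : ℂ) : V :=
  ∑ j ∈ J, ∑ p ∈ Finset.range N, (1 / (z - a j) ^ (p + 1)) • B j p -
    ∑ q ∈ Finset.range N, z ^ q • C q

/-- The square of a polynomial part, summed by degree. The bound `2 * N` leaves out no nonzero term,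
since `g` vanishes beyond `N` in each variable. -/
theorem sum_sum_pow_add {N : ℕ} (u : ℂ) {g : ℕ → ℕ → W}
    (hp : ∀ p q, N ≤ p → g p q = 0) (hq : ∀ p q, N ≤ q → g p q = 0) :
    ∑ p ∈ Finset.range N, ∑ q ∈ Finset.range N, u ^ (p + q) • g p q =
      ∑ n ∈ Finset.range (2 * N), u ^ n • ∑ p ∈ Finset.range (n + 1), g p (n - p) := by
  simp only [← Finset.Nat.sum_antidiagonal_eq_sum_range_succ g, Finset.smul_sum]
  rw [Finset.sum_sigma', Finset.sum_sigma']
  refine Finset.sum_bij_ne_zero (fun a _ _ => ⟨a.1 + a.2, (a.1, a.2)⟩) ?_ ?_ ?_ ?_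
  · rintro ⟨p, s⟩ h _
    rw [Finset.mem_sigma, Finset.mem_range, Finset.mem_range] at h
    rw [Finset.mem_sigma, Finset.mem_range, Finset.HasAntidiagonal.mem_antidiagonal]
    dsimp only at h ⊢
    exact ⟨by omega, rfl⟩
  · rintro ⟨p, s⟩ _ _ ⟨p', s'⟩ _ _ h1
    simp only [Sigma.mk.injEq, heq_eq_eq, Prod.mk.injEq] at h1
    rw [h1.2.1, h1.2.2]
  · rintro ⟨n, ⟨p, s⟩⟩ h1 h2
    rw [Finset.mem_sigma, Finset.mem_range, Finset.HasAntidiagonal.mem_antidiagonal] at h1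
    obtain ⟨h3, h4⟩ := h1
    dsimp only at h3 h4 h2
    subst h4
    refine ⟨⟨p, s⟩, ?_, h2, rfl⟩
    rw [Finset.mem_sigma, Finset.mem_range, Finset.mem_range]
    dsimp only
    constructor
    · by_contra hc
      exact h2 (by rw [hp _ _ (not_lt.mp hc), smul_zero])
    · by_contra hc
      exact h2 (by rw [hq _ _ (not_lt.mp hc), smul_zero])
  · rintro ⟨p, s⟩ _ _
    rfl

/-- The square of a polar part, summed by the order of the pole. -/
theorem sum_sum_pow_add_two {N : ℕ} (u : ℂ) {g : ℕ → ℕ → W}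
    (hp : ∀ p q, N ≤ p → g p q = 0) (hq : ∀ p q, N ≤ q → g p q = 0) :
    ∑ p ∈ Finset.range N, ∑ q ∈ Finset.range N, (u ^ (p + 1) * u ^ (q + 1)) • g p q =
      ∑ n ∈ Finset.range (2 * N), u ^ (n + 1) • ∑ p ∈ Finset.range n, g p (n - p - 1) := by
  have h1 : ∀ p q, (u ^ (p + 1) * u ^ (q + 1)) • g p q = u ^ 2 • u ^ (p + q) • g p q := by
    intro p q
    rw [smul_smul]
    congr 1
    ring
  simp only [h1, ← Finset.smul_sum]
  rw [sum_sum_pow_add u hp hq, Finset.smul_sum]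
  have h2 := Finset.sum_range_succ
    (fun n => u ^ (n + 1) • ∑ p ∈ Finset.range n, g p (n - p - 1)) (2 * N)
  have h3 : ∑ p ∈ Finset.range (2 * N), g p (2 * N - p - 1) = 0 := by
    refine Finset.sum_eq_zero fun p _ => ?_
    rcases Nat.lt_or_ge p N with h | h
    · exact hq _ _ (by omega)
    · exact hp _ _ h
  rw [h3, smul_zero, add_zero, Finset.sum_range_succ', Finset.range_zero, Finset.sum_empty,
    smul_zero, add_zero] at h2
  rw [← h2]
  refine Finset.sum_congr rfl fun n _ => ?_
  rw [smul_smul]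
  congr 1
  · ring
  · refine Finset.sum_congr rfl fun p _ => ?_
    rw [show n + 1 - p - 1 = n - p by omega]

/-- the polar coefficients of half the square of a vector valued rational function -/
def squarePolar (β : V →ₗ[ℂ] V →ₗ[ℂ] W) (J : Finset ι) (a : ι → ℂ) (B : ι → ℕ → V) (C : ℕ → V)
    (N : ℕ) (j : ι) (p : ℕ) : W :=
  ∑ i ∈ J.erase j, ∑ q ∈ Finset.range N, ∑ s ∈ Finset.range N,
      ((-1) ^ s * ((q + s).choose s : ℂ) * (1 / (a j - a i)) ^ (q + s + 1)) •
        β (B j (p + s)) (B i q) -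
    ∑ q ∈ Finset.range N, ∑ s ∈ Finset.range N,
      ((q.choose s : ℂ) * a j ^ (q - s)) • β (B j (p + s)) (C q) +
    (1 / 2 : ℂ) • ∑ q ∈ Finset.range p, β (B j q) (B j (p - q - 1))

/-- the polynomial coefficients of half the square of a vector valued rational function -/
def squarePoly (β : V →ₗ[ℂ] V →ₗ[ℂ] W) (J : Finset ι) (a : ι → ℂ) (B : ι → ℕ → V) (C : ℕ → V)
    (N : ℕ) (q : ℕ) : W :=
  -(∑ j ∈ J, ∑ p ∈ Finset.range N, ∑ s ∈ Finset.range N,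
      ((s.choose p : ℂ) * a j ^ (s - p)) • β (B j p) (C (q + s + 1))) +
    (1 / 2 : ℂ) • ∑ p ∈ Finset.range (q + 1), β (C p) (C (q - p))

variable {β : V →ₗ[ℂ] V →ₗ[ℂ] W} {J : Finset ι} {a : ι → ℂ} {B : ι → ℕ → V} {C : ℕ → V} {N : ℕ}

theorem bilin_sum_smul_sum_smul (f g : ℕ → ℂ) (A D : ℕ → V) :
    β (∑ p ∈ Finset.range N, f p • A p) (∑ q ∈ Finset.range N, g q • D q) =
      ∑ p ∈ Finset.range N, ∑ q ∈ Finset.range N, (f p * g q) • β (A p) (D q) := by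
  simp only [map_sum, LinearMap.sum_apply, map_smul, LinearMap.smul_apply, Finset.smul_sum,
    mul_smul]
  rw [Finset.sum_comm]
  refine Finset.sum_congr rfl fun p _ => Finset.sum_congr rfl fun q _ => smul_comm _ _ _

/-- Partial fraction expansion of half the square of a vector valued rational function, with respect
to a symmetric bilinear map. -/
theorem half_square (hβ : ∀ x y, β x y = β y x) (ha : Set.InjOn a J)
    (hB : ∀ j p, N ≤ p → B j p = 0) (hC : ∀ q, N ≤ q → C q = 0) {z : ℂ}
    (hz : ∀ j ∈ J, z ≠ a j ∨ ∀ p, B j p = 0) :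
    (1 / 2 : ℂ) • β (ratFun J a B C N z) (ratFun J a B C N z) =
      ∑ j ∈ J, ∑ p ∈ Finset.range (2 * N), (1 / (z - a j) ^ (p + 1)) • squarePolar β J a B C N j p +
        ∑ q ∈ Finset.range (2 * N), z ^ q • squarePoly β J a B C N q := by
  have hN : N ≤ 2 * N := by omega
  have hβp : ∀ i (D : ℕ → V) p q, N ≤ p → β (B i p) (D q) = 0 := fun i D p q h => by
    rw [hB i p h, map_zero, LinearMap.zero_apply]
  have hβq : ∀ (D : ℕ → V), (∀ q, N ≤ q → D q = 0) → ∀ i p q, N ≤ q → β (B i p) (D q) = 0 :=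
    fun D hD i p q h => by rw [hD q h, map_zero]
  set b : ι → V := fun j => ∑ p ∈ Finset.range N, (1 / (z - a j) ^ (p + 1)) • B j p with hb
  set c : V := ∑ q ∈ Finset.range N, z ^ q • C q with hc
  set X : ι → ι → W := fun i j => ∑ p ∈ Finset.range (2 * N), (1 / (z - a i) ^ (p + 1)) •
    ∑ q ∈ Finset.range N, ∑ s ∈ Finset.range N,
      ((-1) ^ s * ((q + s).choose s : ℂ) * (1 / (a i - a j)) ^ (q + s + 1)) •
        β (B i (p + s)) (B j q) with hX
  set Y : ι → W := fun j => ∑ p ∈ Finset.range (2 * N), (1 / (z - a j) ^ (p + 1)) •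
    ∑ q ∈ Finset.range N, ∑ s ∈ Finset.range N,
      ((q.choose s : ℂ) * a j ^ (q - s)) • β (B j (p + s)) (C q) with hY
  set Y' : ι → W := fun j => ∑ m ∈ Finset.range (2 * N), z ^ m •
    ∑ p ∈ Finset.range N, ∑ s ∈ Finset.range N,
      ((s.choose p : ℂ) * a j ^ (s - p)) • β (B j p) (C (m + s + 1)) with hY'
  set U : ι → W := fun j => ∑ n ∈ Finset.range (2 * N), (1 / (z - a j) ^ (n + 1)) •
    ∑ q ∈ Finset.range n, β (B j q) (B j (n - q - 1)) with hU
  set U' : W := ∑ n ∈ Finset.range (2 * N), z ^ n •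
    ∑ p ∈ Finset.range (n + 1), β (C p) (C (n - p)) with hU'
  have e1 : ∀ i ∈ J, ∀ j ∈ J.erase i, β (b i) (b j) = X i j + X j i := by
    intro i hi j hj
    rw [Finset.mem_erase] at hj
    have hij : a i ≠ a j := fun h => hj.1 (ha hj.2 hi h.symm)
    by_cases h0 : (∀ p, B i p = 0) ∨ ∀ p, B j p = 0
    · rcases h0 with h0 | h0 <;> simp [hb, hX, h0]
    · rw [not_or] at h0
      have hzi := sub_ne_zero.mpr ((hz i hi).resolve_right h0.1)
      have hzj := sub_ne_zero.mpr ((hz j hj.2).resolve_right h0.2)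
      have hij' := sub_ne_zero.mpr hij
      have h := polar_mul_polar (d := 1 / (a i - a j)) (u := 1 / (z - a i)) (v := 1 / (z - a j)) hN
        (hβp i (B j)) (hβq (B j) (hB j) i) (by field_simp; ring)
      have hd : -(1 / (a i - a j)) = 1 / (a j - a i) := by
        rw [← one_div_neg_eq_neg_one_div, neg_sub]
      rw [hd] at h
      simp only [hb, bilin_sum_smul_sum_smul, hX]
      simp only [one_div_pow] at h ⊢
      rw [h]
      simp only [hβ (B j _) (B i _)]
  have e2 : ∀ i ∈ J, β (b i) (b i) = U i := by
    intro i _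
    simp only [hb, bilin_sum_smul_sum_smul, hU, ← one_div_pow]
    exact sum_sum_pow_add_two _ (hβp i (B i)) (hβq (B i) (hB i) i)
  have e3 : ∀ i ∈ J, β (b i) c = Y i + Y' i := by
    intro i hi
    rcases hz i hi with h0 | h0
    · have hzi := sub_ne_zero.mpr h0
      have h := polar_mul_polynomial (a := a i) (u := 1 / (z - a i)) (z := z) hN
        (hβp i C) (hβq C hC i) (by field_simp; ring)
      simp only [hb, hc, bilin_sum_smul_sum_smul, hY, hY']
      simp only [one_div_pow] at h ⊢
      rw [h]
    · simp [hb, hY, hY', h0]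
  have e4 : β c c = U' := by
    simp only [hc, hU', bilin_sum_smul_sum_smul, ← pow_add]
    exact sum_sum_pow_add _ (fun p q h => by rw [hC p h, map_zero, LinearMap.zero_apply])
      (fun p q h => by rw [hC q h, map_zero])
  have e5 : ∑ i ∈ J, ∑ j ∈ J, β (b i) (b j) =
      ∑ i ∈ J, U i + (2 : ℂ) • ∑ i ∈ J, ∑ j ∈ J.erase i, X i j := by
    have h1 : ∀ i ∈ J, ∑ j ∈ J, β (b i) (b j) =
        U i + (∑ j ∈ J.erase i, X i j + ∑ j ∈ J.erase i, X j i) := by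
      intro i hi
      rw [← Finset.add_sum_erase J _ hi, e2 i hi, Finset.sum_congr rfl (e1 i hi),
        Finset.sum_add_distrib]
    have h2 : ∑ i ∈ J, ∑ j ∈ J.erase i, X j i = ∑ i ∈ J, ∑ j ∈ J.erase i, X i j := by
      refine Finset.sum_comm' fun i j => ?_
      simp only [Finset.mem_erase]
      tauto
    rw [Finset.sum_congr rfl h1, Finset.sum_add_distrib, Finset.sum_add_distrib, h2, two_smul]
  have e6 : β (ratFun J a B C N z) (ratFun J a B C N z) =
      ∑ i ∈ J, ∑ j ∈ J, β (b i) (b j) - (2 : ℂ) • ∑ i ∈ J, β (b i) c + β c c := by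
    have h1 : ratFun J a B C N z = ∑ j ∈ J, b j - c := rfl
    have h2 : β c (∑ j ∈ J, b j) = ∑ i ∈ J, β (b i) c := by
      rw [hβ]; simp
    rw [h1]
    simp only [map_sub, LinearMap.sub_apply]
    rw [h2]
    simp only [map_sum, LinearMap.sum_apply]
    rw [Finset.sum_comm, two_smul]
    abel
  rw [e6, e5, e4, Finset.sum_congr rfl e3, Finset.sum_add_distrib]
  have e7 : ∑ j ∈ J, ∑ p ∈ Finset.range (2 * N), (1 / (z - a j) ^ (p + 1)) •
      squarePolar β J a B C N j p = ∑ i ∈ J, ∑ j ∈ J.erase i, X i j - ∑ j ∈ J, Y j +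
        (1 / 2 : ℂ) • ∑ j ∈ J, U j := by
    rw [Finset.smul_sum, ← Finset.sum_sub_distrib, ← Finset.sum_add_distrib]
    refine Finset.sum_congr rfl fun j _ => ?_
    simp only [hX, hY, hU, squarePolar]
    rw [Finset.sum_comm, Finset.smul_sum, ← Finset.sum_sub_distrib, ← Finset.sum_add_distrib]
    refine Finset.sum_congr rfl fun p _ => ?_
    rw [smul_add, smul_sub, Finset.smul_sum, smul_comm (1 / 2 : ℂ)]
  have e8 : ∑ q ∈ Finset.range (2 * N), z ^ q • squarePoly β J a B C N q =
      - ∑ j ∈ J, Y' j + (1 / 2 : ℂ) • U' := by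
    simp only [hY', hU', squarePoly]
    rw [Finset.sum_comm, Finset.smul_sum, ← Finset.sum_neg_distrib, ← Finset.sum_add_distrib]
    refine Finset.sum_congr rfl fun p _ => ?_
    rw [smul_add, smul_neg, Finset.smul_sum, smul_comm (1 / 2 : ℂ)]
  rw [e7, e8]
  module

/-- Expansion of the difference quotient of a vector valued rational function. -/
theorem ratFun_difference (hB : ∀ j p, N ≤ p → B j p = 0) (hC : ∀ q, N ≤ q → C q = 0) {w ζ : ℂ}
    (hw : ∀ j ∈ J, w ≠ a j ∨ ∀ p, B j p = 0) (hζ : ∀ j ∈ J, ζ ≠ a j ∨ ∀ p, B j p = 0)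
    (hwζ : w ≠ ζ) {M : ℕ} (hM : N ≤ M) :
    (1 / (ζ - w)) • (ratFun J a B C N w - ratFun J a B C N ζ) =
      ∑ j ∈ J, ∑ p ∈ Finset.range M, (1 / (w - a j) ^ (p + 1)) •
          ∑ s ∈ Finset.range N, (1 / (ζ - a j) ^ (s + 1)) • B j (p + s) +
        ∑ q ∈ Finset.range M, w ^ q • ∑ s ∈ Finset.range N, ζ ^ s • C (q + s + 1) := by
  have e1 : ∀ j ∈ J, ∑ p ∈ Finset.range M, (1 / (w - a j) ^ (p + 1)) •
      ∑ s ∈ Finset.range N, (1 / (ζ - a j) ^ (s + 1)) • B j (p + s) =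
      (1 / (ζ - w)) • ∑ n ∈ Finset.range N,
        (1 / (w - a j) ^ (n + 1) - 1 / (ζ - a j) ^ (n + 1)) • B j n := by
    intro j hj
    by_cases h0 : ∀ p, B j p = 0
    · simp [h0]
    · simp only [Finset.smul_sum (r := 1 / (w - a j) ^ _), smul_smul (1 / (w - a j) ^ _)]
      exact polar_difference hM (hB j) ((hw j hj).resolve_right h0) ((hζ j hj).resolve_right h0) hwζ
  have e2 : ∑ q ∈ Finset.range M, w ^ q • ∑ s ∈ Finset.range N, ζ ^ s • C (q + s + 1) =
      (1 / (w - ζ)) • ∑ n ∈ Finset.range N, (w ^ n - ζ ^ n) • C n := by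
    simp only [Finset.smul_sum (r := w ^ _), smul_smul (w ^ _)]
    exact polynomial_difference hM hC hwζ
  rw [Finset.sum_congr rfl e1, e2, ratFun, ratFun]
  have e3 : 1 / (w - ζ) = -(1 / (ζ - w)) := by
    rw [← one_div_neg_eq_neg_one_div, neg_sub]
  rw [e3, neg_smul, ← sub_eq_add_neg, ← Finset.smul_sum, ← smul_sub]
  congr 1
  simp only [sub_smul, Finset.sum_sub_distrib]
  abel

end RationalFunctions

/-! ### Brackets of the Lax matrix -/

section LaxBracket

variable [NeZero T] (P : DihedralGaudin T 𝔤)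

/-- the generating function `∑ (z - x) ^ (-p - 1) E^x_p` of the observables attached to `x` -/
def polarE (x z : ℂ) : Aff P →ₗ[ℂ] gDC P :=
  ∑ p ∈ Finset.range (bound P), (1 / (z - x) ^ (p + 1)) • E P x p

/-- the generating function `∑ z ^ q E^∞_{q + 1}` of the observables attached to infinity -/
def polyE (z : ℂ) : Aff P →ₗ[ℂ] gDC P :=
  ∑ q ∈ Finset.range (bound P), z ^ q • E P OnePoint.infty (q + 1)

variable {P}

theorem mem_pts' {x : ℂ} : x ∈ pts' P ↔ x ≠ 0 ∧ (x : OnePoint ℂ) ∈ pts P := by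
  rw [pts', Finset.mem_erase, Finset.mem_preimage]

theorem mobius_r_coe (k : ZMod T) (z : ℂ) :
    mobius P.ω (.r k) (z : OnePoint ℂ) = ((om P k * z : ℂ) : OnePoint ℂ) := rfl

theorem mobius_sr_coe (k : ZMod T) (z : ℂ) :
    mobius P.ω (.sr k) (z : OnePoint ℂ) = ((conj (om P k * z) : ℂ) : OnePoint ℂ) := rfl

theorem om_neg_mul_cancel (k : ZMod T) (z : ℂ) : om P (-k) * (om P k * z) = z := by
  rw [om_neg, ← mul_assoc, inv_mul_cancel₀ (om_ne_zero k), one_mul]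

theorem conj_om (k : ZMod T) : conj (om P k) = om P (-k) := by
  rw [om_neg, om, map_pow, P.conj_ω, inv_pow]

theorem regular_ne {z : ℂ} (hz : z ∈ regular P) {x : ℂ} (hx : x ∈ pts' P) (k : ZMod T) :
    om P k * z ≠ x := by
  rintro rfl
  rcases mem_pts_cases (mem_pts'.mp hx).2 with h | ⟨-, h, -⟩
  · refine hz _ (Finsupp.mem_support_iff.mpr h) (.r (-k)) ?_
    rw [mobius_r_coe, om_neg_mul_cancel]
  · refine hz _ (Finsupp.mem_support_iff.mpr h) (.sr k) ?_
    change mobius P.ω (.sr k) ((conj (om P k * z) : ℂ) : OnePoint ℂ) = _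
    rw [mobius_sr_coe, map_mul, map_mul, map_mul, Complex.conj_conj, conj_om, Complex.conj_conj,
      om_neg_mul_cancel]

theorem regular_mul {z : ℂ} (hz : z ∈ regular P) (k : ZMod T) : om P k * z ∈ regular P := by
  intro x hx α h
  rw [← mobius_r_coe] at h
  have h' : mobius P.ω (.r (-k)) (mobius P.ω α x) = (z : OnePoint ℂ) := by
    rw [h, mobius_r_coe, mobius_r_coe, om_neg_mul_cancel]
  rw [← mobius_mul] at h'
  exact hz x hx _ h'

/-- The origin can be a regular point only if it is not marked. -/
theorem regular_zero {z : ℂ} (hz : z ∈ regular P) : z ≠ 0 ∨ P.level ((0 : ℂ) : OnePoint ℂ) = 0 := by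
  by_contra! h
  obtain ⟨rfl, h⟩ := h
  exact hz _ (Finsupp.mem_support_iff.mpr h) 1 (mobius_zero 1)

variable [FiniteDimensional ℂ 𝔤]

theorem E_zero_of_level (h : P.level ((0 : ℂ) : OnePoint ℂ) = 0) (p : ℕ) (Y : Aff P) :
    E P (0 : ℂ) p Y = 0 := by
  refine E_of_level (by omega) ?_ Y
  change P.level ((conj (0 : ℂ) : ℂ) : OnePoint ℂ) ≤ p
  rw [map_zero, h]
  exact Nat.zero_le _

theorem zero_mem_pts (h : P.level ((0 : ℂ) : OnePoint ℂ) ≠ 0) :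
    ((0 : ℂ) : OnePoint ℂ) ∈ pts P := by
  classical
  exact Finset.mem_union_left _ (Finsupp.mem_support_iff.mpr h)

theorem infty_mem_pts : OnePoint.infty ∈ pts P := by
  classical
  exact Finset.mem_union_left _ (Finsupp.mem_support_iff.mpr P.level_infty)

theorem E_zero_lie_of_ne {x : OnePoint ℂ} (hx : x ∈ pts P) (h : x ≠ (0 : ℂ)) (p q : ℕ)
    (X Y : Aff P) : ⁅E P (0 : ℂ) p X, E P x q Y⁆ = 0 := by
  by_cases h0 : P.level ((0 : ℂ) : OnePoint ℂ) = 0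
  · rw [E_zero_of_level h0, zero_lie]
  · exact E_lie_of_ne (zero_mem_pts h0) hx h.symm p q X Y

theorem sum_lie_sum_smul {ι κ L : Type*} [LieRing L] [LieAlgebra ℂ L] (s : Finset ι) (t : Finset κ)
    (c : ι → ℂ) (d : κ → ℂ) (f : ι → L) (g : κ → L) :
    ⁅∑ i ∈ s, c i • f i, ∑ j ∈ t, d j • g j⁆ = ∑ i ∈ s, ∑ j ∈ t, (c i * d j) • ⁅f i, g j⁆ := by
  simp only [sum_lie, lie_sum, smul_lie, lie_smul, Finset.smul_sum, mul_smul]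
  rw [Finset.sum_comm]
  exact Finset.sum_congr rfl fun i _ => Finset.sum_congr rfl fun j _ => smul_comm _ _ _

theorem polarE_apply (x z : ℂ) (X : Aff P) :
    polarE P x z X = ∑ p ∈ Finset.range (bound P), (1 / (z - x) ^ (p + 1)) • E P x p X := by
  simp only [polarE, LinearMap.sum_apply, LinearMap.smul_apply]

theorem polyE_apply (z : ℂ) (X : Aff P) :
    polyE P z X = ∑ q ∈ Finset.range (bound P), z ^ q • E P OnePoint.infty (q + 1) X := by
  simp only [polyE, LinearMap.sum_apply, LinearMap.smul_apply]

/-- The Takiff relations at one point sum to a difference quotient. -/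
theorem polarE_lie {x : ℂ} (hx : x ∈ pts' P) {z w : ℂ} (hz : z ≠ x) (hw : w ≠ x) (hzw : z ≠ w)
    (X Y : Aff P) : ⁅polarE P x z X, polarE P x w Y⁆ =
      (1 / (w - z)) • (polarE P x z ⁅X, Y⁆ - polarE P x w ⁅X, Y⁆) := by
  simp only [polarE_apply, sum_lie_sum_smul, E_lie (mem_pts'.mp hx).2 (mem_pts'.mp hx).1]
  rw [polar_difference le_rfl (e := fun n => E P x n ⁅X, Y⁆)
    (fun n hn => E_of_bound_le _ hn _) hz hw hzw]
  simp only [sub_smul, Finset.sum_sub_distrib]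

theorem polarE_lie_of_ne {x y : ℂ} (hx : x ∈ pts' P) (hy : y ∈ pts' P) (h : x ≠ y) (z w : ℂ)
    (X Y : Aff P) : ⁅polarE P x z X, polarE P y w Y⁆ = 0 := by
  simp only [polarE_apply, sum_lie_sum_smul]
  refine Finset.sum_eq_zero fun p _ => Finset.sum_eq_zero fun q _ => ?_
  rw [E_lie_of_ne (mem_pts'.mp hx).2 (mem_pts'.mp hy).2 fun h' => h (OnePoint.coe_injective h'),
    smul_zero]

theorem polarE_zero_lie_of_ne {y : ℂ} (hy : y ∈ pts' P) (z w : ℂ)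
    (X Y : Aff P) : ⁅polarE P 0 z X, polarE P y w Y⁆ = 0 := by
  simp only [polarE_apply, sum_lie_sum_smul]
  refine Finset.sum_eq_zero fun p _ => Finset.sum_eq_zero fun q _ => ?_
  rw [E_zero_lie_of_ne (mem_pts'.mp hy).2
    (fun h' => (mem_pts'.mp hy).1 (OnePoint.coe_injective h')), smul_zero]

theorem polarE_zero_lie_polyE (z w : ℂ) (X Y : Aff P) :
    ⁅polarE P 0 z X, polyE P w Y⁆ = 0 := by
  simp only [polarE_apply, polyE_apply, sum_lie_sum_smul]
  refine Finset.sum_eq_zero fun p _ => Finset.sum_eq_zero fun q _ => ?_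
  rw [E_zero_lie_of_ne infty_mem_pts (OnePoint.infty_ne_coe _), smul_zero]

theorem polarE_lie_polyE {x : ℂ} (hx : x ∈ pts' P) (z w : ℂ) (X Y : Aff P) :
    ⁅polarE P x z X, polyE P w Y⁆ = 0 := by
  simp only [polarE_apply, polyE_apply, sum_lie_sum_smul]
  refine Finset.sum_eq_zero fun p _ => Finset.sum_eq_zero fun q _ => ?_
  rw [E_lie_of_ne (mem_pts'.mp hx).2 infty_mem_pts (OnePoint.coe_ne_infty _), smul_zero]

/-- The averaged relations at the origin sum to an average of difference quotients at the points of
the orbit of `w`. -/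
theorem polarE_zero_lie {z w : ℂ} (hz : z ≠ 0 ∨ P.level ((0 : ℂ) : OnePoint ℂ) = 0)
    (hw : w ≠ 0 ∨ P.level ((0 : ℂ) : OnePoint ℂ) = 0) (hzw : ∀ m, z ≠ om P m * w) (X Y : Aff P) :
    ⁅polarE P 0 z X, polarE P 0 w Y⁆ =
      (T : ℂ)⁻¹ • ∑ m, (om P m / (om P m * w - z)) •
        (polarE P 0 z ⁅X, sg P m Y⁆ - polarE P 0 (om P m * w) ⁅X, sg P m Y⁆) := by
  by_cases h0 : P.level ((0 : ℂ) : OnePoint ℂ) = 0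
  · simp [polarE_apply, E_zero_of_level h0]
  · have hz0 := hz.resolve_right h0
    have hw0 := hw.resolve_right h0
    have h1 : ∀ m : ZMod T, (om P m / (om P m * w - z)) •
        (polarE P 0 z ⁅X, sg P m Y⁆ - polarE P 0 (om P m * w) ⁅X, sg P m Y⁆) =
        ∑ p ∈ Finset.range (bound P), ∑ q ∈ Finset.range (bound P),
          (1 / (z - 0) ^ (p + 1) * (1 / (w - 0) ^ (q + 1))) •
            (om P m)⁻¹ ^ q • E P (0 : ℂ) (p + q) ⁅X, sg P m Y⁆ := by
      intro m
      have h2 := polar_difference le_rfl (e := fun n => E P (0 : ℂ) n ⁅X, sg P m Y⁆)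
        (fun n hn => E_of_bound_le _ hn _) hz0 (mul_ne_zero (om_ne_zero m) hw0) (hzw m)
      have h3 : om P m / (om P m * w - z) = om P m * (1 / (om P m * w - z)) := by ring
      rw [h3, mul_smul, polarE_apply, polarE_apply, ← Finset.sum_sub_distrib]
      simp only [← sub_smul]
      rw [← h2, Finset.smul_sum]
      refine Finset.sum_congr rfl fun p _ => ?_
      rw [Finset.smul_sum]
      refine Finset.sum_congr rfl fun q _ => ?_
      rw [smul_smul, smul_smul]
      congr 1
      have := om_ne_zero (P := P) m
      simp only [sub_zero, inv_pow, mul_pow, pow_succ]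
      field_simp
    rw [Finset.sum_congr rfl fun m _ => h1 m]
    simp only [polarE_apply, sum_lie_sum_smul, E_zero_lie, Finset.smul_sum]
    rw [Finset.sum_comm]
    conv_rhs => rw [Finset.sum_comm]; enter [2, p]; rw [Finset.sum_comm]
    rw [Finset.sum_comm]
    refine Finset.sum_congr rfl fun p _ => Finset.sum_congr rfl fun q _ => ?_
    exact Finset.sum_congr rfl fun m _ => smul_comm _ _ _

/-- The averaged relations at infinity sum to the same average of difference quotients as at the
origin, with the opposite sign. The fields at infinity enter the Lax matrix with a minus sign, which
restores the common form. -/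
theorem polyE_lie {z w : ℂ} (hzw : ∀ m, z ≠ om P m * w) (X Y : Aff P) :
    ⁅polyE P z X, polyE P w Y⁆ =
      -((T : ℂ)⁻¹ • ∑ m, (om P m / (om P m * w - z)) •
        (polyE P z ⁅X, sg P m Y⁆ - polyE P (om P m * w) ⁅X, sg P m Y⁆)) := by
  have h1 : ∀ m : ZMod T, (om P m / (om P m * w - z)) •
      (polyE P z ⁅X, sg P m Y⁆ - polyE P (om P m * w) ⁅X, sg P m Y⁆) =
      -∑ p ∈ Finset.range (bound P), ∑ q ∈ Finset.range (bound P),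
        (z ^ p * w ^ q) • om P m ^ (q + 1) • E P OnePoint.infty (p + q + 2) ⁅X, sg P m Y⁆ := by
    intro m
    have h2 := polynomial_difference le_rfl
      (e := fun n => E P OnePoint.infty (n + 1) ⁅X, sg P m Y⁆)
      (fun n hn => E_of_bound_le _ (hn.trans n.le_succ) _) (hzw m)
    have h3 : om P m / (om P m * w - z) = -(om P m * (1 / (z - om P m * w))) := by
      rw [← neg_sub z, div_neg]; ring
    rw [h3, neg_smul, mul_smul, polyE_apply, polyE_apply, ← Finset.sum_sub_distrib]
    simp only [← sub_smul]
    rw [← h2, Finset.smul_sum]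
    refine congrArg Neg.neg (Finset.sum_congr rfl fun p _ => ?_)
    rw [Finset.smul_sum]
    refine Finset.sum_congr rfl fun q _ => ?_
    rw [smul_smul, smul_smul]
    congr 1
    ring
  rw [Finset.sum_congr rfl fun m _ => h1 m]
  simp only [polyE_apply, sum_lie_sum_smul, E_infty_lie, Finset.smul_sum,
    Finset.sum_neg_distrib, smul_neg, neg_neg]
  rw [Finset.sum_comm]
  conv_rhs => rw [Finset.sum_comm]; enter [2, p]; rw [Finset.sum_comm]
  rw [Finset.sum_comm]
  refine Finset.sum_congr rfl fun p _ => Finset.sum_congr rfl fun q _ => ?_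
  exact Finset.sum_congr rfl fun m _ => smul_comm _ _ _

variable (P) in
/-- the part of the Lax matrix with poles away from `0` and `∞`, evaluated on the affine algebra -/
def orbitE (z : ℂ) (X : Aff P) : gDC P :=
  (T : ℂ)⁻¹ • ∑ k, om P k • ∑ x ∈ pts' P, polarE P x (om P k * z) (sg P k X)

theorem evHat_Lax (z : ℂ) (X : Aff P) :
    evHat X (Lax P z) = orbitE P z X + polarE P 0 z X - polyE P z X := by
  rw [Lax]
  refine (map_sub (evHat X) _ _).trans ?_
  rw [map_add, map_smul, sum_range_zmod]
  simp only [map_sum, map_smul]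
  congr 1
  · congr 1
    · rw [one_div, orbitE]
      congr 1
      refine Fintype.sum_equiv (Equiv.neg (ZMod T)) _ _ fun k => ?_
      rw [Finset.smul_sum]
      refine Finset.sum_congr rfl fun x _ => ?_
      rw [polarE_apply, Finset.smul_sum]
      refine Finset.sum_congr rfl fun p _ => ?_
      have h1 : P.ω⁻¹ ^ k.val = om P (-k) := by rw [om_neg, om, inv_pow]
      have h2 : evHat X ((sigHat P ^ k.val) (A P x p)) = E P x p (sg P (-k) X) := by
        rw [← evHat_A, ← evHat_Sg']
        rfl
      rw [h1, h2, smul_smul, mul_one_div, Equiv.neg_apply]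
    · simp only [evHat_A, polarE_apply, sub_zero]
  · simp only [evHat_A, polyE_apply]

/-- The part with poles at free orbits: only the terms of the double sum with poles at the same
point contribute, and reindexing by the difference of the two rotations makes the kernel appear. -/
theorem orbitE_lie {z w : ℂ} (hz : z ∈ regular P) (hw : w ∈ regular P)
    (hzw : ∀ m, z ≠ om P m * w) (X Y : Aff P) :
    ⁅orbitE P z X, orbitE P w Y⁆ =
      (T : ℂ)⁻¹ • ∑ m, (om P m / (om P m * w - z)) •
        (orbitE P z ⁅X, sg P m Y⁆ - orbitE P (om P m * w) ⁅X, sg P m Y⁆) := by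
  have hkl : ∀ k m : ZMod T, om P k * z ≠ om P (k + m) * w := fun k m h => hzw m (by
    rw [om_add, mul_assoc] at h
    exact mul_left_cancel₀ (om_ne_zero k) h)
  have h1 : ∀ k m : ZMod T, ⁅∑ x ∈ pts' P, polarE P x (om P k * z) (sg P k X),
      ∑ x ∈ pts' P, polarE P x (om P (k + m) * w) (sg P (k + m) Y)⁆ =
      (1 / (om P (k + m) * w - om P k * z)) • ∑ x ∈ pts' P,
        (polarE P x (om P k * z) (sg P k ⁅X, sg P m Y⁆) -
          polarE P x (om P k * (om P m * w)) (sg P k ⁅X, sg P m Y⁆)) := by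
    intro k m
    rw [sum_lie, Finset.smul_sum]
    refine Finset.sum_congr rfl fun x hx => ?_
    rw [lie_sum, Finset.sum_eq_single x (fun y hy hxy => polarE_lie_of_ne hx hy hxy.symm _ _ _ _)
      (fun h => absurd hx h), polarE_lie hx (regular_ne hz hx k) (regular_ne hw hx _) (hkl k m),
      sg_add, ← sg_lie, om_add, mul_assoc]
  have h2 : ∀ k m : ZMod T, om P k * om P (k + m) * (1 / (om P (k + m) * w - om P k * z)) =
      om P m / (om P m * w - z) * om P k := by
    intro k m
    have h3 := om_ne_zero (P := P) k
    have h4 : om P m * w - z ≠ 0 := sub_ne_zero.mpr (hzw m).symm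
    rw [om_add, mul_assoc (om P k) _ w, ← mul_sub]
    field_simp
  rw [orbitE, orbitE, smul_lie, lie_smul, sum_lie_sum_smul]
  simp only [orbitE]
  rw [Finset.sum_congr rfl fun k _ => (Fintype.sum_equiv (Equiv.addLeft k) _ _ fun m => rfl).symm]
  simp only [Equiv.coe_addLeft, h1, smul_smul (om P _ * om P _), h2, ← smul_sub,
    ← Finset.sum_sub_distrib, mul_smul]
  rw [Finset.sum_comm]
  refine congrArg _ ?_
  rw [Finset.smul_sum]
  refine Finset.sum_congr rfl fun m _ => ?_
  rw [smul_comm, Finset.smul_sum, ← Finset.smul_sum, ← Finset.smul_sum]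

/-- The Poisson brackets of the Lax matrix with itself, evaluated on the affine algebra. -/
theorem evHat_Lax_lie {z w : ℂ} (hz : z ∈ regular P) (hw : w ∈ regular P)
    (hzw : ∀ m, z ≠ om P m * w) (X Y : Aff P) :
    ⁅evHat X (Lax P z), evHat Y (Lax P w)⁆ =
      (T : ℂ)⁻¹ • ∑ m, (om P m / (om P m * w - z)) •
        (evHat ⁅X, sg P m Y⁆ (Lax P z) - evHat ⁅X, sg P m Y⁆ (Lax P (om P m * w))) := by
  have h1 : ⁅orbitE P z X, polarE P 0 w Y⁆ = 0 := by
    rw [← lie_skew]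
    simp only [orbitE, lie_smul, lie_sum]
    rw [Finset.sum_eq_zero fun k _ => ?_, smul_zero, neg_zero]
    rw [Finset.sum_eq_zero fun x hx => polarE_zero_lie_of_ne hx _ _ _ _, smul_zero]
  have h2 : ⁅polarE P 0 z X, orbitE P w Y⁆ = 0 := by
    simp only [orbitE, lie_smul, lie_sum]
    rw [Finset.sum_eq_zero fun k _ => ?_, smul_zero]
    rw [Finset.sum_eq_zero fun x hx => polarE_zero_lie_of_ne hx _ _ _ _, smul_zero]
  have h3 : ∀ z w X Y, ⁅orbitE P z X, polyE P w Y⁆ = 0 := by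
    intro z w X Y
    simp only [orbitE, smul_lie, sum_lie]
    rw [Finset.sum_eq_zero fun k _ => ?_, smul_zero]
    rw [Finset.sum_eq_zero fun x hx => polarE_lie_polyE hx _ _ _ _, smul_zero]
  have h4 : ⁅polyE P z X, orbitE P w Y⁆ = 0 := by rw [← lie_skew, h3, neg_zero]
  have h5 : ⁅polyE P z X, polarE P 0 w Y⁆ = 0 := by
    rw [← lie_skew, polarE_zero_lie_polyE, neg_zero]
  simp only [evHat_Lax, add_lie, lie_add, sub_lie, lie_sub, h1, h2, h3, h4, h5,
    polarE_zero_lie_polyE]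
  rw [orbitE_lie hz hw hzw, polarE_zero_lie (regular_zero hz) (regular_zero hw) hzw, polyE_lie hzw]
  simp only [smul_sub, smul_add, Finset.sum_sub_distrib, Finset.sum_add_distrib]
  abel

end LaxBracket

/-! ### The flow of half the square of the Lax matrix -/

section GenericLaxEquation

variable [NeZero T] {P : DihedralGaudin T 𝔤} [FiniteDimensional ℂ 𝔤]

theorem Sg_A_zero (k : ZMod T) (p : ℕ) :
    Sg P k (A P (0 : ℂ) p) = om P (-k) ^ p • A P (0 : ℂ) p := by
  refine fld_ext fun Y => ?_
  rw [evHat_Sg', map_smul, evHat_A, evHat_A, E_zero_sg]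

theorem Sg_A_infty (k : ZMod T) (p : ℕ) :
    Sg P k (A P OnePoint.infty p) = om P k ^ p • A P OnePoint.infty p := by
  refine fld_ext fun Y => ?_
  rw [evHat_Sg', map_smul, evHat_A, evHat_A, E_infty_sg, ← om_neg, neg_neg]

theorem A_of_bound_le (x : OnePoint ℂ) {p : ℕ} (h : bound P ≤ p) : A P x p = 0 :=
  fld_ext fun Y => by rw [evHat_A, E_of_bound_le x h, map_zero]

theorem A_zero_of_level (h : P.level ((0 : ℂ) : OnePoint ℂ) = 0) (p : ℕ) :
    A P (0 : ℂ) p = 0 :=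
  fld_ext fun Y => by rw [evHat_A, E_zero_of_level h, map_zero]

theorem evHat_sub (Y : Aff P) (A B : Fld P) : evHat Y (A - B) = evHat Y A - evHat Y B :=
  map_sub (evHat Y) A B

theorem pairL_sub_left (A B C : Fld P) : pairL P (A - B) C = pairL P A C - pairL P B C :=
  map_sub ((pairL P).flip C) A B

theorem smul_zero_sub_smul {M : Type*} [AddCommGroup M] [Module ℂ M] {a b c : ℂ} (h : a * b = c)
    (v : M) : a • (0 - b • v) = c • -v := by
  rw [zero_sub, smul_neg, smul_neg, smul_smul, h]

theorem orbitE_om_mul (m : ZMod T) (z : ℂ) (X : Aff P) :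
    orbitE P (om P m * z) X = om P (-m) • orbitE P z (sg P (-m) X) := by
  rw [orbitE, orbitE, smul_comm (om P (-m)), Finset.smul_sum (r := om P (-m))]
  refine congrArg (fun v : gDC P => (T : ℂ)⁻¹ • v)
    (Fintype.sum_equiv (Equiv.addRight m) _ _ fun k => ?_)
  rw [Equiv.coe_addRight, smul_smul, ← om_add, neg_add_cancel_comm_assoc]
  refine congrArg _ (Finset.sum_congr rfl fun x _ => ?_)
  rw [← sg_add, add_neg_cancel_right, om_add, mul_assoc]

/-- equivariance of the Lax matrix -/
theorem Lax_om_mul (m : ZMod T) (z : ℂ) :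
    Lax P (om P m * z) = om P (-m) • Sg P m (Lax P z) := by
  refine fld_ext fun X => ?_
  rw [map_smul, evHat_Sg', evHat_Lax, evHat_Lax, smul_sub, smul_add, orbitE_om_mul]
  refine congrArg₂ _ (congrArg₂ _ rfl ?_) ?_
  · simp only [polarE_apply, Finset.smul_sum, E_zero_sg, smul_smul, om_neg]
    refine Finset.sum_congr rfl fun p _ => ?_
    congr 1
    have := om_ne_zero (P := P) m
    simp only [sub_zero, mul_pow, inv_pow, pow_succ]
    field_simp
  · simp only [polyE_apply, Finset.smul_sum, E_infty_sg, smul_smul, om_neg]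
    refine Finset.sum_congr rfl fun p _ => ?_
    congr 1
    have := om_ne_zero (P := P) m
    simp only [mul_pow, inv_inv, pow_succ]
    field_simp

variable (P) in
/-- the matrix `M` in the Lax equation `{(L(w) | L(w)) / 2, L(z)} = [M, L(z)]` -/
def genMat (w z : ℂ) : Fld P :=
  (T : ℂ)⁻¹ • ∑ m, (1 / (om P m * z - w)) • Sg P (-m) (Lax P w)

/-- The bracket of `L(w)` with the observable `(Y | L(z))`, as an identity of formal fields in which
`Y` acts by the adjoint representation. -/
theorem derHat_Lax {z w : ℂ} (hz : z ∈ regular P) (hw : w ∈ regular P)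
    (hwz : ∀ m, w ≠ om P m * z) (Y : Aff P) :
    derHat (evHat Y (Lax P z)) (Lax P w) = (T : ℂ)⁻¹ • ∑ m, (om P m / (om P m * z - w)) •
      (adHat (sg P m Y) (Lax P w) - om P (-m) • Sg P m (adHat Y (Lax P z))) := by
  refine fld_ext fun X => ?_
  rw [evHat_derHat, evHat_Lax_lie hw hz hwz]
  simp only [map_smul, map_sum, evHat_sub, evHat_adHat, Lax_om_mul, ← adHat_Sg]

/-- The flow of `(L(w) | L(w)) / 2` is given by a Lax equation. -/
theorem actL_half_square {z w : ℂ} (hz : z ∈ regular P) (hw : w ∈ regular P)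
    (hwz : ∀ m, w ≠ om P m * z) :
    actL P ((1 / 2 : ℂ) • pairL P (Lax P w) (Lax P w)) (Lax P z) =
      auxL P (genMat P w z) (Lax P z) := by
  refine auxS_ext fun Y => ?_
  rw [evA_actL, evA_auxL, map_smul, LinearMap.smul_apply, poissonL_pairL,
    pairL_symm (Lax P w), ← two_smul ℂ, smul_smul, one_div, inv_mul_cancel₀ two_ne_zero, one_smul,
    derHat_Lax hz hw hwz, genMat]
  -- the terms `([Y, L(w)] | L(w))` vanish by invariance of the form
  simp only [map_smul, map_sum, pairL_sub_left, LinearMap.smul_apply, LinearMap.sum_apply,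
    pairL_adHat_self]
  refine congrArg _ (Finset.sum_congr rfl fun m _ => ?_)
  rw [pairL_adHat Y, pairL_symm (Sg P (-m) _), pairL_Sg_right, neg_neg]
  refine smul_zero_sub_smul (M := SHat P) ?_ _
  have := om_ne_zero (P := P) m
  rw [om_neg]
  field_simp

end GenericLaxEquation

/-! ### Poles and expansion of the Lax matrix -/

section Expansion

variable [NeZero T] (P : DihedralGaudin T 𝔤)

/-- the labels `(k, x)` of the poles `ω ^ k x` of the Lax matrix -/
def poles : Finset (ZMod T × ℂ) :=
  insert (0, 0) (Finset.univ ×ˢ pts' P)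

/-- the position of a pole -/
def polePos (j : ZMod T × ℂ) : ℂ := om P j.1 * j.2

variable [FiniteDimensional ℂ 𝔤]

open Classical in
/-- the polar coefficients of the Lax matrix -/
def laxPolar (j : ZMod T × ℂ) (p : ℕ) : Fld P :=
  if j.2 = 0 then A P (0 : ℂ) p else ((T : ℂ)⁻¹ * om P j.1 ^ p) • Sg P j.1 (A P j.2 p)

variable {P}

theorem zero_notMem_pts' : (0 : ℂ) ∉ pts' P := fun h => (mem_pts'.mp h).1 rfl

theorem sum_poles {M : Type*} [AddCommMonoid M] (f : ZMod T × ℂ → M) :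
    ∑ j ∈ poles P, f j = f (0, 0) + ∑ k, ∑ x ∈ pts' P, f (k, x) := by
  rw [poles, Finset.sum_insert, Finset.sum_product]
  simp [zero_notMem_pts']

theorem laxPolar_zero (p : ℕ) : laxPolar P (0, 0) p = A P (0 : ℂ) p := if_pos rfl

theorem laxPolar_of_mem {x : ℂ} (hx : x ∈ pts' P) (k : ZMod T) (p : ℕ) :
    laxPolar P (k, x) p = ((T : ℂ)⁻¹ * om P k ^ p) • Sg P k (A P x p) := if_neg (mem_pts'.mp hx).1

theorem laxPolar_of_bound_le (j : ZMod T × ℂ) (p : ℕ) (h : bound P ≤ p) : laxPolar P j p = 0 := by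
  rw [laxPolar, A_of_bound_le _ h, A_of_bound_le _ h, map_zero, smul_zero, ite_self]

theorem Lax_eq_ratFun (z : ℂ) : Lax P z =
    ratFun (poles P) (polePos P) (laxPolar P) (fun q => A P OnePoint.infty (q + 1)) (bound P)
      z := by
  rw [Lax, ratFun, sum_poles, sum_range_zmod, add_comm (_ • _)]
  congr 1
  refine congrArg₂ _ ?_ ?_
  · refine Finset.sum_congr rfl fun p _ => ?_
    rw [laxPolar_zero, polePos, mul_zero, sub_zero]
  · rw [Finset.smul_sum]
    refine Finset.sum_congr rfl fun k _ => ?_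
    rw [Finset.smul_sum]
    refine Finset.sum_congr rfl fun x hx => ?_
    rw [Finset.smul_sum]
    refine Finset.sum_congr rfl fun p _ => ?_
    rw [laxPolar_of_mem hx, smul_smul, smul_smul]
    congr 1
    have h0 := om_ne_zero (P := P) k
    have h1 : P.ω⁻¹ ^ k.val = (om P k)⁻¹ := by rw [om, inv_pow]
    have h2 : (om P k)⁻¹ * z - x = (om P k)⁻¹ * (z - om P k * x) := by field_simp
    rw [h1, h2, polePos, mul_pow, inv_pow, pow_succ]
    field_simp

/-- A regular point is not a pole of the Lax matrix. The label of the origin belongs to `poles P`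
even if the origin is not marked, but then its coefficients vanish. -/
theorem pole_ne {z : ℂ} (hz : z ∈ regular P) (j : ZMod T × ℂ) (hj : j ∈ poles P) :
    z ≠ polePos P j ∨ ∀ p, laxPolar P j p = 0 := by
  rw [poles, Finset.mem_insert, Finset.mem_product] at hj
  rcases hj with rfl | ⟨-, hj⟩
  · refine (regular_zero hz).imp (fun h => by rwa [polePos, mul_zero]) fun h p => ?_
    rw [laxPolar_zero, A_zero_of_level h]
  · refine Or.inl fun h => regular_ne hz hj (-j.1) ?_
    rw [h, polePos, om_neg_mul_cancel]

/-- Distinct points of `pts' P` lie in distinct orbits of the rotations. For a marked point and the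
conjugate of another one this uses that the latter has trivial stabilizer. -/
theorem eq_of_om_mul_eq {x y : ℂ} (hx : x ∈ pts' P) (hy : y ∈ pts' P) {m : ZMod T}
    (h : om P m * x = y) : x = y := by
  have key : ∀ {x y : ℂ} {m : ZMod T}, P.level (x : OnePoint ℂ) ≠ 0 →
      P.level (OnePoint.map conj (y : OnePoint ℂ)) ≠ 0 →
      stab P (OnePoint.map conj (y : OnePoint ℂ)) = {1} → om P m * x = y → x = y := by
    intro x y m hx hy hs h
    have h1 : mobius P.ω (.sr m) (x : OnePoint ℂ) = OnePoint.map conj (y : OnePoint ℂ) := by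
      rw [mobius_sr_coe, h]
      rfl
    have h2 := P.level_disjoint _ (Finsupp.mem_support_iff.mpr hx) _
      (Finsupp.mem_support_iff.mpr hy) _ h1
    have h3 : (.sr m : DihedralGroup T) ∈ stab P (OnePoint.map conj (y : OnePoint ℂ)) := by
      rw [mem_stab, ← h2, h1, h2]
    rw [hs, Finset.mem_singleton] at h3
    cases h3
  rcases mem_pts_cases (mem_pts'.mp hx).2 with h1 | ⟨-, h1, h1s⟩ <;>
    rcases mem_pts_cases (mem_pts'.mp hy).2 with h2 | ⟨-, h2, h2s⟩
  · refine OnePoint.coe_injective (P.level_disjoint _ (Finsupp.mem_support_iff.mpr h1) _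
      (Finsupp.mem_support_iff.mpr h2) (.r m) ?_)
    rw [mobius_r_coe, h]
  · exact key h1 h2 h2s h
  · refine (key (m := -m) h2 h1 h1s ?_).symm
    rw [← h, om_neg_mul_cancel]
  · have h3 := P.level_disjoint _ (Finsupp.mem_support_iff.mpr h1) _
      (Finsupp.mem_support_iff.mpr h2) (.r (-m)) (by
        change mobius P.ω (.r (-m)) ((conj x : ℂ) : OnePoint ℂ) = ((conj y : ℂ) : OnePoint ℂ)
        rw [mobius_r_coe, ← h, map_mul, conj_om])
    refine OnePoint.coe_injective ?_
    rw [← conj_conj_map (x : OnePoint ℂ), h3, conj_conj_map]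

theorem polePos_injOn : Set.InjOn (polePos P) (poles P) := by
  rintro ⟨k, x⟩ hx ⟨l, y⟩ hy h
  rw [Finset.mem_coe, poles, Finset.mem_insert, Finset.mem_product] at hx hy
  simp only [polePos] at h
  rcases hx with hx | ⟨-, hx⟩ <;> rcases hy with hy | ⟨-, hy⟩
  · rw [hx, hy]
  · obtain ⟨rfl, rfl⟩ := Prod.mk.inj hx
    rw [mul_zero] at h
    exact absurd h.symm (mul_ne_zero (om_ne_zero l) (mem_pts'.mp hy).1)
  · obtain ⟨rfl, rfl⟩ := Prod.mk.inj hy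
    rw [mul_zero] at h
    exact absurd h (mul_ne_zero (om_ne_zero k) (mem_pts'.mp hx).1)
  · dsimp only at hx hy
    have h1 : x = y := eq_of_om_mul_eq (m := -l + k) hx hy (by
      rw [om_add, mul_assoc, h, om_neg_mul_cancel])
    subst h1
    rw [om_injective (mul_right_cancel₀ (mem_pts'.mp hx).1 h)]

end Expansion

/-! ### Coefficients of the square at the orbits -/

section Coefficients

variable [NeZero T] {P : DihedralGaudin T 𝔤}

theorem om_natCast (n : ℕ) : om P (n : ZMod T) = P.ω ^ n := by
  rw [om, ZMod.val_natCast]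
  exact (pow_eq_pow_mod _ P.ω_pow).symm

theorem om_zpow_eq_one (k : ZMod T) {n : ℤ} (h : (T : ℤ) ∣ n) : om P k ^ n = 1 := by
  rw [om, ← zpow_natCast, ← zpow_mul, mul_comm, zpow_mul,
    (P.ω_prim.zpow_eq_one_iff_dvd n).mpr h, one_zpow]

theorem om_one_zpow_ne_one {n : ℤ} (h : ¬ (T : ℤ) ∣ n) : om P 1 ^ n ≠ 1 := by
  rw [← Nat.cast_one, om_natCast, pow_one]
  exact fun h' => h ((P.ω_prim.zpow_eq_one_iff_dvd n).mp h')

/-- orthogonality of the characters of the cyclic group -/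
theorem sum_om_zpow (n : ℤ) :
    (T : ℂ)⁻¹ * ∑ k, om P k ^ n = if (T : ℤ) ∣ n then 1 else 0 := by
  split_ifs with h
  · simp only [om_zpow_eq_one _ h, Finset.sum_const, Finset.card_univ, ZMod.card, nsmul_eq_mul,
      mul_one]
    exact inv_mul_cancel₀ (Nat.cast_ne_zero.mpr (NeZero.ne T))
  · have h1 : ∑ k, om P k ^ n = om P 1 ^ n * ∑ k, om P k ^ n := by
      rw [Finset.mul_sum]
      refine (Fintype.sum_equiv (Equiv.addLeft 1) _ _ fun k => ?_).symm
      rw [Equiv.coe_addLeft, om_add, mul_zpow]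
    have h2 : (1 - om P 1 ^ n) * ∑ k, om P k ^ n = 0 := by linear_combination h1
    rw [(mul_eq_zero.mp h2).resolve_left (sub_ne_zero.mpr (om_one_zpow_ne_one h).symm), mul_zero]

/-- Homogeneous fields whose weights do not add up to zero are orthogonal, as the pairing is
invariant. -/
theorem pairL_eq_zero_of_weight {A B : Fld P} {a b : ℤ} (hA : Sg P 1 A = om P 1 ^ a • A)
    (hB : Sg P 1 B = om P 1 ^ b • B) (h : ¬ (T : ℤ) ∣ a + b) : pairL P A B = 0 := by
  have h1 := pairL_Sg 1 A B
  rw [hA, hB, map_smul, LinearMap.map_smul₂ (pairL P), smul_smul,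
    ← zpow_add₀ (om_ne_zero 1), add_comm] at h1
  have h2 : (1 - om P 1 ^ (a + b)) • pairL P A B = 0 := by
    refine (sub_smul (1 : ℂ) (om P 1 ^ (a + b)) (pairL P A B)).trans ?_
    rw [h1, one_smul]
    exact sub_self _
  exact (smul_eq_zero.mp h2).resolve_left (sub_ne_zero.mpr (om_one_zpow_ne_one h).symm)

theorem modEq_one_iff (p : ℕ) : p ≡ 1 [MOD T] ↔ (T : ℤ) ∣ (p : ℤ) - 1 := by
  rw [Nat.ModEq.comm, Nat.modEq_iff_dvd, Nat.cast_one]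

theorem dvd_add_two_iff (q : ℕ) : T ∣ q + 2 ↔ (T : ℤ) ∣ (q : ℤ) + 2 := by
  rw [← Int.natCast_dvd_natCast]
  push_cast
  rfl

theorem pow_mul_pow_mul_inv_pow {u : ℂ} (hu : u ≠ 0) (p q s : ℕ) :
    u ^ (p + s) * u ^ q * u⁻¹ ^ (q + s + 1) = u ^ ((p : ℤ) - 1) := by
  rw [zpow_sub_one₀ hu, zpow_natCast, inv_pow]
  simp only [pow_add, pow_one]
  field_simp

variable [FiniteDimensional ℂ 𝔤]

theorem Sg_A_zero_zpow (k : ZMod T) (p : ℕ) :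
    Sg P k (A P (0 : ℂ) p) = om P k ^ (-(p : ℤ)) • A P (0 : ℂ) p := by
  rw [Sg_A_zero, om_neg, zpow_neg, zpow_natCast, inv_pow]

theorem Sg_A_infty_zpow (k : ZMod T) (p : ℕ) :
    Sg P k (A P OnePoint.infty p) = om P k ^ (p : ℤ) • A P OnePoint.infty p := by
  rw [Sg_A_infty, zpow_natCast]

theorem pairL_Sg_A_zero (k : ZMod T) (X : Fld P) (q : ℕ) :
    pairL P (Sg P k X) (A P (0 : ℂ) q) = om P k ^ q • pairL P X (A P (0 : ℂ) q) := by
  rw [← pairL_Sg (-k), ← Sg_add, neg_add_cancel, Sg_zero, Sg_A_zero, neg_neg, map_smul]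

theorem pairL_Sg_A_infty (k : ZMod T) (X : Fld P) (q : ℕ) :
    pairL P (Sg P k X) (A P OnePoint.infty q) =
      (om P k)⁻¹ ^ q • pairL P X (A P OnePoint.infty q) := by
  rw [← pairL_Sg (-k), ← Sg_add, neg_add_cancel, Sg_zero, Sg_A_infty, om_neg, map_smul]

variable (P) in
/-- the contribution of the pole at `ω ^ m y` to the Hamiltonian `H^x_p` -/
def hamTerm (x : ℂ) (p : ℕ) (m : ZMod T) (y : ℂ) : SHat P :=
  ∑ q ∈ Finset.range (bound P), ∑ s ∈ Finset.range (bound P),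
    ((-1) ^ s * ((q + s).choose s : ℂ) * P.ω ^ (m.val * q) / (x - P.ω ^ m.val * y) ^ (q + s + 1)) •
      pairHat P (A P x (p + s)) ((sigHat P ^ m.val) (A P y q))

/-- The rotation is irrelevant for the pole at the origin, so that its `T` contributions to
`hamFinite` agree. -/
theorem hamTerm_zero (x : ℂ) (p : ℕ) (m : ZMod T) : hamTerm P x p m 0 = hamTerm P x p 0 0 := by
  refine Finset.sum_congr rfl fun q _ => Finset.sum_congr rfl fun s _ => ?_
  have h : ∀ m : ZMod T, pairHat P (A P x (p + s)) ((sigHat P ^ m.val) (A P (0 : ℂ) q)) =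
      om P (-m) ^ q • pairHat P (A P x (p + s)) (A P (0 : ℂ) q) := by
    intro m
    have h1 := Sg_A_zero (P := P) m q
    rw [Sg] at h1
    rw [h1]
    exact map_smul (pairL P (A P x (p + s))) _ _
  have h2 : ∀ m : ZMod T, P.ω ^ (m.val * q) * om P (-m) ^ q = 1 := by
    intro m
    rw [pow_mul, ← mul_pow, om_neg, om,
      mul_inv_cancel₀ (pow_ne_zero _ P.ω_ne_zero), one_pow]
  rw [h, h, smul_smul, smul_smul, mul_zero, mul_zero, div_mul_eq_mul_div, div_mul_eq_mul_div,
    mul_assoc _ (P.ω ^ _), mul_assoc _ (P.ω ^ _), h2, h2]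

theorem hamFinite_eq {x : ℂ} (hx : x ∈ pts' P) (p : ℕ) : hamFinite P x p =
    (T : ℂ) • hamTerm P x p 0 0 +
      ∑ m : ZMod T, ∑ y ∈ pts' P, (if m = 0 ∧ y = x then 0 else hamTerm P x p m y) -
    (T : ℂ) • ∑ q ∈ Finset.range (bound P), ∑ s ∈ Finset.range (bound P),
      ((q.choose s : ℂ) * x ^ (q - s)) • pairHat P (A P x (p + s)) (A P OnePoint.infty (q + 1)) +
    (1 / 2 : ℂ) • ∑ q ∈ Finset.range p, pairHat P (A P x q) (A P x (p - q - 1)) := by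
  have h1 : ∀ m : ZMod T, ∑ y ∈ insert 0 (pts' P), (if m.val = 0 ∧ y = x then 0 else
      hamTerm P x p m y) = hamTerm P x p 0 0 +
      ∑ y ∈ pts' P, (if m = 0 ∧ y = x then 0 else hamTerm P x p m y) := by
    intro m
    rw [Finset.sum_insert zero_notMem_pts', if_neg fun h => (mem_pts'.mp hx).1 h.2.symm,
      hamTerm_zero]
    simp only [ZMod.val_eq_zero]
  have h2 : ∑ l ∈ Finset.range T, ∑ y ∈ insert 0 (pts' P), (if l = 0 ∧ y = x then 0 else
      ∑ q ∈ Finset.range (bound P), ∑ s ∈ Finset.range (bound P),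
        ((-1) ^ s * ((q + s).choose s : ℂ) * P.ω ^ (l * q) / (x - P.ω ^ l * y) ^ (q + s + 1)) •
          pairHat P (A P x (p + s)) ((sigHat P ^ l) (A P y q))) =
      (T : ℂ) • hamTerm P x p 0 0 +
      ∑ m : ZMod T, ∑ y ∈ pts' P, (if m = 0 ∧ y = x then 0 else hamTerm P x p m y) := by
    rw [sum_range_zmod]
    refine (Finset.sum_congr rfl fun m _ => h1 m).trans ?_
    rw [Finset.sum_add_distrib, Finset.sum_const, Finset.card_univ, ZMod.card,
      ← Nat.cast_smul_eq_nsmul ℂ]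
  rw [← h2, hamFinite]

variable (P) in
/-- the coefficients of the polynomial part of the Lax matrix, up to sign -/
abbrev laxPoly (q : ℕ) : Fld P := A P OnePoint.infty (q + 1)

/-- The coefficients of the square at `ω ^ k x` are those at `x`, transported by equivariance. -/
theorem squarePolar_orbit {x : ℂ} (hx : x ∈ pts' P) (k : ZMod T) (p : ℕ) :
    squarePolar (pairL P) (poles P) (polePos P) (laxPolar P) (laxPoly P) (bound P) (k, x) p =
      ((T : ℂ)⁻¹ ^ 2 * om P k ^ ((p : ℤ) - 1)) • hamFinite P x p := by
  have hT : (T : ℂ) ≠ 0 := Nat.cast_ne_zero.mpr (NeZero.ne T)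
  have hk := om_ne_zero (P := P) k
  set c : ℂ := (T : ℂ)⁻¹ ^ 2 * om P k ^ ((p : ℤ) - 1) with hc
  have h1 : ∀ m : ZMod T, ∀ y ∈ pts' P,
      ∑ q ∈ Finset.range (bound P), ∑ s ∈ Finset.range (bound P),
        ((-1) ^ s * ((q + s).choose s : ℂ) *
          (1 / (polePos P (k, x) - polePos P (k + m, y))) ^ (q + s + 1)) •
        pairL P (laxPolar P (k, x) (p + s)) (laxPolar P (k + m, y) q) = c • hamTerm P x p m y := by
    intro m y hy
    rw [hamTerm, Finset.smul_sum]
    refine Finset.sum_congr rfl fun q _ => ?_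
    rw [Finset.smul_sum]
    refine Finset.sum_congr rfl fun s _ => ?_
    have h2 : polePos P (k, x) - polePos P (k + m, y) = om P k * (x - om P m * y) := by
      rw [polePos, polePos, om_add]
      ring
    rw [laxPolar_of_mem hx, laxPolar_of_mem hy, map_smul, LinearMap.map_smul₂, Sg_add, pairL_Sg,
      smul_smul, smul_smul, smul_smul, h2, hc, ← pow_mul_pow_mul_inv_pow hk p q s, om_add]
    refine congrArg (fun r : ℂ => r • pairL P (A P x (p + s)) (Sg P m (A P y q))) ?_
    rw [pow_mul, show P.ω ^ m.val = om P m from rfl]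
    generalize x - om P m * y = d
    ring
  have h2 : ∑ q ∈ Finset.range (bound P), ∑ s ∈ Finset.range (bound P),
        ((-1) ^ s * ((q + s).choose s : ℂ) *
          (1 / (polePos P (k, x) - polePos P (0, 0))) ^ (q + s + 1)) •
        pairL P (laxPolar P (k, x) (p + s)) (laxPolar P (0, 0) q) =
      c • (T : ℂ) • hamTerm P x p 0 0 := by
    rw [hamTerm, Finset.smul_sum, Finset.smul_sum]
    refine Finset.sum_congr rfl fun q _ => ?_
    rw [Finset.smul_sum, Finset.smul_sum]
    refine Finset.sum_congr rfl fun s _ => ?_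
    rw [laxPolar_of_mem hx, laxPolar_zero, LinearMap.map_smul₂, pairL_Sg_A_zero,
      smul_smul, smul_smul, smul_smul, smul_smul, polePos, polePos, hc,
      ← pow_mul_pow_mul_inv_pow hk p q s, ZMod.val_zero, zero_mul, pow_zero, pow_zero,
      Module.End.one_apply]
    refine congrArg (fun r : ℂ => r • pairL P (A P x (p + s)) (A P (0 : ℂ) q)) ?_
    rw [mul_zero, mul_zero, sub_zero, sub_zero]
    have h3 : (T : ℂ)⁻¹ ^ 2 * T = (T : ℂ)⁻¹ := by field_simp
    linear_combination (-((-1) ^ s * ((q + s).choose s : ℂ) * om P k ^ (p + s) * om P k ^ q *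
      (om P k)⁻¹ ^ (q + s + 1) * (1 / x ^ (q + s + 1)))) * h3
  have h3 : ∑ q ∈ Finset.range (bound P), ∑ s ∈ Finset.range (bound P),
      ((q.choose s : ℂ) * polePos P (k, x) ^ (q - s)) •
        pairL P (laxPolar P (k, x) (p + s)) (laxPoly P q) =
      c • (T : ℂ) • ∑ q ∈ Finset.range (bound P), ∑ s ∈ Finset.range (bound P),
      ((q.choose s : ℂ) * x ^ (q - s)) •
        pairHat P (A P x (p + s)) (A P OnePoint.infty (q + 1)) := by
    rw [Finset.smul_sum, Finset.smul_sum]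
    refine Finset.sum_congr rfl fun q _ => ?_
    rw [Finset.smul_sum, Finset.smul_sum]
    refine Finset.sum_congr rfl fun s _ => ?_
    rw [laxPolar_of_mem hx, LinearMap.map_smul₂, pairL_Sg_A_infty,
      smul_smul, smul_smul, smul_smul, smul_smul, polePos, hc]
    refine congrArg (fun r : ℂ => r • pairL P (A P x (p + s)) (A P OnePoint.infty (q + 1))) ?_
    rcases Nat.lt_or_ge q s with h | h
    · simp [Nat.choose_eq_zero_of_lt h]
    · obtain ⟨r, rfl⟩ := Nat.exists_eq_add_of_le h
      rw [← pow_mul_pow_mul_inv_pow hk p r s, Nat.add_sub_cancel_left, mul_pow, add_comm s r]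
      field_simp
  have h4 : ∑ q ∈ Finset.range p, pairL P (laxPolar P (k, x) q) (laxPolar P (k, x) (p - q - 1)) =
      c • ∑ q ∈ Finset.range p, pairHat P (A P x q) (A P x (p - q - 1)) := by
    rw [Finset.smul_sum]
    refine Finset.sum_congr rfl fun q hq => ?_
    rw [laxPolar_of_mem hx, laxPolar_of_mem hx, map_smul, LinearMap.map_smul₂, pairL_Sg,
      smul_smul, hc]
    refine congrArg (fun r : ℂ => r • pairL P (A P x q) (A P x (p - q - 1))) ?_
    rw [Finset.mem_range] at hq
    obtain ⟨r, rfl⟩ := Nat.exists_eq_add_of_lt hq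
    rw [show q + r + 1 - q - 1 = r by omega, show ((q + r + 1 : ℕ) : ℤ) - 1 = ((q + r : ℕ) : ℤ) by
      push_cast; ring, zpow_natCast, pow_add]
    ring
  rw [squarePolar, h3, h4, hamFinite_eq hx, smul_comm (1 / 2 : ℂ)]
  have h5 : ∀ f : ZMod T × ℂ → SHat P, ∑ i ∈ (poles P).erase (k, x), f i =
      f (0, 0) + ∑ m : ZMod T, ∑ y ∈ pts' P, if m = 0 ∧ y = x then 0 else f (k + m, y) := by
    intro f
    have h6 : ∑ i ∈ (poles P).erase (k, x), f i =
        ∑ i ∈ (poles P).erase (k, x), if i = (k, x) then 0 else f i :=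
      Finset.sum_congr rfl fun i hi => (if_neg (Finset.ne_of_mem_erase hi)).symm
    rw [h6, Finset.sum_erase (f := fun i => if i = (k, x) then 0 else f i) _ (if_pos rfl),
      sum_poles, if_neg fun h => (mem_pts'.mp hx).1 (Prod.mk.inj h).2.symm]
    refine congrArg _ (Fintype.sum_equiv (Equiv.addLeft k) _ _ fun m => ?_).symm
    refine Finset.sum_congr rfl fun y _ => if_congr ?_ rfl rfl
    simp
  rw [h5, h2]
  have h7 : ∑ m : ZMod T, ∑ y ∈ pts' P, (if m = 0 ∧ y = x then 0 else
      ∑ q ∈ Finset.range (bound P), ∑ s ∈ Finset.range (bound P),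
        ((-1) ^ s * ((q + s).choose s : ℂ) *
          (1 / (polePos P (k, x) - polePos P (k + m, y))) ^ (q + s + 1)) •
        pairL P (laxPolar P (k, x) (p + s)) (laxPolar P (k + m, y) q)) =
      c • ∑ m : ZMod T, ∑ y ∈ pts' P, if m = 0 ∧ y = x then 0 else hamTerm P x p m y := by
    rw [Finset.smul_sum]
    refine Finset.sum_congr rfl fun m _ => ?_
    rw [Finset.smul_sum]
    refine Finset.sum_congr rfl fun y hy => ?_
    rw [h1 m y hy, smul_ite, smul_zero]
  rw [h7]
  module

end Coefficients

/-! ### Coefficients of the square at the fixed points -/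

section FixedPoints

variable [NeZero T] {P : DihedralGaudin T 𝔤} [FiniteDimensional ℂ 𝔤]

/-- the pairing of two homogeneous fields is invariant or zero -/
theorem pairL_weight {A B : Fld P} {a b n : ℤ} (hA : ∀ k, Sg P k A = om P k ^ a • A)
    (hB : ∀ k, Sg P k B = om P k ^ b • B) (h : (T : ℤ) ∣ n ↔ (T : ℤ) ∣ a + b) :
    pairL P A B = (if (T : ℤ) ∣ n then 1 else 0 : ℂ) • pairL P A B := by
  split_ifs with hn
  · rw [one_smul]
  · rw [pairL_eq_zero_of_weight (hA 1) (hB 1) (mt h.mpr hn), smul_zero]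

/-- Summing over the rotations of the other pole gives a sum of powers of `ω`, which is the
congruence `p ≡ 1` modulo `T`. -/
theorem squarePolar_origin (p : ℕ) :
    squarePolar (pairL P) (poles P) (polePos P) (laxPolar P) (laxPoly P) (bound P) (0, 0) p =
      (if (T : ℤ) ∣ (p : ℤ) - 1 then 1 else 0 : ℂ) • hamZero P p := by
  set δ : ℂ := if (T : ℤ) ∣ (p : ℤ) - 1 then 1 else 0 with hδ
  have h1 : ∑ i ∈ (poles P).erase (0, 0), ∑ q ∈ Finset.range (bound P),
      ∑ s ∈ Finset.range (bound P), ((-1) ^ s * ((q + s).choose s : ℂ) *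
          (1 / (polePos P (0, 0) - polePos P i)) ^ (q + s + 1)) •
        pairL P (laxPolar P (0, 0) (p + s)) (laxPolar P i q) =
      δ • ∑ x ∈ pts' P, ∑ q ∈ Finset.range (bound P), ∑ s ∈ Finset.range (bound P),
      ((-1) ^ (q + 1) * ((q + s).choose s : ℂ) / x ^ (q + s + 1)) •
        pairHat P (A P (0 : ℂ) (p + s)) (A P x q) := by
    rw [poles, Finset.erase_insert (by simp [zero_notMem_pts']), Finset.sum_product, hδ,
      ← sum_om_zpow (P := P), Finset.mul_sum, Finset.sum_smul]
    refine Finset.sum_congr rfl fun l _ => ?_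
    rw [Finset.smul_sum]
    refine Finset.sum_congr rfl fun y hy => ?_
    rw [Finset.smul_sum]
    refine Finset.sum_congr rfl fun q _ => ?_
    rw [Finset.smul_sum]
    refine Finset.sum_congr rfl fun s _ => ?_
    rw [laxPolar_of_mem hy, laxPolar_zero, map_smul, pairL_Sg_right, Sg_A_zero, neg_neg,
      LinearMap.map_smul₂ (pairL P), smul_smul, smul_smul, smul_smul,
      ← pow_mul_pow_mul_inv_pow (om_ne_zero l) p q s, polePos, polePos]
    refine congrArg (fun r : ℂ => r • pairL P (A P (0 : ℂ) (p + s)) (A P y q)) ?_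
    have h2 : (1 / (om P 0 * 0 - om P l * y)) ^ (q + s + 1) =
        (-1) ^ (q + s + 1) * ((om P l)⁻¹ ^ (q + s + 1) * (1 / y ^ (q + s + 1))) := by
      rw [mul_zero, zero_sub, one_div, inv_neg, neg_pow, mul_inv, mul_pow, inv_pow y, one_div]
    have h3 : (-1 : ℂ) ^ s * (-1) ^ s = 1 := by rw [← mul_pow]; norm_num
    rw [h2]
    linear_combination ((-1) ^ (q + 1) * ((q + s).choose s : ℂ) * (om P l)⁻¹ ^ (q + s + 1) *
      (1 / y ^ (q + s + 1)) * (T : ℂ)⁻¹ * om P l ^ q * om P l ^ (p + s)) * h3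
  have h2 : ∑ q ∈ Finset.range (bound P), ∑ s ∈ Finset.range (bound P),
      ((q.choose s : ℂ) * polePos P (0, 0) ^ (q - s)) •
        pairL P (laxPolar P (0, 0) (p + s)) (laxPoly P q) =
      δ • ∑ q ∈ Finset.range (bound P),
        pairHat P (A P (0 : ℂ) (p + q)) (A P OnePoint.infty (q + 1)) := by
    rw [Finset.smul_sum]
    refine Finset.sum_congr rfl fun q hq => ?_
    rw [Finset.sum_eq_single_of_mem q hq, Nat.choose_self, Nat.sub_self, pow_zero, Nat.cast_one,
      mul_one, one_smul, laxPolar_zero]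
    · refine pairL_weight (fun k => Sg_A_zero_zpow k _) (fun k => Sg_A_infty_zpow k _) ?_
      rw [show -((p + q : ℕ) : ℤ) + ((q + 1 : ℕ) : ℤ) = -((p : ℤ) - 1) by push_cast; ring, dvd_neg]
    · intro s _ hs
      rcases Nat.lt_or_gt_of_ne hs with h | h
      · rw [polePos, mul_zero, zero_pow (by omega), mul_zero, zero_smul]
      · rw [Nat.choose_eq_zero_of_lt h, Nat.cast_zero, zero_mul, zero_smul]
  have h3 : ∑ q ∈ Finset.range p, pairL P (laxPolar P (0, 0) q) (laxPolar P (0, 0) (p - q - 1)) =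
      δ • ∑ q ∈ Finset.range p, pairHat P (A P (0 : ℂ) (p - q - 1)) (A P (0 : ℂ) q) := by
    rw [Finset.smul_sum]
    refine Finset.sum_congr rfl fun q hq => ?_
    rw [laxPolar_zero, laxPolar_zero, pairL_symm]
    refine pairL_weight (fun k => Sg_A_zero_zpow k _) (fun k => Sg_A_zero_zpow k _) ?_
    rw [Finset.mem_range] at hq
    rw [show -((p - q - 1 : ℕ) : ℤ) + -((q : ℕ) : ℤ) = -((p : ℤ) - 1) by omega, dvd_neg]
  rw [squarePolar, h1, h2, h3, hamZero]
  module

/-- At infinity the sum over rotations gives the congruence `q + 2 ≡ 0` modulo `T`. -/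
theorem squarePoly_eq (q : ℕ) :
    squarePoly (pairL P) (poles P) (polePos P) (laxPolar P) (laxPoly P) (bound P) q =
      (if (T : ℤ) ∣ (q : ℤ) + 2 then 1 else 0 : ℂ) • hamInfty P q := by
  set δ : ℂ := if (T : ℤ) ∣ (q : ℤ) + 2 then 1 else 0 with hδ
  have h1 : ∑ l : ZMod T, ∑ x ∈ pts' P, ∑ p ∈ Finset.range (bound P),
      ∑ s ∈ Finset.range (bound P), ((s.choose p : ℂ) * polePos P (l, x) ^ (s - p)) •
        pairL P (laxPolar P (l, x) p) (laxPoly P (q + s + 1)) =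
      δ • ∑ x ∈ pts' P, ∑ p ∈ Finset.range (bound P), ∑ s ∈ Finset.range (bound P),
      ((s.choose p : ℂ) * x ^ (s - p)) •
        pairHat P (A P x p) (A P OnePoint.infty (q + s + 2)) := by
    have h2 : δ = (T : ℂ)⁻¹ * ∑ k, om P k ^ (-((q : ℤ) + 2)) := by
      rw [sum_om_zpow, hδ]
      exact if_congr (dvd_neg).symm rfl rfl
    rw [h2, Finset.mul_sum, Finset.sum_smul]
    refine Finset.sum_congr rfl fun l _ => ?_
    rw [Finset.smul_sum]
    refine Finset.sum_congr rfl fun y hy => ?_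
    rw [Finset.smul_sum]
    refine Finset.sum_congr rfl fun p _ => ?_
    rw [Finset.smul_sum]
    refine Finset.sum_congr rfl fun s _ => ?_
    rw [laxPolar_of_mem hy, LinearMap.map_smul₂ (pairL P), pairL_Sg_A_infty, smul_smul, smul_smul,
      smul_smul, polePos]
    refine congrArg (fun r : ℂ => r • pairL P (A P y p) (A P OnePoint.infty (q + s + 2))) ?_
    rcases Nat.lt_or_ge s p with h | h
    · simp [Nat.choose_eq_zero_of_lt h]
    · obtain ⟨r, rfl⟩ := Nat.exists_eq_add_of_le h
      have hl := om_ne_zero (P := P) l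
      have h3 : om P l ^ (-((q : ℤ) + 2)) = (om P l)⁻¹ ^ (q + 2) := by
        rw [zpow_neg, inv_pow, ← zpow_natCast]
        push_cast
        rfl
      have h4 : (om P l ^ p * om P l ^ r) * (om P l)⁻¹ ^ (q + (p + r) + 1 + 1) =
          (om P l)⁻¹ ^ (q + 2) := by
        rw [show q + (p + r) + 1 + 1 = (p + r) + (q + 2) by ring, pow_add _ (p + r), ← pow_add,
          ← mul_assoc, ← mul_pow, mul_inv_cancel₀ hl, one_pow, one_mul]
      rw [h3, ← h4, Nat.add_sub_cancel_left, mul_pow]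
      ring
  have h2 : ∑ p ∈ Finset.range (bound P), ∑ s ∈ Finset.range (bound P),
      ((s.choose p : ℂ) * polePos P (0, 0) ^ (s - p)) •
        pairL P (laxPolar P (0, 0) p) (laxPoly P (q + s + 1)) =
      δ • ∑ p ∈ Finset.range (bound P),
        pairHat P (A P (0 : ℂ) p) (A P OnePoint.infty (q + p + 2)) := by
    rw [Finset.smul_sum]
    refine Finset.sum_congr rfl fun p hp => ?_
    rw [Finset.sum_eq_single_of_mem p hp, Nat.choose_self, Nat.sub_self, pow_zero, Nat.cast_one,
      mul_one, one_smul, laxPolar_zero]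
    · refine pairL_weight (fun k => Sg_A_zero_zpow k _) (fun k => Sg_A_infty_zpow k _) ?_
      rw [show -((p : ℕ) : ℤ) + ((q + p + 1 + 1 : ℕ) : ℤ) = (q : ℤ) + 2 by push_cast; ring]
    · intro s _ hs
      rcases Nat.lt_or_gt_of_ne hs with h | h
      · rw [Nat.choose_eq_zero_of_lt h, Nat.cast_zero, zero_mul, zero_smul]
      · rw [polePos, mul_zero, zero_pow (by omega), mul_zero, zero_smul]
  have h3 : ∑ p ∈ Finset.range (q + 1), pairL P (laxPoly P p) (laxPoly P (q - p)) =
      δ • ∑ p ∈ Finset.range (q + 1),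
        pairHat P (A P OnePoint.infty (p + 1)) (A P OnePoint.infty (q - p + 1)) := by
    rw [Finset.smul_sum]
    refine Finset.sum_congr rfl fun p hp => ?_
    refine pairL_weight (fun k => Sg_A_infty_zpow k _) (fun k => Sg_A_infty_zpow k _) ?_
    rw [Finset.mem_range] at hp
    rw [show ((p + 1 : ℕ) : ℤ) + ((q - p + 1 : ℕ) : ℤ) = (q : ℤ) + 2 by omega]
  rw [squarePoly, sum_poles, h1, h2, h3, hamInfty]
  module

end FixedPoints

/-! ### Expansion of half the square of the Lax matrix -/

section Hamiltonians

variable [NeZero T] (P : DihedralGaudin T 𝔤) [FiniteDimensional ℂ 𝔤]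

open Classical in
/-- the polar coefficients of `(L(z) | L(z)) / 2` -/
def hamPolar (j : ZMod T × ℂ) (p : ℕ) : SHat P :=
  if j.2 = 0 then (if (T : ℤ) ∣ (p : ℤ) - 1 then 1 else 0 : ℂ) • Ham P (0 : ℂ) p
  else ((T : ℂ)⁻¹ ^ 2 * om P j.1 ^ ((p : ℤ) - 1)) • Ham P j.2 p

/-- the polynomial coefficients of `(L(z) | L(z)) / 2` -/
def hamPoly (q : ℕ) : SHat P :=
  (if (T : ℤ) ∣ (q : ℤ) + 2 then 1 else 0 : ℂ) • Ham P OnePoint.infty q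

variable {P}

theorem Ham_zero (p : ℕ) : Ham P (0 : ℂ) p = hamZero P p := if_pos rfl

theorem Ham_of_mem {x : ℂ} (hx : x ∈ pts' P) (p : ℕ) : Ham P x p = hamFinite P x p :=
  if_neg (mem_pts'.mp hx).1

theorem Ham_infty (p : ℕ) : Ham P OnePoint.infty p = hamInfty P p := rfl

theorem hamPolar_zero (p : ℕ) : hamPolar P (0, 0) p =
    (if (T : ℤ) ∣ (p : ℤ) - 1 then 1 else 0 : ℂ) • Ham P (0 : ℂ) p := if_pos rfl

theorem hamPolar_of_mem {x : ℂ} (hx : x ∈ pts' P) (k : ZMod T) (p : ℕ) :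
    hamPolar P (k, x) p = ((T : ℂ)⁻¹ ^ 2 * om P k ^ ((p : ℤ) - 1)) • Ham P x p :=
  if_neg (mem_pts'.mp hx).1

/-- Partial fraction expansion of `(L(z) | L(z)) / 2`. -/
theorem half_square_Lax {z : ℂ} (hz : z ∈ regular P) :
    (1 / 2 : ℂ) • pairL P (Lax P z) (Lax P z) =
      ∑ j ∈ poles P, ∑ p ∈ Finset.range (2 * bound P),
        (1 / (z - polePos P j) ^ (p + 1)) • hamPolar P j p +
      ∑ q ∈ Finset.range (2 * bound P), z ^ q • hamPoly P q := by
  rw [Lax_eq_ratFun]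
  refine (half_square (V := Fld P) (W := SHat P) (β := pairL P) (C := laxPoly P)
    (pairL_symm (P := P)) polePos_injOn laxPolar_of_bound_le
    (fun q hq => A_of_bound_le _ (hq.trans q.le_succ)) (pole_ne hz)).trans ?_
  refine congrArg₂ _ ?_ ?_
  · refine Finset.sum_congr rfl fun j hj => Finset.sum_congr rfl fun p _ => ?_
    rw [poles, Finset.mem_insert, Finset.mem_product] at hj
    rcases hj with rfl | ⟨-, hj⟩
    · rw [hamPolar_zero, Ham_zero, ← squarePolar_origin]
    · obtain ⟨k, x⟩ := j
      rw [hamPolar_of_mem hj, Ham_of_mem hj, ← squarePolar_orbit hj]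
  · refine Finset.sum_congr rfl fun q _ => ?_
    rw [hamPoly, Ham_infty, ← squarePoly_eq]

/-- The Hamiltonians are the coefficients of half the square of the Lax matrix. -/
theorem half_square_Lax_eq {z : ℂ} (hz : z ∈ regular P) :
    (1 / 2 : ℂ) • pairHat P (Lax P z) (Lax P z) =
      (1 / (T : ℂ) ^ 2) • ∑ k ∈ Finset.range T, ∑ x ∈ pts' P,
          ∑ p ∈ Finset.range (2 * bound P),
            (P.ω ^ (k * ((p : ℤ) - 1)) / (z - P.ω ^ k * x) ^ (p + 1)) • Ham P x p +
        ∑ p ∈ Finset.range (2 * bound P) with p ≡ 1 [MOD T],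
          (1 / z ^ (p + 1)) • Ham P (0 : ℂ) p +
        ∑ q ∈ Finset.range (2 * bound P) with T ∣ q + 2,
          z ^ q • Ham P OnePoint.infty q := by
  refine (half_square_Lax hz).trans ?_
  rw [sum_poles, sum_range_zmod (T := T), add_comm (Finset.sum _ _) (Finset.sum Finset.univ _)]
  refine congrArg₂ _ (congrArg₂ _ ?_ ?_) ?_
  · rw [Finset.smul_sum]
    refine Finset.sum_congr rfl fun k _ => ?_
    rw [Finset.smul_sum]
    refine Finset.sum_congr rfl fun x hx => ?_
    rw [Finset.smul_sum]
    refine Finset.sum_congr rfl fun p _ => ?_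
    rw [hamPolar_of_mem hx, smul_smul, smul_smul, polePos, zpow_mul, zpow_natCast]
    refine congrArg (fun r : ℂ => r • Ham P x p) ?_
    rw [om]
    ring
  · rw [Finset.sum_filter]
    refine Finset.sum_congr rfl fun p _ => ?_
    rw [hamPolar_zero, polePos, mul_zero, sub_zero]
    simp only [modEq_one_iff]
    split_ifs <;> simp
  · rw [Finset.sum_filter]
    refine Finset.sum_congr rfl fun q _ => ?_
    rw [hamPoly]
    simp only [dvd_add_two_iff]
    split_ifs <;> simp

end Hamiltonians

/-! ### Lax equations of the coefficients -/

section LaxEquations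

variable [NeZero T] {P : DihedralGaudin T 𝔤}

/-- All but finitely many points are regular, so partial fraction coefficients can be compared on
the regular points. -/
theorem finite_compl_regular : (regular P)ᶜ.Finite := by
  have h : (regular P)ᶜ = ⋃ x ∈ P.level.support, ⋃ α : DihedralGroup T,
      ((↑) : ℂ → OnePoint ℂ) ⁻¹' {mobius P.ω α x} := by
    ext z
    simp [regular, eq_comm]
  rw [h]
  exact Set.Finite.biUnion (Finset.finite_toSet _) fun x _ => Set.finite_iUnion fun α =>
    (Set.finite_singleton _).preimage OnePoint.coe_injective.injOn

variable [FiniteDimensional ℂ 𝔤]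

theorem auxL_self (A : Fld P) : auxL P A A = 0 :=
  auxS_ext fun Y => by rw [evA_auxL, pairL_adHat_self, map_zero]

theorem smul_map_of_smul_sub {M : Type*} [AddCommGroup M] [Module ℂ M] (f : M →ₗ[ℂ] M) {c d : ℂ}
    {u v v' r : M} (hv : f v = v') (h : c • (u - d • v) = r) : c • f u = (c * d) • v' + f r := by
  rw [← h, map_smul, map_sub, map_smul, hv]
  module

theorem eq_of_add_neg_one_smul {M : Type*} [AddCommGroup M] [Module ℂ M] {u v : M}
    (h : u + (-1 : ℂ) • v = 0) : u = v := by
  rwa [neg_one_smul, ← sub_eq_add_neg, sub_eq_zero] at h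

theorem sub_eq_zero_of_add {M : Type*} [AddCommGroup M] [Module ℂ M] {u u' v v' : M}
    (h : u + u' = v + v') : u + (-1 : ℂ) • v + (u' + (-1 : ℂ) • v') = 0 := by
  rw [add_add_add_comm, h, ← smul_add, neg_one_smul, add_neg_cancel]

variable (P) in
/-- the polar coefficients of `genMat P w z` as a function of `w` -/
def matPolar (z : ℂ) (j : ZMod T × ℂ) (p : ℕ) : Fld P :=
  (T : ℂ)⁻¹ • ∑ m, Sg P (-m) (∑ s ∈ Finset.range (bound P),
    (1 / (om P m * z - polePos P j) ^ (s + 1)) • laxPolar P j (p + s))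

variable (P) in
/-- the polynomial coefficients of `genMat P w z` as a function of `w` -/
def matPoly (z : ℂ) (q : ℕ) : Fld P :=
  (T : ℂ)⁻¹ • ∑ m, Sg P (-m) (∑ s ∈ Finset.range (bound P),
    (om P m * z) ^ s • laxPoly P (q + s + 1))

/-- Partial fraction expansion of `genMat P w z` in `w`. Its poles at the points `ω ^ m z`
have multiples of `L(z)` as residues and are collected in the first term. -/
theorem genMat_eq {z w : ℂ} (hz : z ∈ regular P) (hw : w ∈ regular P)
    (hwz : ∀ m, w ≠ om P m * z) : ∃ c : ℂ, genMat P w z = c • Lax P z +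
      (∑ j ∈ poles P, ∑ p ∈ Finset.range (2 * bound P),
        (1 / (w - polePos P j) ^ (p + 1)) • matPolar P z j p +
      ∑ q ∈ Finset.range (2 * bound P), w ^ q • matPoly P z q) := by
  have h1 : ∀ m : ZMod T, (1 / (om P m * z - w)) • Sg P (-m) (Lax P w) =
      (1 / (om P m * z - w) * om P (-m)) • Lax P z +
      (∑ j ∈ poles P, ∑ p ∈ Finset.range (2 * bound P), (1 / (w - polePos P j) ^ (p + 1)) •
          Sg P (-m) (∑ s ∈ Finset.range (bound P),
            (1 / (om P m * z - polePos P j) ^ (s + 1)) • laxPolar P j (p + s)) +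
        ∑ q ∈ Finset.range (2 * bound P), w ^ q • Sg P (-m) (∑ s ∈ Finset.range (bound P),
          (om P m * z) ^ s • laxPoly P (q + s + 1))) := by
    intro m
    -- subtracting `L(ω ^ m z)` removes the pole at `w = ω ^ m z` and costs a multiple of `L(z)`
    have h2 := ratFun_difference (V := Fld P) (J := poles P) (a := polePos P) (B := laxPolar P)
      (C := laxPoly P) laxPolar_of_bound_le
      (fun q hq => A_of_bound_le _ (hq.trans q.le_succ)) (pole_ne hw)
      (pole_ne (regular_mul hz m)) (hwz m) (M := 2 * bound P) (by omega)
    rw [← Lax_eq_ratFun, ← Lax_eq_ratFun, Lax_om_mul] at h2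
    refine (smul_map_of_smul_sub (M := Fld P) (Sg P (-m)) (v := Sg P m (Lax P z))
      (by rw [← Sg_add, neg_add_cancel, Sg_zero]) h2).trans ?_
    simp only [map_add, map_sum, map_smul]
  refine ⟨(T : ℂ)⁻¹ * ∑ m, 1 / (om P m * z - w) * om P (-m), ?_⟩
  rw [genMat, Finset.sum_congr rfl fun m _ => h1 m, Finset.sum_add_distrib, Finset.sum_add_distrib,
    smul_add, smul_add, mul_smul, Finset.sum_smul]
  refine congrArg₂ _ rfl (congrArg₂ _ ?_ ?_)
  · rw [Finset.sum_comm, Finset.smul_sum]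
    refine Finset.sum_congr rfl fun j _ => ?_
    rw [Finset.sum_comm, Finset.smul_sum]
    refine Finset.sum_congr rfl fun p _ => ?_
    rw [matPolar, ← Finset.smul_sum, smul_comm]
  · rw [Finset.sum_comm, Finset.smul_sum]
    refine Finset.sum_congr rfl fun p _ => ?_
    rw [matPoly, ← Finset.smul_sum, smul_comm]

/-- The Lax equation of `(L(w) | L(w)) / 2` holds for each coefficient of its expansion in `w`. -/
theorem lax_equations {z : ℂ} (hz : z ∈ regular P) :
    (∀ j ∈ poles P, ∀ p < 2 * bound P,
      actL P (hamPolar P j p) (Lax P z) = auxL P (matPolar P z j p) (Lax P z)) ∧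
    ∀ q < 2 * bound P, actL P (hamPoly P q) (Lax P z) = auxL P (matPoly P z q) (Lax P z) := by
  have key := partialFractions_unique (W := AuxS P) (J := poles P) (a := polePos P)
    (N := 2 * bound P)
    (c := fun j p => actL P (hamPolar P j p) (Lax P z) +
      (-1 : ℂ) • auxL P (matPolar P z j p) (Lax P z))
    (d := fun q => actL P (hamPoly P q) (Lax P z) + (-1 : ℂ) • auxL P (matPoly P z q) (Lax P z))
    -- the generic Lax equation excludes the singular points and the orbit of `z`
    (Z := (regular P)ᶜ ∪ Set.range fun m => om P m * z)
    polePos_injOn (finite_compl_regular.union (Set.finite_range _)) (fun w hw _ => by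
      rw [Set.mem_union, not_or, Set.notMem_compl_iff] at hw
      have hwz : ∀ m, w ≠ om P m * z := fun m h => hw.2 ⟨m, h.symm⟩
      have h1 := actL_half_square hz hw.1 hwz
      obtain ⟨c, hc⟩ := genMat_eq hz hw.1 hwz
      rw [half_square_Lax hw.1, hc] at h1
      -- the term `c • L(z)` of `genMat` commutes with `L(z)`
      simp only [map_add, map_sum, map_smul, LinearMap.add_apply, LinearMap.sum_apply,
        LinearMap.smul_apply, auxL_self, smul_zero, zero_add] at h1
      simp only [smul_add, Finset.sum_add_distrib, smul_comm _ (-1 : ℂ), ← Finset.smul_sum]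
      exact sub_eq_zero_of_add (M := AuxS P) h1)
  exact ⟨fun j hj p hp => eq_of_add_neg_one_smul (M := AuxS P) (key.1 j hj p hp),
    fun q hq => eq_of_add_neg_one_smul (M := AuxS P) (key.2 q hq)⟩

end LaxEquations

/-! ### Lax equations and involution of the Hamiltonians -/

section Conclusion

variable [NeZero T] {P : DihedralGaudin T 𝔤} [FiniteDimensional ℂ 𝔤]

theorem pairHat_of_left {X : Fld P} (h : X = 0) (Y : Fld P) : pairHat P X Y = 0 := by
  rw [h]
  exact LinearMap.map_zero₂ (pairL P) Y

theorem pairHat_of_right (X : Fld P) {Y : Fld P} (h : Y = 0) : pairHat P X Y = 0 := by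
  rw [h]
  exact map_zero (pairL P X)

/-- All pairings in the Hamiltonians of large index contain a vanishing field. -/
theorem Ham_of_two_mul_bound_le (x : OnePoint ℂ) {p : ℕ} (h : 2 * bound P ≤ p) :
    Ham P x p = 0 := by
  have h0 : ∀ (x : OnePoint ℂ) {n : ℕ}, bound P ≤ n → A P x n = 0 :=
    fun x _ hn => A_of_bound_le x hn
  induction x using OnePoint.rec with
  | infty =>
    rw [Ham_infty, hamInfty, Finset.sum_eq_zero fun x _ => Finset.sum_eq_zero fun p _ =>
      Finset.sum_eq_zero fun s _ => ?_, Finset.sum_eq_zero fun p _ => ?_,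
      Finset.sum_eq_zero fun q _ => ?_]
    · module
    · rcases Nat.lt_or_ge q (bound P) with hq | hq
      · exact pairHat_of_right _ (h0 _ (by omega))
      · exact pairHat_of_left (h0 _ (by omega)) _
    · exact pairHat_of_right _ (h0 _ (by omega))
    · rw [pairHat_of_right _ (h0 _ (by omega)), smul_zero]
  | coe x =>
    by_cases hx : x = 0
    · subst hx
      rw [Ham_zero, hamZero, Finset.sum_eq_zero fun x _ => Finset.sum_eq_zero fun p _ =>
        Finset.sum_eq_zero fun s _ => ?_, Finset.sum_eq_zero fun p _ => ?_,
        Finset.sum_eq_zero fun q _ => ?_]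
      · module
      · rcases Nat.lt_or_ge q (bound P) with hq | hq
        · exact pairHat_of_left (h0 _ (by omega)) _
        · exact pairHat_of_right _ (h0 _ (by omega))
      · exact pairHat_of_left (h0 _ (by omega)) _
      · rw [pairHat_of_left (h0 _ (by omega)), smul_zero]
    · rw [show Ham P x p = hamFinite P x p from if_neg hx, hamFinite,
        Finset.sum_eq_zero fun l _ => Finset.sum_eq_zero fun y _ => ?_,
        Finset.sum_eq_zero fun q _ => Finset.sum_eq_zero fun s _ => ?_,
        Finset.sum_eq_zero fun q _ => ?_]
      · module
      · rcases Nat.lt_or_ge q (bound P) with hq | hq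
        · exact pairHat_of_right _ (h0 _ (by omega))
        · exact pairHat_of_left (h0 _ (by omega)) _
      · rw [pairHat_of_left (h0 _ (by omega)), smul_zero]
      · rw [ite_eq_left_iff]
        intro _
        refine Finset.sum_eq_zero fun q _ => Finset.sum_eq_zero fun s _ => ?_
        rw [pairHat_of_left (h0 _ (by omega)), smul_zero]

theorem Mat_zero (p : ℕ) (z : ℂ) : Mat P (0 : ℂ) p z =
    ∑ s ∈ Finset.range (bound P), (1 / z ^ (s + 1)) • A P (0 : ℂ) (p + s) := if_pos rfl

theorem Mat_of_ne {x : ℂ} (hx : x ≠ 0) (p : ℕ) (z : ℂ) : Mat P x p z =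
    ∑ l ∈ Finset.range T, ∑ s ∈ Finset.range (bound P),
      (1 / (P.ω⁻¹ ^ l * z - x) ^ (s + 1)) • (sigHat P ^ l) (A P x (p + s)) := if_neg hx

theorem Mat_of_bound_le (x : OnePoint ℂ) {p : ℕ} (h : bound P ≤ p) (z : ℂ) : Mat P x p z = 0 := by
  have h0 : ∀ (x : OnePoint ℂ) {n : ℕ}, bound P ≤ n → A P x n = 0 :=
    fun x _ hn => A_of_bound_le x hn
  induction x using OnePoint.rec with
  | infty => exact Finset.sum_eq_zero fun s _ => by rw [h0 _ (by omega), smul_zero]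
  | coe x =>
    by_cases hx : x = 0
    · subst hx
      rw [Mat_zero]
      exact Finset.sum_eq_zero fun s _ => by rw [h0 _ (by omega), smul_zero]
    · rw [Mat_of_ne hx]
      exact Finset.sum_eq_zero fun l _ => Finset.sum_eq_zero fun s _ => by
        rw [h0 _ (by omega), map_zero, smul_zero]

theorem matPolar_of_mem {x : ℂ} (hx : x ∈ pts' P) (p : ℕ) (z : ℂ) :
    matPolar P z (0, x) p = (T : ℂ)⁻¹ ^ 2 • Mat P x p z := by
  rw [matPolar, Mat_of_ne (mem_pts'.mp hx).1, sum_range_zmod, pow_two, mul_smul]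
  refine congrArg (fun v : Fld P => (T : ℂ)⁻¹ • v) ?_
  rw [Finset.smul_sum]
  refine Fintype.sum_equiv (Equiv.neg (ZMod T)) _ _ fun m => ?_
  rw [Finset.smul_sum, map_sum]
  refine Finset.sum_congr rfl fun s _ => ?_
  rw [laxPolar_of_mem hx, om_zero, one_pow, mul_one, Sg_zero, map_smul, map_smul, smul_comm,
    polePos, om_zero, one_mul, Equiv.neg_apply, inv_pow]
  rw [show (P.ω ^ (-m).val)⁻¹ = om P m by
    rw [← om, om_neg, inv_inv], ← Sg]

/-- At the origin the congruence makes the average over the cyclic group trivial. -/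
theorem matPolar_origin {p : ℕ} (hp : (T : ℤ) ∣ (p : ℤ) - 1) (z : ℂ) :
    matPolar P z (0, 0) p = Mat P (0 : ℂ) p z := by
  have hT : (T : ℂ) ≠ 0 := Nat.cast_ne_zero.mpr (NeZero.ne T)
  have h1 : ∀ m : ZMod T, Sg P (-m) (∑ s ∈ Finset.range (bound P),
      (1 / (om P m * z - polePos P (0, 0)) ^ (s + 1)) • laxPolar P (0, 0) (p + s)) =
      Mat P (0 : ℂ) p z := by
    intro m
    rw [Mat_zero, map_sum]
    refine Finset.sum_congr rfl fun s _ => ?_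
    rw [map_smul, laxPolar_zero, Sg_A_zero, neg_neg, smul_smul, polePos, mul_zero, sub_zero]
    refine congrArg (fun r : ℂ => r • A P (0 : ℂ) (p + s)) ?_
    have hm := om_ne_zero (P := P) m
    have h2 : om P m ^ p = om P m := by
      have h3 := om_zpow_eq_one (P := P) m hp
      rw [zpow_sub_one₀ hm, zpow_natCast] at h3
      exact (mul_inv_eq_one₀ hm).mp h3
    rw [pow_add _ p, h2, mul_pow, pow_succ']
    field_simp
  rw [matPolar, Finset.sum_congr rfl fun m _ => h1 m, Finset.sum_const, Finset.card_univ,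
    ZMod.card, ← Nat.cast_smul_eq_nsmul ℂ, smul_smul, inv_mul_cancel₀ hT, one_smul]

theorem matPoly_eq {q : ℕ} (hq : (T : ℤ) ∣ (q : ℤ) + 2) (z : ℂ) :
    matPoly P z q = Mat P OnePoint.infty q z := by
  have hT : (T : ℂ) ≠ 0 := Nat.cast_ne_zero.mpr (NeZero.ne T)
  have h1 : ∀ m : ZMod T, Sg P (-m) (∑ s ∈ Finset.range (bound P),
      (om P m * z) ^ s • laxPoly P (q + s + 1)) = Mat P OnePoint.infty q z := by
    intro m
    rw [map_sum]
    refine Finset.sum_congr rfl fun s _ => ?_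
    rw [map_smul, Sg_A_infty, smul_smul, om_neg]
    refine congrArg (fun r : ℂ => r • A P OnePoint.infty (q + s + 2)) ?_
    have hm := om_ne_zero (P := P) m
    have h2 : om P m ^ (q + 2) = 1 := by
      have h3 := om_zpow_eq_one (P := P) m hq
      rw [← zpow_natCast]
      push_cast
      exact h3
    rw [show q + s + 1 + 1 = s + (q + 2) by ring, pow_add, inv_pow, inv_pow, h2, mul_pow]
    field_simp
  rw [matPoly, Finset.sum_congr rfl fun m _ => h1 m, Finset.sum_const, Finset.card_univ,
    ZMod.card, ← Nat.cast_smul_eq_nsmul ℂ, smul_smul, inv_mul_cancel₀ hT, one_smul]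

/-- Case distinction for the labels of the Hamiltonians below the degree bound, above
which all of them vanish. -/
theorem index_cases {Q : OnePoint ℂ → ℕ → Prop} (hbig : ∀ x p, 2 * bound P ≤ p → Q x p)
    (hfin : ∀ x ∈ pts' P, ∀ p < 2 * bound P, Q x p)
    (hzero : ∀ p < 2 * bound P, (T : ℤ) ∣ (p : ℤ) - 1 → Q (0 : ℂ) p)
    (hinf : ∀ q < 2 * bound P, (T : ℤ) ∣ (q : ℤ) + 2 → Q OnePoint.infty q)
    (a : OnePoint ℂ × ℕ) (ha : a ∈ index P) : Q a.1 a.2 := by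
  obtain ⟨x, p⟩ := a
  obtain ⟨h1, h2, h3⟩ := ha
  rcases Nat.lt_or_ge p (2 * bound P) with hp | hp
  · induction x using OnePoint.rec with
    | infty => exact hinf p hp ((dvd_add_two_iff p).mp (h3 rfl))
    | coe x =>
      by_cases hx : x = 0
      · subst hx
        exact hzero p hp ((modEq_one_iff p).mp (h2 rfl))
      · exact hfin x (mem_pts'.mpr ⟨hx, h1⟩) p hp
  · exact hbig x p hp

theorem orbit_mem_poles {x : ℂ} (hx : x ∈ pts' P) (k : ZMod T) : (k, x) ∈ poles P :=
  Finset.mem_insert_of_mem (Finset.mem_product.mpr ⟨Finset.mem_univ k, hx⟩)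

theorem origin_mem_poles : ((0, 0) : ZMod T × ℂ) ∈ poles P := Finset.mem_insert_self _ _

theorem inv_sq_ne_zero : (T : ℂ)⁻¹ ^ 2 ≠ 0 :=
  pow_ne_zero 2 (inv_ne_zero (Nat.cast_ne_zero.mpr (NeZero.ne T)))

theorem hamPolar_orbit {x : ℂ} (hx : x ∈ pts' P) (p : ℕ) :
    hamPolar P (0, x) p = (T : ℂ)⁻¹ ^ 2 • Ham P x p := by
  rw [hamPolar_of_mem hx, om_zero, one_zpow, mul_one]

/-- The Hamiltonians generate Lax equations. -/
theorem lax_equation (a : OnePoint ℂ × ℕ) (ha : a ∈ index P) {z : ℂ} (hz : z ∈ regular P) :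
    actL P (Ham P a.1 a.2) (Lax P z) = auxL P (Mat P a.1 a.2 z) (Lax P z) := by
  refine index_cases (Q := fun x p => actL P (Ham P x p) (Lax P z) = auxL P (Mat P x p z) (Lax P z))
    ?_ ?_ ?_ ?_ a ha
  · intro x p h
    rw [Ham_of_two_mul_bound_le x h, Mat_of_bound_le x (by omega), map_zero, map_zero]
  · intro x hx p hp
    have h := (lax_equations hz).1 _ (orbit_mem_poles hx 0) p hp
    rw [hamPolar_orbit hx, matPolar_of_mem hx, map_smul, map_smul] at h
    exact smul_right_injective (AuxS P) (inv_sq_ne_zero (T := T)) h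
  · intro p hp hp'
    have h := (lax_equations hz).1 _ origin_mem_poles p hp
    rwa [hamPolar_zero, if_pos hp', one_smul, matPolar_origin hp'] at h
  · intro q hq hq'
    have h := (lax_equations hz).2 q hq
    rwa [hamPoly, if_pos hq', one_smul, matPoly_eq hq'] at h

/-- Half the square of the Lax matrix is conserved by every Hamiltonian, because the flow of the
Hamiltonian is given by a Lax equation. -/
theorem poissonL_half_square (a : OnePoint ℂ × ℕ) (ha : a ∈ index P) {w : ℂ}
    (hw : w ∈ regular P) :
    poissonL P (Ham P a.1 a.2) ((1 / 2 : ℂ) • pairL P (Lax P w) (Lax P w)) = 0 := by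
  rw [map_smul, poissonL_pairL_right, lax_equation a ha hw, tripL_auxL_self, add_zero, smul_zero]

/-- Comparison of coefficients in `poissonL_half_square`. -/
theorem poissonL_coefficients (a : OnePoint ℂ × ℕ) (ha : a ∈ index P) :
    (∀ j ∈ poles P, ∀ p < 2 * bound P, poissonL P (Ham P a.1 a.2) (hamPolar P j p) = 0) ∧
    ∀ q < 2 * bound P, poissonL P (Ham P a.1 a.2) (hamPoly P q) = 0 := by
  refine partialFractions_unique (W := SHat P) (a := polePos P) polePos_injOn
    (finite_compl_regular (P := P)) fun w hw _ => ?_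
  rw [Set.notMem_compl_iff] at hw
  have h := poissonL_half_square a ha hw
  rw [half_square_Lax hw] at h
  simpa only [map_add, map_sum, map_smul] using h

/-- The Hamiltonians Poisson commute. -/
theorem poissonL_Ham (a : OnePoint ℂ × ℕ) (ha : a ∈ index P) (b : OnePoint ℂ × ℕ)
    (hb : b ∈ index P) : poissonL P (Ham P a.1 a.2) (Ham P b.1 b.2) = 0 := by
  refine index_cases (Q := fun x p => poissonL P (Ham P a.1 a.2) (Ham P x p) = 0) ?_ ?_ ?_ ?_ b hb
  · intro x p h
    rw [Ham_of_two_mul_bound_le x h, map_zero]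
  · intro x hx p hp
    have h := (poissonL_coefficients a ha).1 _ (orbit_mem_poles hx 0) p hp
    rw [hamPolar_orbit hx, map_smul] at h
    exact (smul_eq_zero.mp h).resolve_left (inv_sq_ne_zero (T := T))
  · intro p hp hp'
    have h := (poissonL_coefficients a ha).1 _ origin_mem_poles p hp
    rwa [hamPolar_zero, if_pos hp', one_smul] at h
  · intro q hq hq'
    have h := (poissonL_coefficients a ha).2 q hq
    rwa [hamPoly, if_pos hq', one_smul] at h

end Conclusion

end Gaudin

end

theorem mainTheorem2 {T : ℕ} [NeZero T] {𝔤 : Type*} [LieRing 𝔤] [LieAlgebra ℂ 𝔤]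
    [FiniteDimensional ℂ 𝔤] (P : Gaudin.DihedralGaudin T 𝔤) :
    (∀ z ∈ Gaudin.regular P,
      (1 / 2 : ℂ) • Gaudin.pairHat P (Gaudin.Lax P z) (Gaudin.Lax P z) =
        (1 / (T : ℂ) ^ 2) • ∑ k ∈ Finset.range T, ∑ x ∈ Gaudin.pts' P,
            ∑ p ∈ Finset.range (2 * Gaudin.bound P),
              (P.ω ^ (k * ((p : ℤ) - 1)) / (z - P.ω ^ k * x) ^ (p + 1)) • Gaudin.Ham P x p +
          ∑ p ∈ Finset.range (2 * Gaudin.bound P) with p ≡ 1 [MOD T],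
            (1 / z ^ (p + 1)) • Gaudin.Ham P (0 : ℂ) p +
          ∑ q ∈ Finset.range (2 * Gaudin.bound P) with T ∣ q + 2,
            z ^ q • Gaudin.Ham P OnePoint.infty q) ∧
    (∀ a ∈ Gaudin.index P, ∀ b ∈ Gaudin.index P,
      Gaudin.poissonHat P (Gaudin.Ham P a.1 a.2) (Gaudin.Ham P b.1 b.2) = 0) ∧
    (∀ a ∈ Gaudin.index P, ∀ z ∈ Gaudin.regular P,
      Gaudin.actHat P (Gaudin.Ham P a.1 a.2) (Gaudin.Lax P z) =
        Gaudin.auxHat P (Gaudin.Mat P a.1 a.2 z) (Gaudin.Lax P z)) := by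
  refine ⟨fun z hz => Gaudin.half_square_Lax_eq hz, fun a ha b hb => Gaudin.poissonL_Ham a ha b hb,
    fun a ha z hz => Gaudin.lax_equation a ha hz⟩
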